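/- A set system $(U,\mathcal F)$ consists of a finite set $U=\{0,\dots,n-1\}$ of labelled elements, $n=|U|$, and a family $\mathcal F\subseteq 2^U$ of solutions. It is commutable if $\emptyset\in\mathcal F$; for all $X\subset Y$ in $\mathcal F$ there is $z\in Y\setminus X$ with $X\cup\{z\}\in\mathcal F$; and for all $X\subset Y$ in $\mathcal F$ with $X\neq\emptyset$ and all $a,b\in Y\setminus X$, if $X\cup\{a\},X\cup\{b\}\in\mathcal F$ then $X\cup\{a,b\}\in\mathcal F$. A maximal solution is an inclusion-maximal member of $\mathcal F$; $q$ is the maximum size of a solution. For $X\in\mathcal F$ and $A\subseteq U$ let $X^+_A=\{a\in A\setminus X: X\cup\{a\}\in\mathcal F\}$ and $X^+=X^+_U$; let $Z=\{x:\{x\}\in\mathcal F\}$, and for $X\ne\emptyset$ let $\mathrm{source}(X)=\min(X\cap Z)$. Put $B_0=\{\mathrm{source}(X)\}$, $B_i=B_{i-1}\cup(B_{i-1}^+\cap X)$, and for $y\in X^+$ let $\mathrm{lay}^X(y)=\min\{i\ge 1: y\in B_{i-1}^+\}$. Let $\mathrm{choose}(X,A)$ be the $y\in X^+_A$ with lexicographically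 least pair $\langle \mathrm{lay}^X(y),y\rangle$, and let $\mathrm{complete}(X,A)$ be obtained from $X$ by repeatedly adding $\mathrm{choose}(X,A)$ to $X$ while $X^+_A\neq\emptyset$; write $\mathrm{complete}(X)=\mathrm{complete}(X,U)$. The canonical order $s_1,\dots,s_{|S|}$ of a nonempty maximal solution $S$ starts with $s_1=\mathrm{source}(S)$ and continues in the order in which $\mathrm{complete}(\{s_1\},S)$ adds elements; $S[j]=\{s_1,\dots,s_j\}$. Let $j$ be least with $\mathrm{complete}(S[j])=S$ and put $\mathrm{pi}(S)=s_j$. If $j>1$, let $\mathrm{core}(S)=S[j-1]$, $\mathrm{parent}(S)=\mathrm{complete}(\mathrm{core}(S))$ and $r(S)=\mathrm{complete}(\mathrm{core}(S)\cup\{\mathrm{pi}(S)\},\ \mathrm{parent}(S)\cup\{\mathrm{pi}(S)\})$; if $j=1$, $S$ is a root, for which $\mathrm{core}$, $\mathrm{parent}$ and $r$ are undefined. The model is a random access machine with words of $O(\log n)$ bits (for $n\ge 2$) that can test whether a listed set $X\subseteq U$ belongs to $\mathcal F$ in time $\mathscr G_T\ge 1$ and working space $\mathscr G_S$ words, where $\mathscr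 G_S=\Omega(q)$; the output is write-only and is not counted as space. Theorem. There is an algorithm (one program for all inputs) such that, for every commutable set system $(U,\mathcal F)$ given by such a membership test, every maximal solution $P$, every $w\in U\setminus P$, and every solution $R$ of the restricted problem $\mathrm{restr}(P,w)$, i.e. every inclusion-maximal member $R\ne P$ of $\{X\in\mathcal F: X\subseteq P\cup\{w\}\}$, given $n$, $w$ and lists of the elements of $P$ and $R$, it outputs each maximal solution $S$ with $\mathrm{parent}(S)=P$, $\mathrm{pi}(S)=w$ and $r(S)=R$ exactly once, and no other set, in time $O(q^3\,|U|\,\mathscr G_T)$ and space $O(\mathscr G_S)$. The constant in the time bound is absolute; the one in the space bound depends only on the constant in $\mathscr G_S=\Omega(q)$. -/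

import Mathlib

namespace MaxEnum

/-! ### Set systems and canonical orders -/

section SetSystems

variable {U : Type} [Fintype U] [LinearOrder U]

/-- Strong accessibility of the set system `(U, F)`. -/
def StronglyAccessible (F : Finset (Finset U)) : Prop :=
  ∀ X ∈ F, ∀ Y ∈ F, X ⊂ Y → ∃ z ∈ Y \ X, insert z X ∈ F

/-- A commutable set system: it contains the empty set, is strongly accessible, and two elements
of a larger solution `Y` that can each be added to a nonempty solution `X ⊂ Y` can be added
together. -/
structure Commutable (F : Finset (Finset U)) : Prop where
  empty_mem : ∅ ∈ F
  stronglyAccessible : StronglyAccessible F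
  commute : ∀ X ∈ F, ∀ Y ∈ F, X.Nonempty → X ⊂ Y → ∀ a ∈ Y \ X, ∀ b ∈ Y \ X,
    insert a X ∈ F → insert b X ∈ F → insert a (insert b X) ∈ F

/-- The maximal solutions. -/
def IsMaximalSolution (F : Finset (Finset U)) (S : Finset U) : Prop :=
  Maximal (fun X => X ∈ F) S

/-- The solutions of the restricted problem `restr(P, w)`: the inclusion-maximal members, other
than `P`, of the set system `(P ∪ {w}, F)`. -/
def IsRestrSolution (F : Finset (Finset U)) (P : Finset U) (w : U) (R : Finset U) : Prop :=
  Maximal (fun X => X ∈ F ∧ X ⊆ insert w P) R ∧ R ≠ P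

/-- The maximum size `q` of a solution. -/
def maxSize (F : Finset (Finset U)) : ℕ := F.sup Finset.card

/-- `X⁺_A`, the elements of `A` that can be added to `X`. -/
def ext (F : Finset (Finset U)) (X A : Finset U) : Finset U :=
  A.filter fun a => a ∉ X ∧ insert a X ∈ F

/-- The set `Z` of good singletons. -/
def singles (F : Finset (Finset U)) : Finset U :=
  Finset.univ.filter fun x => {x} ∈ F

/-- The smallest element of `X ∩ Z`. -/
def source (F : Finset (Finset U)) (X : Finset U) : Option U :=
  if h : (X ∩ singles F).Nonempty then some ((X ∩ singles F).min' h) else none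

/-- The sets `B_0 = {t}`, `B_{i+1} = B_i ∪ (B_i⁺ ∩ X)`. -/
def ball (F : Finset (Finset U)) (X : Finset U) (t : U) : ℕ → Finset U
  | 0 => {t}
  | i + 1 => ball F X t i ∪ (ext F (ball F X t i) Finset.univ ∩ X)

/-- The layer of `y` relatively to `X` from `t`: the least `i > 0` such that `y ∈ B_{i-1}⁺`
(and `0` for `y = t`). -/
noncomputable def layerFrom (F : Finset (Finset U)) (X : Finset U) (t y : U) : ℕ :=
  sInf {i | 0 < i ∧ y ∈ ext F (ball F X t (i - 1)) Finset.univ}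

/-- The layer of `y` relatively to `X` from the source of `X`. -/
noncomputable def layer (F : Finset (Finset U)) (X : Finset U) (y : U) : ℕ :=
  match source F X with
  | some t => layerFrom F X t y
  | none => 0

/-- The pairs `⟨layer of y, y⟩`, ordered lexicographically, for `y ∈ X⁺_A`. -/
noncomputable def keys (F : Finset (Finset U)) (X A : Finset U) : Finset (ℕ ×ₗ U) :=
  (ext F X A).image fun y => toLex (layer F X y, y)

/-- `choose(X, A)`: the element of `X⁺_A` whose pair is the least one, if `X⁺_A` is nonempty. -/
noncomputable def choose (F : Finset (Finset U)) (X A : Finset U) : Option U :=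
  if h : (keys F X A).Nonempty then some (ofLex ((keys F X A).min' h)).2 else none

/-- One iteration of the loop of `complete`. -/
noncomputable def completeStep (F : Finset (Finset U)) (A X : Finset U) : Finset U :=
  match choose F X A with
  | some x => insert x X
  | none => X

/-- `complete(X, A)`: add chosen elements of `X⁺_A` to `X` as long as there are any. Every
effective iteration adds an element, so `|U|` iterations suffice, and further ones do nothing. -/
noncomputable def complete (F : Finset (Finset U)) (X A : Finset U) : Finset U :=
  (completeStep F A)^[Fintype.card U] X

/-- The prefix of length `k + 1` of the canonical order of `S`, that is, of the order in which
`complete({source(S)}, S)` collects the elements of `S`. -/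
noncomputable def canonPrefix (F : Finset (Finset U)) (S : Finset U) (k : ℕ) : Finset U :=
  match source F S with
  | some s => (completeStep F S)^[k] {s}
  | none => ∅

/-- The number of elements of the canonical order of `S` that precede `pi(S)`: the prefix ending
in `pi(S)` is the shortest one whose completion is `S`. -/
noncomputable def piIndex (F : Finset (Finset U)) (S : Finset U) : ℕ :=
  sInf {k | complete F (canonPrefix F S k) Finset.univ = S}

/-- `core(S)`, the prefix of the canonical order that precedes `pi(S)`; undefined for roots. -/
noncomputable def core (F : Finset (Finset U)) (S : Finset U) : Option (Finset U) :=
  if piIndex F S = 0 then none else some (canonPrefix F S (piIndex F S - 1))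

/-- `pi(S)`: the source for a root, otherwise the element that follows `core(S)` in the
canonical order. -/
noncomputable def pi (F : Finset (Finset U)) (S : Finset U) : Option U :=
  match core F S with
  | some C => choose F C S
  | none => source F S

/-- `parent(S) = complete(core(S))`; undefined for roots. -/
noncomputable def parent (F : Finset (Finset U)) (S : Finset U) : Option (Finset U) :=
  match core F S with
  | some C => some (complete F C Finset.univ)
  | none => none

/-- `r(S) = complete(core(S) ∪ {pi(S)}, parent(S) ∪ {pi(S)})`; undefined for roots. -/
noncomputable def restrOf (F : Finset (Finset U)) (S : Finset U) : Option (Finset U) :=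
  match core F S, pi F S, parent F S with
  | some C, some w, some P => some (complete F (insert w C) (insert w P))
  | _, _, _ => none

end SetSystems

/-! ### Word random access machines with a membership test

Programs have `r` registers and `b` memory banks, where `r` and `b` are part of the program. The
cells of a bank are addressed by computed numbers. Besides the usual instructions there is a
membership test for a set of elements that is listed in an initial segment of a bank. -/

/-- Expressions over registers and memory cells. -/
inductive Expr (r b : ℕ) : Type
  /-- a constant -/
  | lit (v : ℕ)
  /-- the content of a register -/
  | reg (i : Fin r)
  /-- the content of a memory cell with a computed address -/
  | cell (k : Fin b) (a : Expr r b)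
  | add (e f : Expr r b)
  /-- truncated subtraction -/
  | sub (e f : Expr r b)
  /-- `1` if the values are equal and `0` otherwise -/
  | eq (e f : Expr r b)
  /-- `1` if the first value is less than the second and `0` otherwise -/
  | lt (e f : Expr r b)

/-- Programs. -/
inductive Prog (r b : ℕ) : Type
  | skip
  /-- write a value into a register -/
  | assign (i : Fin r) (e : Expr r b)
  /-- write a value into a memory cell with a computed address -/
  | store (k : Fin b) (a e : Expr r b)
  /-- write into a register whether the set listed in the first `e` cells of a bank is a
  solution -/
  | test (i : Fin r) (k : Fin b) (e : Expr r b)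
  /-- append a number to the write-only output -/
  | emit (e : Expr r b)
  | seq (c d : Prog r b)
  /-- run the first branch if the value is nonzero and the second one if it is zero -/
  | branch (e : Expr r b) (c d : Prog r b)
  /-- repeat the body as long as the value is nonzero -/
  | loop (e : Expr r b) (c : Prog r b)

/-- The contents of registers and memory, and the output written so far. -/
structure State (r b : ℕ) where
  reg : Fin r → ℕ
  mem : Fin b → ℕ → ℕ
  out : List ℕ

/-- Write `v` into register `i`. -/
def State.setReg {r b : ℕ} (σ : State r b) (i : Fin r) (v : ℕ) : State r b :=
  { σ with reg := Function.update σ.reg i v }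

/-- Write `v` into cell `a` of bank `k`. -/
def State.setCell {r b : ℕ} (σ : State r b) (k : Fin b) (a v : ℕ) : State r b :=
  { σ with mem := Function.update σ.mem k (Function.update (σ.mem k) a v) }

/-- What a run depends on apart from program and input: the set system on `{0, …, n-1}` behind
the membership test, the time that a test costs, the number of cells of each bank, and the
largest number that fits into a register or a cell. -/
structure Env (n : ℕ) where
  family : Finset (Finset (Fin n))
  testTime : ℕ
  bankSize : ℕ
  wordMax : ℕ

namespace Expr

variable {r b : ℕ}

def eval (σ : State r b) : Expr r b → ℕ
  | lit v => v
  | reg i => σ.reg i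
  | cell k a => σ.mem k (a.eval σ)
  | add e f => e.eval σ + f.eval σ
  | sub e f => e.eval σ - f.eval σ
  | eq e f => if e.eval σ = f.eval σ then 1 else 0
  | lt e f => if e.eval σ < f.eval σ then 1 else 0

/-- The number of operations in an expression, which is the time to evaluate it. -/
def size : Expr r b → ℕ
  | lit _ => 1
  | reg _ => 1
  | cell _ a => a.size + 1
  | add e f => e.size + f.size + 1
  | sub e f => e.size + f.size + 1
  | eq e f => e.size + f.size + 1
  | lt e f => e.size + f.size + 1

/-- All cells that are read while evaluating the expression exist if banks have `m` cells. -/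
def InBounds (m : ℕ) (σ : State r b) : Expr r b → Prop
  | lit _ => True
  | reg _ => True
  | cell _ a => a.InBounds m σ ∧ a.eval σ < m
  | add e f => e.InBounds m σ ∧ f.InBounds m σ
  | sub e f => e.InBounds m σ ∧ f.InBounds m σ
  | eq e f => e.InBounds m σ ∧ f.InBounds m σ
  | lt e f => e.InBounds m σ ∧ f.InBounds m σ

end Expr

/-- `Exec E c σ σ' t`: started in `σ`, the program `c` halts in `σ'` after `t` time units, never
accessing a cell outside the banks and never writing a number above `E.wordMax` into a register
or a cell. Programs are deterministic. -/
inductive Exec {n r b : ℕ} (E : Env n) : Prog r b → State r b → State r b → ℕ → Prop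
  | skip (σ : State r b) : Exec E .skip σ σ 1
  | assign (σ : State r b) (i : Fin r) (e : Expr r b)
      (he : e.InBounds E.bankSize σ) (hw : e.eval σ ≤ E.wordMax) :
      Exec E (.assign i e) σ (σ.setReg i (e.eval σ)) (e.size + 1)
  | store (σ : State r b) (k : Fin b) (a e : Expr r b)
      (ha : a.InBounds E.bankSize σ) (he : e.InBounds E.bankSize σ)
      (hk : a.eval σ < E.bankSize) (hw : e.eval σ ≤ E.wordMax) :
      Exec E (.store k a e) σ
        (σ.setCell k (a.eval σ) (e.eval σ))
        (a.size + e.size + 1)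
  | test (σ : State r b) (i : Fin r) (k : Fin b) (e : Expr r b) (l : List (Fin n))
      (he : e.InBounds E.bankSize σ) (hk : e.eval σ ≤ E.bankSize) (hl : l.Nodup)
      (hm : l.map Fin.val = (List.range (e.eval σ)).map (σ.mem k)) (hw : 1 ≤ E.wordMax) :
      Exec E (.test i k e) σ
        (σ.setReg i (if l.toFinset ∈ E.family then 1 else 0))
        (e.size + E.testTime)
  | emit (σ : State r b) (e : Expr r b) (he : e.InBounds E.bankSize σ) :
      Exec E (.emit e) σ { σ with out := σ.out ++ [e.eval σ] } (e.size + 1)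
  | seq {c d : Prog r b} {σ₁ σ₂ σ₃ : State r b} {t u : ℕ}
      (hc : Exec E c σ₁ σ₂ t) (hd : Exec E d σ₂ σ₃ u) :
      Exec E (.seq c d) σ₁ σ₃ (t + u)
  | branch_true {e : Expr r b} {c d : Prog r b} {σ σ' : State r b} {t : ℕ}
      (he : e.InBounds E.bankSize σ) (hv : e.eval σ ≠ 0) (hc : Exec E c σ σ' t) :
      Exec E (.branch e c d) σ σ' (e.size + t)
  | branch_false {e : Expr r b} {c d : Prog r b} {σ σ' : State r b} {t : ℕ}
      (he : e.InBounds E.bankSize σ) (hv : e.eval σ = 0) (hd : Exec E d σ σ' t) :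
      Exec E (.branch e c d) σ σ' (e.size + t)
  | loop_true {e : Expr r b} {c : Prog r b} {σ₁ σ₂ σ₃ : State r b} {t u : ℕ}
      (he : e.InBounds E.bankSize σ₁) (hv : e.eval σ₁ ≠ 0) (hc : Exec E c σ₁ σ₂ t)
      (hd : Exec E (.loop e c) σ₂ σ₃ u) :
      Exec E (.loop e c) σ₁ σ₃ (e.size + t + u)
  | loop_false {e : Expr r b} {c : Prog r b} {σ : State r b}
      (he : e.InBounds E.bankSize σ) (hv : e.eval σ = 0) :
      Exec E (.loop e c) σ σ e.size

/-- The initial state for the ground set `{0, …, n-1}`, the element `w`, and lists of the elements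
of `P` and `R`: the registers `0, 1, 2, 3` hold `n`, `w` and the lengths of the two lists, which
are stored in the banks `0` and `1`; everything else is `0` and the output is empty. -/
def inputState (r b : ℕ) {n : ℕ} (w : Fin n) (p l : List (Fin n)) : State r b where
  reg i := match i.val with
    | 0 => n
    | 1 => w.val
    | 2 => p.length
    | 3 => l.length
    | _ => 0
  mem k j := match k.val with
    | 0 => (p.map Fin.val).getD j 0
    | 1 => (l.map Fin.val).getD j 0
    | _ => 0
  out := []

/-- The output that consists of the given solutions, each written as its size followed by its
elements. -/
def encode {n : ℕ} (L : List (List (Fin n))) : List ℕ :=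
  L.flatMap fun s => s.length :: s.map Fin.val

/-- `L` lists every set with the property `A` exactly once, and no other set. -/
def Enumerates {n : ℕ} (L : List (List (Fin n))) (A : Finset (Fin n) → Prop) : Prop :=
  (∀ s ∈ L, s.Nodup) ∧ (L.map List.toFinset).Nodup ∧
    ∀ S : Finset (Fin n), S ∈ L.map List.toFinset ↔ A S

end MaxEnum

namespace MaxEnum

/-! Call the pair ⟨layer, element⟩ the key of an addable element. Two monotonicity facts carry the
combinatorics, both for a fixed source. By commutability the balls only grow with the solution, so
the layer of an element that stays addable can only drop (`Commutable.layer_anti`). Along a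
canonical order the keys of the chosen elements strictly increase (`Commutable.key_lt_of_choose`).

Together they show that the core of a child can be read off from `R`. Let `S` be a child with source
`s`, and let `S[k]` be its core followed by `w`; it lies in `R` and completes to `S`. Suppose
`complete({s}, R)` left the canonical order of `S` before `S[k]`, preferring some `y` to the element
`x` that is due. Then `y ∉ S`, and `y` can still be added to `S[k]`, with a key that has not grown
and so is below that of `x`. But the next element which the unrestricted completion of `S[k]` takes
lies in `S`, so its key is above that of `x`, although `y` was available: a contradiction
(`Commutable.choose_canonPrefix_eq`). Hence `core(S)` is exactly what `complete({s}, R)` has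
collected when it chooses `w` (`IsChild.prefixBefore`), and `S = complete(core(S) ∪ {w})`.

So a source determines at most one child, and the source of every child lies in `R`. For each good
singleton `s` of `R` the program computes the only possible core `C` and accepts the only candidate
if recomputing parent, restricted solution, source and canonical order confirms it
(`Commutable.isChild_iff`). Children with different sources are different sets, so nothing is output
twice and no earlier output has to be stored.

For the resources: the balls of a set `X` take `O(q²)` tests, and then each of the `n` elements
needs `O(q)` tests to find whether it is addable and what its layer is, so one choice costs `O(qn)`
tests. A completion makes `O(q)` choices, each source needs a bounded number of completions, and
there are at most `q` sources, which gives `O(q³n)` tests. A bounded number of lists of length `q +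
O(1)` is kept. The predicate `Runs` states total correctness with a time bound, and the subroutines
are combined up to `runs_listChildren`. -/

theorem mem_ext {U : Type} [LinearOrder U] {F : Finset (Finset U)} {X A : Finset U} {a : U} :
    a ∈ ext F X A ↔ a ∈ A ∧ a ∉ X ∧ insert a X ∈ F := by
  simp [ext]

/-! ### Exchange properties and sources in commutable set systems -/

section SetSystemFacts

variable {U : Type} [Fintype U] [LinearOrder U] {F : Finset (Finset U)}

theorem ext_subset_ext_univ {X A : Finset U} : ext F X A ⊆ ext F X Finset.univ := fun _ ha =>
  mem_ext.2 ⟨Finset.mem_univ _, (mem_ext.1 ha).2⟩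

/-- An element of `Y` that can be added to a nonempty solution can be added to every larger
solution inside `Y`. -/
theorem Commutable.insert_mem (hF : Commutable F) {B B' Y : Finset U} {a : U}
    (hB : B ∈ F) (hne : B.Nonempty) (hB' : B' ∈ F) (hY : Y ∈ F) (h₁ : B ⊆ B') (h₂ : B' ⊆ Y)
    (ha : a ∈ Y) (hab : insert a B ∈ F) : insert a B' ∈ F := by
  -- Strong accessibility moves `B` towards `B'` one element `z` at a time, and commuting `a` with
  -- `z` inside `Y` keeps `a` addable.
  induction hk : (B' \ B).card generalizing B with
  | zero =>
    have : B' ⊆ B := by simpa [Finset.sdiff_eq_empty_iff_subset] using hk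
    rwa [h₁.antisymm this] at hab
  | succ k ih =>
    by_cases haB' : a ∈ B'
    · rwa [Finset.insert_eq_of_mem haB']
    have hss : B ⊂ B' := by
      refine h₁.ssubset_of_ne ?_
      rintro rfl
      simp at hk
    obtain ⟨z, hz, hzF⟩ := hF.stronglyAccessible B hB B' hB' hss
    rw [Finset.mem_sdiff] at hz
    have haB : a ∉ B := fun h => haB' (h₁ h)
    have h := hF.commute B hB Y hY hne (hss.trans_subset h₂) a (by simp [ha, haB]) z
      (by simp [h₂ hz.1, hz.2]) hab hzF
    refine ih hzF (by simp) (Finset.insert_subset hz.1 h₁) h ?_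
    have : B' \ insert z B = (B' \ B).erase z := by
      ext; simp only [Finset.mem_sdiff, Finset.mem_insert, Finset.mem_erase]; tauto
    rw [this, Finset.card_erase_of_mem (by simp [hz]), hk]; rfl

/-- The elements of `D` are added one after another; each stays addable by `Commutable.insert_mem`.
This is why balls, which absorb a whole layer at once, are solutions. -/
theorem Commutable.union_mem (hF : Commutable F) {B Y D : Finset U} (hB : B ∈ F)
    (hne : B.Nonempty) (hY : Y ∈ F) (hBY : B ⊆ Y) (hDY : D ⊆ Y)
    (hD : ∀ d ∈ D, insert d B ∈ F) : B ∪ D ∈ F := by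
  induction D using Finset.induction_on with
  | empty => simpa
  | insert d D hd ih =>
    rw [Finset.union_insert]
    have hDY' : D ⊆ Y := fun x hx => hDY (Finset.mem_insert_of_mem hx)
    exact hF.insert_mem hB hne (ih hDY' fun x hx => hD x (Finset.mem_insert_of_mem hx)) hY
      Finset.subset_union_left (Finset.union_subset hBY hDY') (hDY (Finset.mem_insert_self _ _))
      (hD d (Finset.mem_insert_self _ _))

theorem mem_source {X : Finset U} {t : U} (h : source F X = some t) : t ∈ X ∧ {t} ∈ F := by
  unfold source at h
  split_ifs at h with h'
  have := Finset.min'_mem _ h'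
  rw [Option.some.inj h] at this
  simpa [singles] using this

theorem source_eq_some_iff {X : Finset U} {t : U} :
    source F X = some t ↔ t ∈ X ∧ {t} ∈ F ∧ ∀ x ∈ X, {x} ∈ F → t ≤ x := by
  constructor
  · intro h
    refine ⟨(mem_source h).1, (mem_source h).2, fun x hx hxF => ?_⟩
    unfold source at h
    split_ifs at h with h'
    rw [← Option.some.inj h]
    exact Finset.min'_le _ _ (by simp [singles, hx, hxF])
  · rintro ⟨h₁, h₂, h₃⟩
    have hne : (X ∩ singles F).Nonempty := ⟨t, by simp [singles, h₁, h₂]⟩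
    unfold source
    rw [dif_pos hne]
    congr 1
    refine le_antisymm (Finset.min'_le _ _ (by simp [singles, h₁, h₂])) ?_
    have := Finset.min'_mem _ hne
    simp only [singles, Finset.mem_inter, Finset.mem_filter, Finset.mem_univ, true_and] at this
    exact h₃ _ this.1 this.2

theorem Commutable.exists_source (hF : Commutable F) {X : Finset U} (hX : X ∈ F)
    (hne : X.Nonempty) : ∃ t, source F X = some t := by
  obtain ⟨z, hz, hzF⟩ := hF.stronglyAccessible ∅ hF.empty_mem X hX
    (Finset.empty_ssubset.2 hne)
  have hne : (X ∩ singles F).Nonempty := ⟨z, by simpa [singles] using And.intro hz hzF⟩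
  exact ⟨_, by rw [source, dif_pos hne]⟩

/-! ### Balls and layers -/

section Balls

variable {X : Finset U} {t : U}

theorem ball_subset (ht : t ∈ X) (i : ℕ) : ball F X t i ⊆ X := by
  induction i with
  | zero => simpa [ball] using ht
  | succ i ih => exact Finset.union_subset ih Finset.inter_subset_right

theorem ball_subset_succ (i : ℕ) : ball F X t i ⊆ ball F X t (i + 1) := Finset.subset_union_left

theorem ball_mono {i j : ℕ} (h : i ≤ j) : ball F X t i ⊆ ball F X t j :=
  monotone_nat_of_le_succ (f := ball F X t) ball_subset_succ h

theorem mem_ball_self (i : ℕ) : t ∈ ball F X t i :=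
  ball_mono (Nat.zero_le i) (by simp [ball])

theorem mem_ball_succ {i : ℕ} {x : U} :
    x ∈ ball F X t (i + 1) ↔ x ∈ ball F X t i ∨ x ∈ X ∧ insert x (ball F X t i) ∈ F := by
  simp only [ball, Finset.mem_union, Finset.mem_inter, mem_ext, Finset.mem_univ, true_and]
  tauto

variable (hF : Commutable F) (hX : X ∈ F) (ht : t ∈ X) (htF : {t} ∈ F)
include hF hX ht htF

theorem ball_mem (i : ℕ) : ball F X t i ∈ F := by
  induction i with
  | zero => simpa [ball] using htF
  | succ i ih =>
    refine hF.union_mem ih ⟨t, mem_ball_self i⟩ hX (ball_subset ht i) Finset.inter_subset_right ?_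
    intro d hd
    exact (mem_ext.1 (Finset.mem_inter.1 hd).1).2.2

/-- Strong accessibility between the ball and `X` supplies an addable element of `X`, which enters
the next ball. -/
theorem ball_ssubset_succ {i : ℕ} (h : ball F X t i ≠ X) :
    ball F X t i ⊂ ball F X t (i + 1) := by
  obtain ⟨z, hz, hzF⟩ := hF.stronglyAccessible _ (ball_mem hF hX ht htF i) X hX
    ((ball_subset ht i).ssubset_of_ne h)
  rw [Finset.mem_sdiff] at hz
  exact (Finset.ssubset_iff_of_subset (ball_subset_succ i)).2
    ⟨z, mem_ball_succ.2 (Or.inr ⟨hz.1, hzF⟩), hz.2⟩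

/-- Balls gain an element at every step until they fill `X`. This bounds the number of balls, and
with it all layers, by the size of `X`. -/
theorem lt_card_ball (i : ℕ) : ball F X t i = X ∨ i < (ball F X t i).card := by
  induction i with
  | zero => right; simp [ball]
  | succ i ih =>
    by_cases h : ball F X t i = X
    · left
      exact (ball_subset ht _).antisymm (h.symm.subset.trans (ball_subset_succ i))
    · right
      have := Finset.card_lt_card (ball_ssubset_succ hF hX ht htF h)
      have := ih.resolve_left h
      omega

theorem exists_ball_eq : ∃ i, ball F X t i = X := by
  refine ⟨X.card, (lt_card_ball hF hX ht htF X.card).resolve_right ?_⟩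
  have := Finset.card_le_card (ball_subset (F := F) ht X.card)
  omega

/-- Some ball equals `X`, so an element addable to `X` has a layer and the infimum is attained
instead of taking its default value `0`. -/
theorem layerFrom_spec {y : U} (hy : y ∈ ext F X Finset.univ) :
    0 < layerFrom F X t y ∧
      y ∈ ext F (ball F X t (layerFrom F X t y - 1)) Finset.univ := by
  obtain ⟨i, hi⟩ := exists_ball_eq hF hX ht htF
  exact Nat.sInf_mem (s := {i | 0 < i ∧ y ∈ ext F (ball F X t (i - 1)) Finset.univ})
    ⟨i + 1, by simp, by simpa [hi] using hy⟩

end Balls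

theorem layerFrom_le {X : Finset U} {t y : U} {i : ℕ}
    (h : y ∈ ext F (ball F X t i) Finset.univ) : layerFrom F X t y ≤ i + 1 :=
  Nat.sInf_le ⟨Nat.succ_pos i, by simpa using h⟩

theorem layer_eq {X : Finset U} {t y : U} (h : source F X = some t) :
    layer F X y = layerFrom F X t y := by
  simp [layer, h]

/-! ### Choosing and completing -/

theorem choose_eq_none_iff {X A : Finset U} : choose F X A = none ↔ ext F X A = ∅ := by
  unfold choose
  split_ifs with h
  · have : (ext F X A).Nonempty := by simpa [keys] using h
    simpa using this.ne_empty
  · simpa [keys, Finset.not_nonempty_iff_eq_empty] using h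

theorem choose_eq_some_iff {X A : Finset U} {x : U} :
    choose F X A = some x ↔ x ∈ ext F X A ∧
      ∀ y ∈ ext F X A, toLex (layer F X x, x) ≤ toLex (layer F X y, y) := by
  constructor
  · intro h
    unfold choose at h
    split_ifs at h with hne
    have hx := Option.some.inj h
    have hm := Finset.min'_mem _ hne
    obtain ⟨z, hz, hzm⟩ := Finset.mem_image.1 hm
    have : z = x := by rw [← hx, ← hzm]; rfl
    subst this
    refine ⟨hz, fun y hy => ?_⟩
    rw [hzm]
    exact Finset.min'_le _ _ (Finset.mem_image_of_mem _ hy)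
  · rintro ⟨hx, hmin⟩
    have hne : (keys F X A).Nonempty := ⟨_, Finset.mem_image_of_mem _ hx⟩
    have : (keys F X A).min' hne = toLex (layer F X x, x) := by
      refine le_antisymm (Finset.min'_le _ _ (Finset.mem_image_of_mem _ hx)) ?_
      refine Finset.le_min' _ _ _ fun k hk => ?_
      obtain ⟨y, hy, rfl⟩ := Finset.mem_image.1 hk
      exact hmin y hy
    rw [choose, dif_pos hne, this]; rfl

theorem mem_ext_of_choose {X A : Finset U} {x : U} (h : choose F X A = some x) :
    x ∈ ext F X A := (choose_eq_some_iff.1 h).1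

/-- Keys depend on `X` only, not on the set of candidates, so a minimum over `B` that lies in `A` is
also the minimum over `A`. -/
theorem choose_of_subset {X A B : Finset U} {x : U} (hAB : A ⊆ B) (hx : x ∈ A)
    (h : choose F X B = some x) : choose F X A = some x := by
  rw [choose_eq_some_iff] at h ⊢
  refine ⟨mem_ext.2 ⟨hx, (mem_ext.1 h.1).2⟩, fun y hy => h.2 y ?_⟩
  exact mem_ext.2 ⟨hAB (mem_ext.1 hy).1, (mem_ext.1 hy).2⟩

theorem completeStep_of_choose {X A : Finset U} {x : U} (h : choose F X A = some x) :
    completeStep F A X = insert x X := by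
  simp [completeStep, h]

theorem completeStep_of_none {X A : Finset U} (h : choose F X A = none) :
    completeStep F A X = X := by
  simp [completeStep, h]

theorem subset_completeStep (A X : Finset U) : X ⊆ completeStep F A X := by
  unfold completeStep; split <;> simp

theorem completeStep_mem {A X : Finset U} (hX : X ∈ F) : completeStep F A X ∈ F := by
  rcases h : choose F X A with _ | x
  · rwa [completeStep_of_none h]
  · rw [completeStep_of_choose h]; exact (mem_ext.1 (mem_ext_of_choose h)).2.2

theorem completeStep_subset {A X : Finset U} (hX : X ⊆ A) : completeStep F A X ⊆ A := by
  rcases h : choose F X A with _ | x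
  · rwa [completeStep_of_none h]
  · rw [completeStep_of_choose h]
    exact Finset.insert_subset (mem_ext.1 (mem_ext_of_choose h)).1 hX

theorem iterate_mono (A X : Finset U) {i j : ℕ} (h : i ≤ j) :
    (completeStep F A)^[i] X ⊆ (completeStep F A)^[j] X :=
  monotone_nat_of_le_succ (f := fun i => (completeStep F A)^[i] X)
    (fun i => by simpa only [Function.iterate_succ_apply'] using subset_completeStep A _) h

theorem subset_iterate (A X : Finset U) (i : ℕ) : X ⊆ (completeStep F A)^[i] X :=
  iterate_mono A X (Nat.zero_le i)

theorem iterate_mem {A X : Finset U} (hX : X ∈ F) (i : ℕ) : (completeStep F A)^[i] X ∈ F := by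
  induction i with
  | zero => exact hX
  | succ i ih => rw [Function.iterate_succ_apply']; exact completeStep_mem ih

theorem iterate_subset {A X : Finset U} (hX : X ⊆ A) (i : ℕ) :
    (completeStep F A)^[i] X ⊆ A := by
  induction i with
  | zero => exact hX
  | succ i ih => rw [Function.iterate_succ_apply']; exact completeStep_subset ih

theorem iterate_of_none {A X : Finset U} {k : ℕ}
    (h : choose F ((completeStep F A)^[k] X) A = none) {i : ℕ} (hi : k ≤ i) :
    (completeStep F A)^[i] X = (completeStep F A)^[k] X := by
  induction i, hi using Nat.le_induction with
  | base => rfl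
  | succ i _ ih => rw [Function.iterate_succ_apply', ih, completeStep_of_none h]

/-- Each effective step adds an element, so the process has stopped after as many steps as the
ground set has elements. -/
theorem choose_complete (X A : Finset U) : choose F (complete F X A) A = none := by
  have key : ∀ k, choose F ((completeStep F A)^[k] X) A = none ∨
      k + 1 ≤ ((completeStep F A)^[k + 1] X).card := by
    intro k
    induction k with
    | zero =>
      rcases h : choose F X A with _ | x
      · left; exact h
      · right; simp [completeStep_of_choose h]
    | succ k ih =>
      rcases h : choose F ((completeStep F A)^[k + 1] X) A with _ | x
      · left; rfl
      · right
        rcases ih with ih | ih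
        · rw [iterate_of_none ih (Nat.le_succ k), ih] at h; simp at h
        · rw [Function.iterate_succ_apply', completeStep_of_choose h,
            Finset.card_insert_of_notMem (mem_ext.1 (mem_ext_of_choose h)).2.1]
          omega
  -- For `k` equal to the size of the ground set, the other alternative asks for a subset that is
  -- too large.
  refine (key _).resolve_right fun h => ?_
  have := Finset.card_le_univ ((completeStep F A)^[Fintype.card U + 1] X)
  omega

theorem complete_eq_of_none {A X : Finset U} {k : ℕ}
    (h : choose F ((completeStep F A)^[k] X) A = none) :
    complete F X A = (completeStep F A)^[k] X := by
  rcases le_total k (Fintype.card U) with hk | hk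
  · exact iterate_of_none h hk
  · exact (iterate_of_none (choose_complete X A) hk).symm

theorem complete_completeStep (A X : Finset U) :
    complete F (completeStep F A X) A = complete F X A := by
  rw [complete, ← Function.iterate_succ_apply]
  exact iterate_of_none (choose_complete X A) (Nat.le_succ _)

theorem subset_complete (X A : Finset U) : X ⊆ complete F X A := subset_iterate _ _ _

theorem complete_mem {X A : Finset U} (hX : X ∈ F) : complete F X A ∈ F := iterate_mem hX _

/-- A larger solution would provide, by strong accessibility, an element that can still be added. -/
theorem Commutable.isMaximalSolution_complete (hF : Commutable F) {X : Finset U} (hX : X ∈ F) :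
    IsMaximalSolution F (complete F X Finset.univ) := by
  refine ⟨complete_mem hX, fun Y hY hle => ?_⟩
  by_contra hnot
  obtain ⟨z, hz, hzF⟩ := hF.stronglyAccessible _ (complete_mem hX) Y hY ⟨hle, hnot⟩
  have := choose_eq_none_iff.1 (choose_complete (F := F) X Finset.univ)
  have hz' : z ∈ ext F (complete F X Finset.univ) Finset.univ :=
    mem_ext.2 ⟨Finset.mem_univ _, (Finset.mem_sdiff.1 hz).2, hzF⟩
  rw [this] at hz'
  simp at hz'

end SetSystemFacts

/-! ### Monotonicity of layers and keys -/

section CanonicalOrders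

variable {U : Type} [Fintype U] [LinearOrder U] {F : Finset (Finset U)}

/-- Each ball of `X` is contained in the ball of `Y` with the same index, and an element addable to
the smaller ball is addable to the larger one, inside the solution `Y ∪ {y}`. -/
theorem Commutable.layer_anti (hF : Commutable F) {X Y : Finset U} {t y : U} (hX : X ∈ F)
    (hY : Y ∈ F) (hXY : X ⊆ Y) (hsX : source F X = some t) (hsY : source F Y = some t)
    (hyX : y ∈ ext F X Finset.univ) (hyY : y ∈ ext F Y Finset.univ) :
    layer F Y y ≤ layer F X y := by
  obtain ⟨htX, htF⟩ := mem_source hsX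
  obtain ⟨htY, -⟩ := mem_source hsY
  have hball : ∀ i, ball F X t i ⊆ ball F Y t i := by
    intro i
    induction i with
    | zero => exact Finset.Subset.refl _
    | succ i ih =>
      intro z hz
      rw [mem_ball_succ] at hz ⊢
      rcases hz with hz | ⟨hzX, hz⟩
      · exact Or.inl (ih hz)
      · exact Or.inr ⟨hXY hzX, hF.insert_mem (ball_mem hF hX htX htF i) ⟨t, mem_ball_self i⟩
          (ball_mem hF hY htY htF i) hY ih (ball_subset htY i) (hXY hzX) hz⟩
  rw [layer_eq hsX, layer_eq hsY]
  obtain ⟨hpos, hl⟩ := layerFrom_spec hF hX htX htF hyX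
  obtain ⟨l, hl'⟩ : ∃ l, layerFrom F X t y = l + 1 := ⟨_, (Nat.sub_add_cancel hpos).symm⟩
  rw [hl'] at hl ⊢
  refine layerFrom_le (mem_ext.2 ⟨Finset.mem_univ _, ?_, ?_⟩)
  · exact fun h => (mem_ext.1 hyY).2.1 (ball_subset htY _ h)
  · exact hF.insert_mem (ball_mem hF hX htX htF l) ⟨t, mem_ball_self l⟩
      (ball_mem hF hY htY htF l) (mem_ext.1 hyY).2.2 (hball l)
      ((ball_subset htY l).trans (Finset.subset_insert _ _)) (Finset.mem_insert_self _ _)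
      (mem_ext.1 hl).2.2

/-- As long as the source stays the same, the keys of the chosen elements increase. -/
theorem Commutable.key_lt_of_choose (hF : Commutable F) {X A : Finset U} {t x y : U}
    (hX : X ∈ F) (hs : source F X = some t) (hx : choose F X A = some x)
    (hs' : source F (insert x X) = some t) (hy : y ∈ ext F (insert x X) A) :
    toLex (layer F X x, x) < toLex (layer F (insert x X) y, y) := by
  obtain ⟨hxe, hmin⟩ := choose_eq_some_iff.1 hx
  obtain ⟨htX, htF⟩ := mem_source hs
  obtain ⟨htX', -⟩ := mem_source hs'
  have hX' : insert x X ∈ F := (mem_ext.1 hxe).2.2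
  by_contra hlt
  rw [not_lt] at hlt
  have hle : layer F (insert x X) y ≤ layer F X x := by
    rw [Prod.Lex.toLex_le_toLex] at hlt
    rcases hlt with h | h
    · exact h.le
    · exact h.1.le
  -- Adding `x` changes no ball whose index is below the layer of `x`, since `x` cannot be added to
  -- any ball early enough to enter one of them.
  have hballs : ∀ k, k < layer F X x → ball F (insert x X) t k = ball F X t k := by
    intro k
    induction k with
    | zero => intro _; rfl
    | succ k ih =>
      intro hk
      have ih := ih (by omega)
      ext z
      rw [mem_ball_succ, mem_ball_succ, ih, Finset.mem_insert]
      constructor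
      · rintro (h | ⟨rfl | h, h'⟩)
        · exact Or.inl h
        · have : layerFrom F X t z ≤ k + 1 := layerFrom_le (mem_ext.2 ⟨Finset.mem_univ _,
            fun h => (mem_ext.1 hxe).2.1 (ball_subset htX _ h), h'⟩)
          rw [layer_eq hs] at hk
          omega
        · exact Or.inr ⟨h, h'⟩
      · tauto
  obtain ⟨hpos, hl⟩ := layerFrom_spec hF hX' htX' htF (ext_subset_ext_univ hy)
  rw [layer_eq hs'] at hle
  obtain ⟨l, hl'⟩ : ∃ l, layerFrom F (insert x X) t y = l + 1 :=
    ⟨_, (Nat.sub_add_cancel hpos).symm⟩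
  rw [hl', Nat.add_sub_cancel, hballs l (by omega)] at hl
  obtain ⟨hyA, hyX, hyF⟩ := mem_ext.1 hy
  -- So `y` was already a candidate when `x` was chosen.
  have hyX' : y ∈ ext F X A := by
    refine mem_ext.2 ⟨hyA, fun h => hyX (Finset.mem_insert_of_mem h), ?_⟩
    refine hF.insert_mem (ball_mem hF hX htX htF l) ⟨t, mem_ball_self l⟩ hX hyF
      (ball_subset htX l) ?_ (Finset.mem_insert_self _ _) (mem_ext.1 hl).2.2
    exact (Finset.subset_insert _ _).trans (Finset.subset_insert _ _)
  have h₁ : layer F X y ≤ layer F (insert x X) y := by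
    rw [layer_eq hs, layer_eq hs', hl']
    exact layerFrom_le hl
  have h₂ := hmin y hyX'
  have h₃ : toLex (layer F X y, y) ≤ toLex (layer F (insert x X) y, y) := by
    rw [Prod.Lex.toLex_le_toLex]
    rcases h₁.lt_or_eq with h | h
    · exact Or.inl h
    · exact Or.inr ⟨h, le_rfl⟩
  -- The two keys now bound each other, so they coincide and `y = x`, although `y` is outside `X ∪
  -- {x}`.
  have h₄ := congrArg Prod.snd (toLex.injective ((h₂.trans h₃).antisymm hlt))
  exact hyX (by simp only at h₄; simp [h₄])

/-! ### Prefixes -/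

/-- `C` is what `complete({s}, A)` has collected when it chooses `w`. -/
def PrefixBefore (F : Finset (Finset U)) (A : Finset U) (s w : U) (C : Finset U) : Prop :=
  ∃ k, (completeStep F A)^[k] {s} = C ∧ choose F C A = some w

/-- Once chosen, `w` belongs to all later sets and is never chosen again. -/
theorem PrefixBefore.unique {A : Finset U} {s w : U} {C D : Finset U}
    (hC : PrefixBefore F A s w C) (hD : PrefixBefore F A s w D) : C = D := by
  have key : ∀ {i j : ℕ}, i < j → choose F ((completeStep F A)^[i] {s}) A = some w →
      choose F ((completeStep F A)^[j] {s}) A ≠ some w := by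
    intro i j hij hi hj
    have : w ∈ (completeStep F A)^[i + 1] {s} := by
      rw [Function.iterate_succ_apply', completeStep_of_choose hi]
      exact Finset.mem_insert_self _ _
    exact (mem_ext.1 (mem_ext_of_choose hj)).2.1 (iterate_mono A _ hij this)
  obtain ⟨i, rfl, hi⟩ := hC
  obtain ⟨j, rfl, hj⟩ := hD
  rcases lt_trichotomy i j with h | h | h
  · exact absurd hj (key h hi)
  · rw [h]
  · exact absurd hi (key h hj)

theorem source_of_subset {X S : Finset U} {s : U} (hXS : X ⊆ S) (hs : source F S = some s)
    (hsX : s ∈ X) : source F X = some s := by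
  rw [source_eq_some_iff] at hs ⊢
  exact ⟨hsX, hs.2.1, fun x hx => hs.2.2 x (hXS hx)⟩

theorem canonPrefix_eq {S : Finset U} {s : U} (hs : source F S = some s) (k : ℕ) :
    canonPrefix F S k = (completeStep F S)^[k] {s} := by
  simp [canonPrefix, hs]

theorem canonPrefix_succ {S : Finset U} {s : U} (hs : source F S = some s) (k : ℕ) :
    canonPrefix F S (k + 1) = completeStep F S (canonPrefix F S k) := by
  rw [canonPrefix_eq hs, canonPrefix_eq hs, Function.iterate_succ_apply']

theorem canonPrefix_subset {S : Finset U} {s : U} (hs : source F S = some s) (k : ℕ) :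
    canonPrefix F S k ⊆ S := by
  rw [canonPrefix_eq hs]
  exact iterate_subset (by simpa using (mem_source hs).1) k

theorem canonPrefix_mem {S : Finset U} {s : U} (hs : source F S = some s) (k : ℕ) :
    canonPrefix F S k ∈ F := by
  rw [canonPrefix_eq hs]
  exact iterate_mem (mem_source hs).2 k

theorem source_canonPrefix {S : Finset U} {s : U} (hs : source F S = some s) (k : ℕ) :
    source F (canonPrefix F S k) = some s := by
  refine source_of_subset (canonPrefix_subset hs k) hs ?_
  rw [canonPrefix_eq hs]
  exact subset_iterate _ _ _ (Finset.mem_singleton_self s)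

/-- If the unrestricted completion of a prefix ends in `S`, its next choice lies in `S`, so it is
also the next choice inside `S`. -/
theorem complete_canonPrefix_succ {S : Finset U} {s : U} (hs : source F S = some s) {k : ℕ}
    (h : complete F (canonPrefix F S k) Finset.univ = S) :
    complete F (canonPrefix F S (k + 1)) Finset.univ = S := by
  rw [canonPrefix_succ hs]
  rcases hc : choose F (canonPrefix F S k) Finset.univ with _ | y
  · have hkS : canonPrefix F S k = S := (complete_eq_of_none (k := 0) hc).symm.trans h
    have : choose F (canonPrefix F S k) S = none := by
      rw [choose_eq_none_iff] at hc ⊢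
      exact Finset.subset_empty.1 (hc ▸ ext_subset_ext_univ)
    rwa [completeStep_of_none this]
  · have hstep := completeStep_of_choose hc
    have hyS : y ∈ S := by
      rw [← h, ← complete_completeStep, hstep]
      exact subset_complete _ _ (Finset.mem_insert_self _ _)
    rw [completeStep_of_choose (choose_of_subset (Finset.subset_univ S) hyS hc), ← hstep,
      complete_completeStep, h]

/-- Completing to `S` is hereditary along the canonical order, so one prefix that fails rules out
all shorter ones. This identifies `piIndex`. -/
theorem complete_canonPrefix_mono {S : Finset U} {s : U} (hs : source F S = some s) {i j : ℕ}
    (hij : i ≤ j) (h : complete F (canonPrefix F S i) Finset.univ = S) :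
    complete F (canonPrefix F S j) Finset.univ = S := by
  induction j, hij using Nat.le_induction with
  | base => exact h
  | succ j _ ih => exact complete_canonPrefix_succ hs ih

/-- The keys of the elements that follow in the canonical order of `S` are larger. -/
theorem Commutable.key_canonPrefix_lt (hF : Commutable F) {S : Finset U} {s x : U}
    (hs : source F S = some s) {i : ℕ} (hx : choose F (canonPrefix F S i) S = some x) {j : ℕ}
    (hij : i < j) {y : U} (hy : y ∈ ext F (canonPrefix F S j) S) :
    toLex (layer F (canonPrefix F S i) x, x) < toLex (layer F (canonPrefix F S j) y, y) := by
  have step : ∀ {j : ℕ} {x y : U}, choose F (canonPrefix F S j) S = some x →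
      y ∈ ext F (canonPrefix F S (j + 1)) S →
      toLex (layer F (canonPrefix F S j) x, x) <
        toLex (layer F (canonPrefix F S (j + 1)) y, y) := by
    intro j x y hx hy
    have hsucc : canonPrefix F S (j + 1) = insert x (canonPrefix F S j) := by
      rw [canonPrefix_succ hs, completeStep_of_choose hx]
    have hsrc := source_canonPrefix hs (j + 1)
    rw [hsucc] at hy hsrc ⊢
    exact hF.key_lt_of_choose (canonPrefix_mem hs j) (source_canonPrefix hs j) hx hsrc hy
  induction j, hij using Nat.le_induction generalizing y with
  | base => exact step hx hy
  | succ j _ ih =>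
    rcases hc : choose F (canonPrefix F S j) S with _ | z
    · rw [canonPrefix_succ hs, completeStep_of_none hc, choose_eq_none_iff.1 hc] at hy
      simp at hy
    · exact (ih (mem_ext_of_choose hc)).trans (step hc hy)

/-- Inside a solution `R` that contains `S[k]`, the canonical order of `S` up to `S[k]` is
followed by `complete({s}, R)`, provided that `S[k]` is completed to `S`. -/
theorem Commutable.choose_canonPrefix_eq (hF : Commutable F) {S R : Finset U} {s : U}
    (hs : source F S = some s) (hR : R ∈ F) {k : ℕ}
    (hkR : canonPrefix F S k ⊆ R) (hk : complete F (canonPrefix F S k) Finset.univ = S)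
    {i : ℕ} (hik : i < k) {x : U} (hx : choose F (canonPrefix F S i) S = some x) :
    choose F (canonPrefix F S i) R = some x := by
  have hmono : ∀ {i j : ℕ}, i ≤ j → canonPrefix F S i ⊆ canonPrefix F S j := by
    intro i j hij
    rw [canonPrefix_eq hs, canonPrefix_eq hs]
    exact iterate_mono _ _ hij
  have hxk : x ∈ canonPrefix F S k := by
    refine hmono hik ?_
    rw [canonPrefix_succ hs, completeStep_of_choose hx]
    exact Finset.mem_insert_self _ _
  obtain ⟨hxe, hxmin⟩ := choose_eq_some_iff.1 hx
  refine choose_eq_some_iff.2 ⟨mem_ext.2 ⟨hkR hxk, (mem_ext.1 hxe).2⟩, fun y hy => ?_⟩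
  by_contra hlt
  rw [not_le] at hlt
  obtain ⟨hyR, hyi, hyF⟩ := mem_ext.1 hy
  -- Within `S` the element `x` has the least key, so a better candidate must be outside `S`.
  have hyS : y ∉ S := fun h => absurd (hxmin y (mem_ext.2 ⟨h, hyi, hyF⟩)) (not_le.2 hlt)
  have hsi : s ∈ canonPrefix F S i := (mem_source (source_canonPrefix hs i)).1
  have hyk : y ∈ ext F (canonPrefix F S k) Finset.univ := by
    refine mem_ext.2 ⟨Finset.mem_univ _, fun h => hyS (canonPrefix_subset hs k h), ?_⟩
    exact hF.insert_mem (canonPrefix_mem hs i) ⟨s, hsi⟩ (canonPrefix_mem hs k) hR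
      (hmono hik.le) hkR hyR hyF
  -- Here `z` is the next element taken by the completion of `S[k]`; it exists because `y` is
  -- addable, and it lies in `S`.
  rcases hc : choose F (canonPrefix F S k) Finset.univ with _ | z
  · rw [choose_eq_none_iff.1 hc] at hyk
    simp at hyk
  have hzS : z ∈ S := by
    rw [← hk, ← complete_completeStep, completeStep_of_choose hc]
    exact subset_complete _ _ (Finset.mem_insert_self _ _)
  obtain ⟨hze, hzmin⟩ := choose_eq_some_iff.1 hc
  have h₁ := hF.key_canonPrefix_lt hs hx hik (mem_ext.2 ⟨hzS, (mem_ext.1 hze).2⟩)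
  have h₂ := hzmin y hyk
  have h₃ : toLex (layer F (canonPrefix F S k) y, y) ≤
      toLex (layer F (canonPrefix F S i) y, y) := by
    rw [Prod.Lex.toLex_le_toLex]
    have := hF.layer_anti (canonPrefix_mem hs i) (canonPrefix_mem hs k) (hmono hik.le)
      (source_canonPrefix hs i) (source_canonPrefix hs k) (ext_subset_ext_univ hy) hyk
    rcases this.lt_or_eq with h | h
    · exact Or.inl h
    · exact Or.inr ⟨h, le_rfl⟩
  -- The cycle of keys: `x` at `S[i]` is below `z` at `S[k]`, which is at most `y` at `S[k]`, which
  -- is at most `y` at `S[i]`, which is below `x` at `S[i]`.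
  exact lt_irrefl _ (((h₁.trans_le h₂).trans_le h₃).trans hlt)

/-! ### Children and the recovery of their cores -/

/-- The solutions that are to be listed. -/
def IsChild (F : Finset (Finset U)) (P : Finset U) (w : U) (R S : Finset U) : Prop :=
  IsMaximalSolution F S ∧ parent F S = some P ∧ pi F S = some w ∧ restrOf F S = some R

/-- Unfolds the optional values: having a parent excludes roots, so the core is the prefix just
before `piIndex`. -/
theorem IsChild.spec (hF : Commutable F) {P R S : Finset U} {w : U} (h : IsChild F P w R S) :
    ∃ s k, source F S = some s ∧ choose F (canonPrefix F S k) S = some w ∧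
      complete F (canonPrefix F S k) Finset.univ = P ∧
      complete F (insert w (canonPrefix F S k)) (insert w P) = R ∧
      complete F (insert w (canonPrefix F S k)) Finset.univ = S := by
  obtain ⟨hS, hP, hw, hR⟩ := h
  by_cases h0 : piIndex F S = 0
  · simp [parent, core, h0] at hP
  obtain ⟨k, hk⟩ : ∃ k, piIndex F S = k + 1 := ⟨_, (Nat.sub_add_cancel (by omega)).symm⟩
  have hcore : core F S = some (canonPrefix F S k) := by simp [core, hk]
  have hP' : complete F (canonPrefix F S k) Finset.univ = P := by
    simpa [parent, hcore] using hP
  have hw' : choose F (canonPrefix F S k) S = some w := by simpa [pi, hcore] using hw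
  have hR' : complete F (insert w (canonPrefix F S k)) (insert w P) = R := by
    simpa [restrOf, hcore, hw, hP] using hR
  have hne : S.Nonempty := ⟨w, (mem_ext.1 (mem_ext_of_choose hw')).1⟩
  obtain ⟨s, hs⟩ := hF.exists_source hS.prop hne
  refine ⟨s, k, hs, hw', hP', hR', ?_⟩
  -- The infimum of the empty set is `0`, which is excluded here, so the infimum is attained.
  have hmem : piIndex F S ∈ {k | complete F (canonPrefix F S k) Finset.univ = S} := by
    refine Nat.sInf_mem ?_
    by_contra hemp
    rw [Set.not_nonempty_iff_eq_empty] at hemp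
    apply h0
    rw [piIndex, hemp, Nat.sInf_empty]
  rw [hk] at hmem
  have : canonPrefix F S (k + 1) = insert w (canonPrefix F S k) := by
    rw [canonPrefix_succ hs, completeStep_of_choose hw']
  rwa [← this]

theorem isChild_of_spec {P R S : Finset U} {s w : U} {k : ℕ} (hS : IsMaximalSolution F S)
    (hwP : w ∉ P) (hs : source F S = some s) (hw : choose F (canonPrefix F S k) S = some w)
    (hP : complete F (canonPrefix F S k) Finset.univ = P)
    (hR : complete F (insert w (canonPrefix F S k)) (insert w P) = R)
    (hSk : complete F (insert w (canonPrefix F S k)) Finset.univ = S) :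
    IsChild F P w R S := by
  have hsucc : canonPrefix F S (k + 1) = insert w (canonPrefix F S k) := by
    rw [canonPrefix_succ hs, completeStep_of_choose hw]
  have hk : piIndex F S = k + 1 := by
    have hmem : k + 1 ∈ {k | complete F (canonPrefix F S k) Finset.univ = S} := by
      change complete F (canonPrefix F S (k + 1)) Finset.univ = S
      rwa [hsucc]
    refine le_antisymm (Nat.sInf_le hmem) ?_
    -- If an earlier prefix completed to `S`, so would the core, which completes to `P`; but `w` is
    -- in `S` and not in `P`.
    by_contra hlt
    have := complete_canonPrefix_mono hs (show piIndex F S ≤ k by omega)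
      (Nat.sInf_mem ⟨_, hmem⟩)
    rw [hP] at this
    exact hwP (this ▸ (mem_ext.1 (mem_ext_of_choose hw)).1)
  have hcore : core F S = some (canonPrefix F S k) := by simp [core, hk]
  have hpi : pi F S = some w := by simp [pi, hcore, hw]
  have hpar : parent F S = some P := by simp [parent, hcore, hP]
  exact ⟨hS, hpar, hpi, by simp [restrOf, hcore, hpi, hpar, hR]⟩

/-- The core of a child depends only on `R`, `w` and the source, because the canonical order of `S`
up to and including `w` is also followed inside `R`. -/
theorem IsChild.prefixBefore (hF : Commutable F) {P R S : Finset U} {s w : U}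
    (h : IsChild F P w R S) (hs : source F S = some s) :
    ∃ C, PrefixBefore F R s w C ∧ PrefixBefore F S s w C ∧ complete F C Finset.univ = P ∧
      complete F (insert w C) (insert w P) = R ∧ complete F (insert w C) Finset.univ = S := by
  obtain ⟨s', k, hs', hw, hP, hR, hSk⟩ := h.spec hF
  obtain rfl : s = s' := Option.some.inj (hs.symm.trans hs')
  have hsucc : canonPrefix F S (k + 1) = insert w (canonPrefix F S k) := by
    rw [canonPrefix_succ hs, completeStep_of_choose hw]
  have hRF : R ∈ F := by
    rw [← hR, ← hsucc]
    exact complete_mem (canonPrefix_mem hs _)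
  have hkR : canonPrefix F S (k + 1) ⊆ R := by
    rw [← hR, hsucc]
    exact subset_complete _ _
  -- The comparison with `R` needs a prefix that completes to `S`. The core completes to `P`, so the
  -- prefix one longer is used, and it still lies in `R`.
  have hagree : ∀ {i x}, i < k + 1 → choose F (canonPrefix F S i) S = some x →
      choose F (canonPrefix F S i) R = some x := fun hi hx =>
    hF.choose_canonPrefix_eq hs hRF hkR (by rwa [hsucc]) hi hx
  have hit : ∀ i ≤ k, (completeStep F R)^[i] {s} = canonPrefix F S i := by
    intro i
    induction i with
    | zero => intro _; rw [canonPrefix_eq hs]; rfl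
    | succ i ih =>
      intro hi
      rw [Function.iterate_succ_apply', ih (by omega), canonPrefix_succ hs]
      rcases hc : choose F (canonPrefix F S i) S with _ | x
      -- A canonical order that stopped here would never reach the choice of `w`.
      · have hconst : canonPrefix F S k = canonPrefix F S i := by
          rw [canonPrefix_eq hs, canonPrefix_eq hs]
          rw [canonPrefix_eq hs] at hc
          exact iterate_of_none hc (by omega)
        rw [hconst, hc] at hw
        simp at hw
      · rw [completeStep_of_choose hc, completeStep_of_choose (hagree (by omega) hc)]
  exact ⟨canonPrefix F S k, ⟨k, hit k le_rfl, hagree (by omega) hw⟩,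
    ⟨k, (canonPrefix_eq hs k).symm, hw⟩, hP, hR, hSk⟩

/-- For a given source, the right-hand side names a single candidate and conditions that can be
tested by completions. Uniqueness of the prefix before `w` identifies `C` with the core. -/
theorem Commutable.isChild_iff (hF : Commutable F) {P R S C : Finset U} {s w : U}
    (hwP : w ∉ P) (hC : PrefixBefore F R s w C) :
    IsChild F P w R S ∧ source F S = some s ↔
      complete F C Finset.univ = P ∧ complete F (insert w C) (insert w P) = R ∧
        S = complete F (insert w C) Finset.univ ∧ source F S = some s ∧
        PrefixBefore F S s w C := by
  constructor
  · rintro ⟨h, hs⟩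
    obtain ⟨D, hD, hDS, hP, hR, hS⟩ := h.prefixBefore hF hs
    obtain rfl := hC.unique hD
    exact ⟨hP, hR, hS.symm, hs, hDS⟩
  · rintro ⟨hP, hR, rfl, hs, k, hk, hw⟩
    have hCF : insert w C ∈ F := (mem_ext.1 (mem_ext_of_choose hw)).2.2
    rw [← canonPrefix_eq hs] at hk
    refine ⟨isChild_of_spec (s := s) (k := k) (hF.isMaximalSolution_complete hCF) hwP hs
      ?_ ?_ ?_ ?_, hs⟩
    all_goals rw [hk]
    all_goals assumption

end CanonicalOrders

/-! ### Total correctness with time bounds -/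

section Logic

variable {n r b : ℕ} {E : Env n}

/-- All registers and cells hold numbers up to `N`. -/
def State.Bounded (N : ℕ) (σ : State r b) : Prop :=
  (∀ i, σ.reg i ≤ N) ∧ ∀ k a, σ.mem k a ≤ N

theorem State.Bounded.setReg {N : ℕ} {σ : State r b} (h : σ.Bounded N) {i : Fin r} {v : ℕ}
    (hv : v ≤ N) : (σ.setReg i v).Bounded N := by
  refine ⟨fun j => ?_, h.2⟩
  simp only [State.setReg, Function.update_apply]
  split_ifs
  · exact hv
  · exact h.1 j

theorem State.Bounded.setCell {N : ℕ} {σ : State r b} (h : σ.Bounded N) {k : Fin b} {a v : ℕ}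
    (hv : v ≤ N) : (σ.setCell k a v).Bounded N := by
  refine ⟨h.1, fun j c => ?_⟩
  simp only [State.setCell, Function.update_apply]
  split_ifs with hj
  · subst hj
    rw [Function.update_apply]
    split_ifs
    · exact hv
    · exact h.2 _ _
  · exact h.2 j c

/-- Every write is checked against the word bound. Carrying boundedness along lets copied values
meet that check without being known. -/
theorem Exec.bounded {c : Prog r b} {σ τ : State r b} {t : ℕ} (h : Exec E c σ τ t) :
    σ.Bounded E.wordMax → τ.Bounded E.wordMax := by
  induction h with
  | skip σ => exact id
  | assign σ i e he hw => exact fun h => h.setReg hw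
  | store σ k a e ha he hk hw => exact fun h => h.setCell hw
  | test σ i k e l he hk hl hm hw => exact fun h => h.setReg (by split_ifs <;> omega)
  | emit σ e he => exact fun h => ⟨h.1, h.2⟩
  | seq _ _ ih₁ ih₂ => exact fun h => ih₂ (ih₁ h)
  | branch_true _ _ _ ih => exact ih
  | branch_false _ _ _ ih => exact ih
  | loop_true _ _ _ _ ih₁ ih₂ => exact fun h => ih₂ (ih₁ h)
  | loop_false _ _ => exact id

/-- Started in a bounded state `σ`, the program halts within time `T` in a state with the
property `Q`. -/
def Runs (E : Env n) (c : Prog r b) (σ : State r b) (T : ℕ) (Q : State r b → Prop) : Prop :=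
  σ.Bounded E.wordMax → ∃ τ t, Exec E c σ τ t ∧ t ≤ T ∧ Q τ

variable {c d : Prog r b} {σ : State r b} {T T₁ T₂ : ℕ} {Q Q' : State r b → Prop}

theorem Runs.mono (h : Runs E c σ T Q') (hQ : ∀ τ, Q' τ → Q τ) : Runs E c σ T Q := fun hb => by
  obtain ⟨τ, t, h₁, h₂, h₃⟩ := h hb
  exact ⟨τ, t, h₁, h₂, hQ τ h₃⟩

theorem Runs.le (h : Runs E c σ T₁ Q) (hT : T₁ ≤ T) : Runs E c σ T Q := fun hb => by
  obtain ⟨τ, t, h₁, h₂, h₃⟩ := h hb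
  exact ⟨τ, t, h₁, h₂.trans hT, h₃⟩

theorem Runs.skip (h : Q σ) : Runs E .skip σ 1 Q := fun _ => ⟨σ, 1, .skip σ, le_rfl, h⟩

theorem Runs.assign {i : Fin r} {e : Expr r b} (he : e.InBounds E.bankSize σ)
    (hw : σ.Bounded E.wordMax → e.eval σ ≤ E.wordMax) (h : Q (σ.setReg i (e.eval σ))) :
    Runs E (.assign i e) σ (e.size + 1) Q :=
  fun hb => ⟨_, _, .assign σ i e he (hw hb), le_rfl, h⟩

theorem Runs.store {k : Fin b} {a e : Expr r b} (ha : a.InBounds E.bankSize σ)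
    (he : e.InBounds E.bankSize σ) (hk : a.eval σ < E.bankSize)
    (hw : σ.Bounded E.wordMax → e.eval σ ≤ E.wordMax)
    (h : Q (σ.setCell k (a.eval σ) (e.eval σ))) :
    Runs E (.store k a e) σ (a.size + e.size + 1) Q :=
  fun hb => ⟨_, _, .store σ k a e ha he hk (hw hb), le_rfl, h⟩

theorem Runs.emit {e : Expr r b} (he : e.InBounds E.bankSize σ)
    (h : Q { σ with out := σ.out ++ [e.eval σ] }) : Runs E (.emit e) σ (e.size + 1) Q :=
  fun _ => ⟨_, _, .emit σ e he, le_rfl, h⟩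

theorem Runs.seq (h : Runs E c σ T₁ fun τ => Runs E d τ T₂ Q) :
    Runs E (.seq c d) σ (T₁ + T₂) Q := fun hb => by
  obtain ⟨τ, t, h₁, h₂, h₃⟩ := h hb
  obtain ⟨ρ, u, h₄, h₅, h₆⟩ := h₃ (h₁.bounded hb)
  exact ⟨ρ, t + u, .seq h₁ h₄, by omega, h₆⟩

/-- Charging for both branches avoids maxima in the time bounds. -/
theorem Runs.branch {e : Expr r b} (he : e.InBounds E.bankSize σ)
    (h₁ : e.eval σ ≠ 0 → Runs E c σ T₁ Q) (h₂ : e.eval σ = 0 → Runs E d σ T₂ Q) :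
    Runs E (.branch e c d) σ (e.size + (T₁ + T₂)) Q := fun hb => by
  by_cases hv : e.eval σ = 0
  · obtain ⟨τ, t, h, ht, hQ⟩ := h₂ hv hb
    exact ⟨τ, _, .branch_false he hv h, by omega, hQ⟩
  · obtain ⟨τ, t, h, ht, hQ⟩ := h₁ hv hb
    exact ⟨τ, _, .branch_true he hv h, by omega, hQ⟩

/-- A loop whose body runs at most `N` times. -/
theorem Runs.loop {e : Expr r b} (I : ℕ → State r b → Prop) (N T : ℕ) (h₀ : I 0 σ)
    (he : ∀ k τ, I k τ → e.InBounds E.bankSize τ)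
    (hstep : ∀ k τ, I k τ → τ.Bounded E.wordMax → e.eval τ ≠ 0 →
      k < N ∧ Runs E c τ T (I (k + 1)))
    (hend : ∀ k τ, I k τ → e.eval τ = 0 → Q τ) :
    Runs E (.loop e c) σ (N * (T + e.size) + e.size) Q := by
  -- Here `k` counts the iterations done and `j` bounds those that remain; with `j = 0` the body
  -- cannot be entered, as this would require `k < N`.
  suffices h : ∀ j k τ, N ≤ j + k → I k τ → Runs E (.loop e c) τ (j * (T + e.size) + e.size) Q from
    h N 0 σ le_rfl h₀
  intro j
  induction j with
  | zero =>
    intro k τ hk hI hb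
    have hv : e.eval τ = 0 := by
      by_contra hv
      have := (hstep k τ hI hb hv).1
      omega
    exact ⟨τ, _, .loop_false (he k τ hI) hv, by omega, hend k τ hI hv⟩
  | succ j ih =>
    intro k τ hk hI hb
    by_cases hv : e.eval τ = 0
    · exact ⟨τ, _, .loop_false (he k τ hI) hv, by omega, hend k τ hI hv⟩
    · obtain ⟨-, h⟩ := hstep k τ hI hb hv
      obtain ⟨ρ, t, h₁, h₂, h₃⟩ := h hb
      obtain ⟨π, u, h₄, h₅, h₆⟩ := ih (k + 1) ρ (by omega) h₃ (h₁.bounded hb)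
      refine ⟨π, _, .loop_true (he k τ hI) hv h₁ h₄, ?_, h₆⟩
      rw [Nat.succ_mul]
      omega

/-- Registers below `a` and banks below `k` are the same in both states, and so is the output. -/
structure Frame (a k : ℕ) (σ τ : State r b) : Prop where
  reg : ∀ i : Fin r, i.val < a → τ.reg i = σ.reg i
  mem : ∀ j : Fin b, j.val < k → τ.mem j = σ.mem j
  out : τ.out = σ.out

theorem Frame.rfl {a k : ℕ} {σ : State r b} : Frame a k σ σ :=
  ⟨fun _ _ => Eq.refl _, fun _ _ => Eq.refl _, Eq.refl _⟩

theorem Frame.trans {a k : ℕ} {σ τ ρ : State r b} (h : Frame a k σ τ) (h' : Frame a k τ ρ) :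
    Frame a k σ ρ :=
  ⟨fun i hi => (h'.reg i hi).trans (h.reg i hi), fun j hj => (h'.mem j hj).trans (h.mem j hj),
    h'.out.trans h.out⟩

theorem Frame.mono {a k a' k' : ℕ} {σ τ : State r b} (h : Frame a k σ τ) (ha : a' ≤ a)
    (hk : k' ≤ k) : Frame a' k' σ τ :=
  ⟨fun i hi => h.reg i (by omega), fun j hj => h.mem j (by omega), h.out⟩

theorem Frame.setReg {a k : ℕ} {σ τ : State r b} (h : Frame a k σ τ) {i : Fin r} {v : ℕ}
    (hi : a ≤ i.val) : Frame a k σ (τ.setReg i v) := by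
  refine ⟨fun j hj => ?_, h.mem, h.out⟩
  rw [← h.reg j hj]
  exact Function.update_of_ne (by rintro rfl; omega) _ _

theorem Frame.setCell {a k : ℕ} {σ τ : State r b} (h : Frame a k σ τ) {i : Fin b} {c v : ℕ}
    (hi : k ≤ i.val) : Frame a k σ (τ.setCell i c v) := by
  refine ⟨h.reg, fun j hj => ?_, h.out⟩
  rw [← h.mem j hj]
  exact Function.update_of_ne (by rintro rfl; omega) _ _

end Logic

/-! ### Sets listed in memory -/

section Listings

variable {n : ℕ}

/-- The cells `0, …, k - 1` list the set `X`. -/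
def Listing (m : ℕ → ℕ) (k : ℕ) (X : Finset (Fin n)) : Prop :=
  ∃ l : List (Fin n), l.Nodup ∧ l.toFinset = X ∧ l.map Fin.val = (List.range k).map m

variable {m m' : ℕ → ℕ} {k : ℕ} {X : Finset (Fin n)}

theorem Listing.card_eq (h : Listing m k X) : X.card = k := by
  obtain ⟨l, hl, rfl, hm⟩ := h
  rw [List.toFinset_card_of_nodup hl]
  simpa using congrArg List.length hm

theorem Listing.mem_iff (h : Listing m k X) {x : Fin n} : x ∈ X ↔ ∃ j < k, m j = x.val := by
  obtain ⟨l, hl, rfl, hm⟩ := h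
  have : x.val ∈ l.map Fin.val ↔ x.val ∈ (List.range k).map m := by rw [hm]
  simpa [List.mem_map, Fin.val_inj] using this

theorem Listing.exists_mem (h : Listing m k X) {j : ℕ} (hj : j < k) : ∃ x ∈ X, m j = x.val := by
  obtain ⟨l, hl, rfl, hm⟩ := h
  have : m j ∈ l.map Fin.val := by
    rw [hm]
    exact List.mem_map_of_mem (List.mem_range.2 hj)
  obtain ⟨x, hx, hxj⟩ := List.mem_map.1 this
  exact ⟨x, List.mem_toFinset.2 hx, hxj.symm⟩

theorem Listing.inj (h : Listing m k X) {i j : ℕ} (hi : i < k) (hj : j < k) (hij : m i = m j) :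
    i = j := by
  obtain ⟨l, hl, rfl, hm⟩ := h
  have : ((List.range k).map m).Nodup := hm ▸ hl.map Fin.val_injective
  exact List.inj_on_of_nodup_map this (List.mem_range.2 hi) (List.mem_range.2 hj) hij

theorem Listing.congr (h : Listing m k X) (hm : ∀ j < k, m' j = m j) : Listing m' k X := by
  obtain ⟨l, hl, hX, h⟩ := h
  exact ⟨l, hl, hX, h.trans (List.map_congr_left fun j hj => (hm j (List.mem_range.1 hj)).symm)⟩

theorem Listing.empty : Listing m 0 (∅ : Finset (Fin n)) := ⟨[], by simp⟩

theorem Listing.push (h : Listing m k X) {x : Fin n} (hx : x ∉ X) {v : ℕ} (hv : v = x.val) :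
    Listing (Function.update m k v) (k + 1) (insert x X) := by
  obtain ⟨l, hl, rfl, h⟩ := h
  rw [List.mem_toFinset] at hx
  refine ⟨l ++ [x], ?_, ?_, ?_⟩
  · rw [List.nodup_append]
    refine ⟨hl, by simp, fun a ha b hb => ?_⟩
    rintro rfl
    exact hx (by simpa [← List.mem_singleton.1 hb] using ha)
  · ext y; simp
  · rw [List.map_append, h, List.range_succ, List.map_append]
    congr 1
    · refine List.map_congr_left fun j hj => ?_
      rw [Function.update_of_ne (List.mem_range.1 hj).ne]
    · simp [hv]

theorem Listing.singleton {x : Fin n} {v : ℕ} (hv : v = x.val) :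
    Listing (Function.update m 0 v) 1 ({x} : Finset (Fin n)) := by
  simpa using (Listing.empty (m := m)).push (Finset.notMem_empty x) hv

theorem Runs.test {r b : ℕ} {E : Env n} {σ : State r b} {Q : State r b → Prop} {i : Fin r}
    {k : Fin b} {e : Expr r b} (he : e.InBounds E.bankSize σ) (hk : e.eval σ ≤ E.bankSize)
    (hX : Listing (σ.mem k) (e.eval σ) X) (hw : 1 ≤ E.wordMax)
    (h : Q (σ.setReg i (if X ∈ E.family then 1 else 0))) :
    Runs E (.test i k e) σ (e.size + E.testTime) Q := by
  obtain ⟨l, hl, rfl, hm⟩ := hX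
  exact fun _ => ⟨_, _, .test σ i k e l he hk hl hm hw, le_rfl, h⟩

end Listings

/-! ### Reading a state after a write -/

section Updates

variable {r b : ℕ} (σ : State r b) (i j : Fin r) (k l : Fin b) (a v : ℕ)

@[simp] theorem State.setReg_reg : (σ.setReg i v).reg j = if j = i then v else σ.reg j := by
  simp [State.setReg, Function.update_apply]

@[simp] theorem State.setReg_mem : (σ.setReg i v).mem = σ.mem := rfl

@[simp] theorem State.setReg_out : (σ.setReg i v).out = σ.out := rfl

@[simp] theorem State.setCell_reg : (σ.setCell k a v).reg = σ.reg := rfl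

@[simp] theorem State.setCell_mem :
    (σ.setCell k a v).mem l = if l = k then Function.update (σ.mem k) a v else σ.mem l := by
  simp only [State.setCell, Function.update_apply]

@[simp] theorem State.setCell_out : (σ.setCell k a v).out = σ.out := rfl

end Updates

/-! ### The program

Banks: `0` the list of `P`, `1` the list of `R`, `2` a core, `3` a candidate, `4` the set `A`,
`5` the set `X`, `6` the balls in `X` as prefixes, `7` the sizes of the balls, `8` marks.

Registers: `0` to `3` input, `4` and `5` the position in `R` and the element there, `6` and `7`
lengths for the banks `2` and `3`, `9` length for bank `4`, `10` nonzero if `A` is the whole ground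
set, `11` the element to stop at, `12` length for bank `5`, `13` whether something has been found,
`14` the chosen element, `15` its layer, `16` the source, and above that local variables. -/

local infixr:60 " ;; " => Prog.seq

attribute [local simp] Expr.eval Expr.InBounds Expr.size

abbrev Program := Prog 24 9

abbrev Config := State 24 9

/-! ### Membership in a list, probing a set, and the source -/

/-- Write into register `22` whether the number in register `y` occurs in bank `k`. -/
def member (k : Fin 9) (len y : Fin 24) : Program :=
  .assign 22 (.lit 0) ;; .assign 23 (.lit 0) ;;
  .loop (.lt (.reg 23) (.reg len))
    (.branch (.eq (.cell k (.reg 23)) (.reg y)) (.assign 22 (.lit 1)) .skip ;;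
      .assign 23 (.add (.reg 23) (.lit 1)))

/-- Write into register `21` whether the element in register `18` can be added to the set that is
listed in the first cells of bank `6`, whose number is in register `19`. -/
def probe : Program :=
  .assign 22 (.cell 6 (.reg 19)) ;; .store 6 (.reg 19) (.reg 18) ;;
  .test 21 6 (.add (.reg 19) (.lit 1)) ;; .store 6 (.reg 19) (.reg 22)

/-- Write the source of `X` into register `16`. -/
def findSource : Program :=
  .assign 16 (.reg 0) ;; .assign 19 (.lit 0) ;; .assign 20 (.lit 0) ;;
  .loop (.lt (.reg 20) (.reg 12))
    (.assign 18 (.cell 5 (.reg 20)) ;; probe ;;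
      .branch (.reg 21)
        (.branch (.lt (.reg 18) (.reg 16)) (.assign 16 (.reg 18)) .skip) .skip ;;
      .assign 20 (.add (.reg 20) (.lit 1)))

variable {n : ℕ} {E : Env n} {σ : Config} {Q : Config → Prop}

theorem runs_member {k : Fin 9} {len y : Fin 24} (hlen : len.val < 22) (hy : y.val < 22)
    (hm : σ.reg len ≤ E.bankSize) (hw : 1 ≤ E.wordMax)
    (hQ : ∀ τ, Frame 22 9 σ τ →
      τ.reg 22 = (if ∃ j < σ.reg len, σ.mem k j = σ.reg y then 1 else 0) → Q τ) :
    Runs E (member k len y) σ (σ.reg len * 16 + 7) Q := by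
  have hlen' : len ≠ 22 ∧ len ≠ 23 := by constructor <;> rintro rfl <;> simp at hlen
  have hy' : y ≠ 22 ∧ y ≠ 23 := by constructor <;> rintro rfl <;> simp at hy
  refine Runs.le (Runs.seq <| Runs.assign (by simp) (by simp) <| Runs.seq <|
    Runs.assign (by simp) (by simp) <|
    Runs.loop (fun k' τ => Frame 22 9 σ τ ∧ τ.reg 23 = k' ∧ k' ≤ σ.reg len ∧
      τ.reg 22 = (if ∃ j < k', σ.mem k j = σ.reg y then 1 else 0))
      (σ.reg len) 13 ?_ ?_ ?_ ?_) ?_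
  · refine ⟨?_, by simp, by simp, by simp⟩
    exact (Frame.rfl.setReg (by simp)).setReg (by simp)
  · intro k' τ _
    simp
  · rintro k' τ ⟨hf, h23, hk', h22⟩ hb hlt
    have hl : τ.reg len = σ.reg len := hf.reg len hlen
    simp [h23, hl] at hlt
    have hb' := hb.1 len
    refine ⟨hlt, Runs.le (Runs.seq (T₂ := 4) <| Runs.branch (T₁ := 2) (T₂ := 1) ?_ (fun h => ?_)
      (fun h => ?_)) ?_⟩
    · simp; omega
    · refine Runs.assign (by simp) (fun _ => by simpa using hw) (Runs.assign (by simp) (fun _ => ?_) ?_)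
      · simp; omega
      · refine ⟨(hf.setReg (by simp)).setReg (by simp), by simp [h23], hlt, ?_⟩
        simp [h23, hf.mem k k.isLt, hf.reg y hy] at h
        have : ∃ j < k' + 1, σ.mem k j = σ.reg y := ⟨k', by omega, h⟩
        rw [if_pos this]
        simp
    · refine Runs.skip (Runs.assign (by simp) (fun _ => by simp; omega) ?_)
      refine ⟨hf.setReg (by simp), by simp [h23], hlt, ?_⟩
      simp [h23, hf.mem k k.isLt, hf.reg y hy] at h
      have : (∃ j < k' + 1, σ.mem k j = σ.reg y) ↔ ∃ j < k', σ.mem k j = σ.reg y := by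
        constructor
        · rintro ⟨j, hj, hjy⟩
          refine ⟨j, ?_, hjy⟩
          rcases Nat.lt_succ_iff_lt_or_eq.1 hj with hj | rfl
          · exact hj
          · exact absurd hjy h
        · rintro ⟨j, hj, hjy⟩
          exact ⟨j, by omega, hjy⟩
      simp only [this]
      simp [h22]
    · simp
  · rintro k' τ ⟨hf, h23, hk', h22⟩ hge
    simp [h23, hf.reg len hlen] at hge
    refine hQ τ hf ?_
    rw [h22, le_antisymm hk' hge]
  · simp; omega

/-- The probed element is written just behind the list of `B`, and the old content of that cell is
put back after the test. So memory is unchanged even if the cell belongs to a larger set of which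
`B` is a prefix. -/
theorem runs_probe {B : Finset (Fin n)} {x : Fin n} (hB : Listing (σ.mem 6) (σ.reg 19) B)
    (hx : σ.reg 18 = x.val) (hxB : x ∉ B) (hm : σ.reg 19 < E.bankSize) (hw : 1 ≤ E.wordMax)
    (hQ : ∀ v, Q ((σ.setReg 22 v).setReg 21 (if insert x B ∈ E.family then 1 else 0))) :
    Runs E probe σ (E.testTime + 12) Q := by
  refine Runs.le (Runs.seq <| Runs.assign ?_ (fun hb => ?_) <| Runs.seq <|
    Runs.store ?_ ?_ ?_ (fun hb => ?_) <| Runs.seq <| Runs.test (X := insert x B) ?_ ?_ ?_ hw <|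
    Runs.store ?_ ?_ ?_ (fun hb => ?_) ?_) ?_
  · simpa using hm
  · exact hb.2 _ _
  · simp
  · simp
  · simpa using hm
  · exact hb.1 _
  · simp
  · simpa using hm
  · simpa using hB.push hxB hx
  · simp
  · simp
  · simpa using hm
  · exact hb.1 _
  · convert hQ (σ.mem 6 (σ.reg 19)) using 1
    simp [State.setCell, State.setReg]
  · simp; omega

theorem runs_findSource {X : Finset (Fin n)} (hF : Commutable E.family)
    (hX : Listing (σ.mem 5) (σ.reg 12) X) (hXF : X ∈ E.family) (hne : X.Nonempty)
    (h0 : σ.reg 0 = n) (hm : σ.reg 12 ≤ E.bankSize) (hw : 1 ≤ E.wordMax)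
    (hQ : ∀ τ t, Frame 16 9 σ τ → source E.family X = some t → τ.reg 16 = t.val → Q τ) :
    Runs E findSource σ (σ.reg 12 * (E.testTime + 33) + 9) Q := by
  have hpos : 0 < σ.reg 12 := hX.card_eq ▸ hne.card_pos
  -- The value `n`, above all elements, stands for having found nothing yet. Register `19` stays
  -- `0`, so the probes extend the empty set and test singletons.
  refine Runs.le (Runs.seq <| Runs.assign (by simp) (fun hb => hb.1 _) <| Runs.seq <|
    Runs.assign (by simp) (by simp) <| Runs.seq <| Runs.assign (by simp) (by simp) <|
    Runs.loop (fun k τ => Frame 16 9 σ τ ∧ τ.reg 20 = k ∧ k ≤ σ.reg 12 ∧ τ.reg 19 = 0 ∧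
      (∀ j < k, ∀ x : Fin n, σ.mem 5 j = x.val → {x} ∈ E.family → τ.reg 16 ≤ x.val) ∧
      (τ.reg 16 = n ∨ ∃ t ∈ X, {t} ∈ E.family ∧ τ.reg 16 = t.val))
      (σ.reg 12) (E.testTime + 30) ?_ ?_ ?_ ?_) ?_
  · refine ⟨?_, by simp, by simp, by simp, by simp, by simp [h0]⟩
    exact ((Frame.rfl.setReg (by simp)).setReg (by simp)).setReg (by simp)
  · intro k τ _
    simp
  · rintro k τ ⟨hf, h20, hk, h19, hmin, hmem⟩ hb hlt
    have h12 : τ.reg 12 = σ.reg 12 := hf.reg 12 (by simp)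
    simp [h20, h12] at hlt
    have h5 : τ.mem 5 = σ.mem 5 := hf.mem 5 (by simp)
    obtain ⟨x, hxX, hx⟩ := hX.exists_mem hlt
    have hb' := hb.1 12
    refine ⟨hlt, Runs.le (Runs.seq <| Runs.assign ?_ (fun hb => hb.2 _ _) <| Runs.seq <|
      runs_probe (B := ∅) (x := x) ?_ ?_ (by simp) ?_ hw fun v => Runs.seq (T₂ := 4) <|
      Runs.branch (T₁ := 6) (T₂ := 1) (by simp) (fun h => ?_) fun h => ?_) ?_⟩
    · simp; omega
    · simpa [h19] using Listing.empty
    · simp [h20, h5, hx]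
    · simp [h19]; omega
    · have hxF : {x} ∈ E.family := by simpa using h
      refine Runs.le (Runs.branch (by simp) (fun h => Runs.assign (by simp) (fun hb => hb.1 _) <|
        Runs.assign (by simp) (fun hb => ?_) ?_) fun h => Runs.skip <|
        Runs.assign (by simp) (fun hb => ?_) ?_) (by simp)
      · simp; omega
      · simp [h20, h5, hx] at h
        refine ⟨?_, by simp [h20], hlt, by simp [h19], ?_, ?_⟩
        · exact ((((hf.setReg (by simp)).setReg (by simp)).setReg (by simp)).setReg
            (by simp)).setReg (by simp)
        · intro j hj y hy hyF
          simp [h20, h5, hx]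
          rcases Nat.lt_succ_iff_lt_or_eq.1 hj with hj | rfl
          · have := hmin j hj y hy hyF
            omega
          · omega
        · right
          exact ⟨x, hxX, hxF, by simp [h20, h5, hx]⟩
      · simp; omega
      · simp [h20, h5, hx] at h
        refine ⟨?_, by simp [h20], hlt, by simp [h19], ?_, by simpa using hmem⟩
        · exact (((hf.setReg (by simp)).setReg (by simp)).setReg (by simp)).setReg (by simp)
        · intro j hj y hy hyF
          rcases Nat.lt_succ_iff_lt_or_eq.1 hj with hj | rfl
          · simpa using hmin j hj y hy hyF
          · simp; omega
    · have hxF : {x} ∉ E.family := by simpa using h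
      refine Runs.skip <| Runs.assign (by simp) (fun hb => ?_) ?_
      · simp; omega
      · refine ⟨?_, by simp [h20], hlt, by simp [h19], ?_, by simpa using hmem⟩
        · exact (((hf.setReg (by simp)).setReg (by simp)).setReg (by simp)).setReg (by simp)
        · intro j hj y hy hyF
          rcases Nat.lt_succ_iff_lt_or_eq.1 hj with hj | rfl
          · simpa using hmin j hj y hy hyF
          · obtain rfl : x = y := Fin.ext (hx.symm.trans hy)
            exact absurd hyF hxF
    · simp; omega
  · rintro k τ ⟨hf, h20, hk, h19, hmin, hmem⟩ hge
    simp [h20, hf.reg 12 (by simp)] at hge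
    obtain rfl := le_antisymm hk hge
    obtain ⟨t, ht⟩ := hF.exists_source hXF hne
    obtain ⟨htX, htF, htmin⟩ := source_eq_some_iff.1 ht
    refine hQ τ t hf ht ?_
    obtain ⟨j, hj, hjt⟩ := hX.mem_iff.1 htX
    have h₁ := hmin j hj t hjt htF
    rcases hmem with h | ⟨t', ht'X, ht'F, h⟩
    · have := t.isLt
      omega
    · have := htmin t' ht'X ht'F
      have : t.val ≤ t'.val := this
      omega
  · simp; ring_nf; omega

/-! ### The balls, listed as prefixes of one bank -/

/-- Extend the list of a ball in `X`, whose length is in register `15`, to a list of the next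
ball. -/
def expandBall : Program :=
  .assign 19 (.reg 15) ;; .assign 20 (.lit 0) ;;
  .loop (.lt (.reg 20) (.reg 12))
    (.branch (.cell 8 (.reg 20)) .skip
        (.assign 18 (.cell 5 (.reg 20)) ;; probe ;;
          .branch (.reg 21)
            (.store 6 (.reg 15) (.reg 18) ;; .assign 15 (.add (.reg 15) (.lit 1)) ;;
              .store 8 (.reg 20) (.lit 1))
            .skip) ;;
      .assign 20 (.add (.reg 20) (.lit 1)))

/-- List the balls in `X` around the source as prefixes of bank `6`, with sizes in bank `7`, and
write the number of the last one into register `17`. -/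
def findBalls : Program :=
  .store 6 (.lit 0) (.reg 16) ;; .store 7 (.lit 0) (.lit 1) ;; .assign 20 (.lit 0) ;;
  .loop (.lt (.reg 20) (.reg 12))
    (.store 8 (.reg 20) (.eq (.cell 5 (.reg 20)) (.reg 16)) ;;
      .assign 20 (.add (.reg 20) (.lit 1))) ;;
  .assign 17 (.lit 0) ;; .assign 15 (.lit 1) ;;
  .loop (.lt (.reg 15) (.reg 12))
    (expandBall ;; .assign 17 (.add (.reg 17) (.lit 1)) ;; .store 7 (.reg 17) (.reg 15))

/-- The marks in bank `8` tell which elements of the set in bank `5` are in `D`. -/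
def Marked (σ : Config) (D : Finset (Fin n)) : Prop :=
  ∀ j < σ.reg 12, ∀ x : Fin n, σ.mem 5 j = x.val → σ.mem 8 j = if x ∈ D then 1 else 0

/-- All probes are made against the old ball, whose length stays in register `19`, while accepted
elements are appended further on. The partial list `D` lies between the two balls, and the marks
keep elements of `D` from being probed again. -/
theorem runs_expandBall {X : Finset (Fin n)} {t : Fin n} {i : ℕ}
    (hX : Listing (σ.mem 5) (σ.reg 12) X) (ht : t ∈ X)
    (hB : Listing (σ.mem 6) (σ.reg 15) (ball E.family X t i))
    (hM : Marked σ (ball E.family X t i)) (hm : σ.reg 12 < E.bankSize) (hw : 1 ≤ E.wordMax)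
    (hQ : ∀ τ, Frame 15 6 σ τ → τ.mem 7 = σ.mem 7 → τ.reg 17 = σ.reg 17 →
      (∀ j < σ.reg 15, τ.mem 6 j = σ.mem 6 j) →
      Listing (τ.mem 6) (τ.reg 15) (ball E.family X t (i + 1)) →
      Marked τ (ball E.family X t (i + 1)) → Q τ) :
    Runs E expandBall σ (σ.reg 12 * (E.testTime + 44) + 7) Q := by
  refine Runs.le (Runs.seq <| Runs.assign (by simp) (fun hb => hb.1 _) <| Runs.seq <|
    Runs.assign (by simp) (by simp) <|
    Runs.loop (fun k τ => Frame 15 6 σ τ ∧ τ.mem 7 = σ.mem 7 ∧ τ.reg 17 = σ.reg 17 ∧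
      (∀ j < σ.reg 15, τ.mem 6 j = σ.mem 6 j) ∧ τ.reg 19 = σ.reg 15 ∧ τ.reg 20 = k ∧
      k ≤ σ.reg 12 ∧ ∃ D, Listing (τ.mem 6) (τ.reg 15) D ∧ Marked τ D ∧
        ball E.family X t i ⊆ D ∧ D ⊆ ball E.family X t (i + 1) ∧
        ∀ j < k, ∀ x : Fin n, σ.mem 5 j = x.val → insert x (ball E.family X t i) ∈ E.family →
          x ∈ D)
      (σ.reg 12) (E.testTime + 41) ?_ ?_ ?_ ?_) ?_
  · refine ⟨(Frame.rfl.setReg (by simp)).setReg (by simp), by simp, by simp, by simp, by simp,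
      by simp, by simp, _, by simpa using hB, ?_, Finset.Subset.refl _, ball_subset_succ i,
      by simp⟩
    simpa [Marked] using hM
  · intro k τ _
    simp
  · rintro k τ ⟨hf, h7, h17, h6, h19, h20, hk, D, hD, hDM, hBD, hDB, hDk⟩ hb hlt
    have h12 : τ.reg 12 = σ.reg 12 := hf.reg 12 (by simp)
    have h5 : τ.mem 5 = σ.mem 5 := hf.mem 5 (by simp)
    simp [h20, h12] at hlt
    obtain ⟨x, hxX, hx⟩ := hX.exists_mem hlt
    have hb' := hb.1 12
    have hDX : D ⊆ X := hDB.trans (ball_subset ht _)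
    have hmark := hDM k (by omega) x (by rw [h5, hx])
    have hBτ : Listing (τ.mem 6) (σ.reg 15) (ball E.family X t i) := hB.congr h6
    refine ⟨hlt, Runs.le (Runs.seq (T₂ := 4) <| Runs.branch (T₁ := 1)
      (T₂ := E.testTime + 32) ?_ (fun h => ?_) (fun h => ?_)) ?_⟩
    · simp; omega
    · simp [h20, hmark] at h
      refine Runs.skip (Runs.assign (by simp) (fun _ => by simp; omega) ?_)
      refine ⟨hf.setReg (by simp), by simpa, by simpa, by simpa, by simpa, by simp [h20], hlt, D,
        by simpa using hD, by simpa [Marked] using hDM, hBD, hDB, fun j hj y hy hyF => ?_⟩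
      rcases Nat.lt_succ_iff_lt_or_eq.1 hj with hj | rfl
      · exact hDk j hj y hy hyF
      · obtain rfl : x = y := Fin.ext (hx.symm.trans hy)
        exact h
    · simp [h20, hmark] at h
      refine Runs.le (Runs.seq <| Runs.assign ?_ (fun hb => hb.2 _ _) <| Runs.seq <|
        runs_probe (B := ball E.family X t i) (x := x) ?_ ?_ (fun hxB => h (hBD hxB)) ?_ hw
          fun v => Runs.branch (T₁ := 14) (T₂ := 1) (by simp) (fun hv => ?_) fun hv => ?_) ?_
      · simp; omega
      · simpa [h19] using hBτ
      · simp [h20, h5, hx]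
      · have := hB.card_eq
        have := hX.card_eq
        have := Finset.card_le_card (ball_subset (F := E.family) ht i)
        simp [h19]; omega
      · have hxF : insert x (ball E.family X t i) ∈ E.family := by simpa using hv
        -- The element `x` of `X` is not yet in `D`, so `D` is a proper subset of `X` and there is
        -- room to append.
        have hlt' : τ.reg 15 < σ.reg 12 := by
          rw [← hD.card_eq, ← hX.card_eq]
          exact Finset.card_lt_card ((Finset.ssubset_iff_of_subset hDX).2 ⟨x, hxX, h⟩)
        have hc : σ.reg 15 ≤ τ.reg 15 := by
          rw [← hD.card_eq, ← hB.card_eq]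
          exact Finset.card_le_card hBD
        refine Runs.le (Runs.seq <| Runs.store (by simp) (by simp) (by simp; omega)
          (fun hb => hb.1 _) <| Runs.seq <| Runs.assign (by simp) (fun _ => by simp; omega) <|
          Runs.store (by simp) (by simp) (by simp; omega) (fun _ => by simpa using hw) <|
          Runs.assign (by simp) (fun _ => by simp; omega) ?_) (by simp)
        refine ⟨?_, by simpa, by simpa, ?_, by simpa, by simp [h20], hlt, insert x D, ?_, ?_,
          hBD.trans (Finset.subset_insert _ _), ?_, ?_⟩
        · exact (((((((hf.setReg (by simp)).setReg (by simp)).setReg (by simp)).setCell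
            (by simp)).setReg (by simp)).setCell (by simp)).setReg (by simp))
        · intro j hj
          simp only [State.setReg_mem, State.setCell_mem]
          simp
          rw [Function.update_of_ne (by omega), h6 j hj]
        · simpa [h20, h5] using hD.push h hx
        · intro j hj y hy
          simp [h12, h5] at hj hy
          simp [h20]
          by_cases hjk : j = k
          · subst hjk
            obtain rfl : x = y := Fin.ext (hx.symm.trans hy)
            simp
          · rw [Function.update_of_ne hjk, hDM j (by omega) y (by rw [h5, hy])]
            -- Positions in the list of `X` determine elements, so only the mark of `x` changes.
            have hyx : y ≠ x := by
              rintro rfl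
              exact hjk (hX.inj hj hlt (hy.trans hx.symm))
            simp [hyx]
        · refine Finset.insert_subset (mem_ball_succ.2 (Or.inr ⟨hxX, ?_⟩)) hDB
          convert hxF
        · intro j hj y hy hyF
          rcases Nat.lt_succ_iff_lt_or_eq.1 hj with hj | rfl
          · exact Finset.mem_insert_of_mem (hDk j hj y hy hyF)
          · obtain rfl : x = y := Fin.ext (hx.symm.trans hy)
            exact Finset.mem_insert_self _ _
      · have hxF : insert x (ball E.family X t i) ∉ E.family := by simpa using hv
        refine Runs.skip (Runs.assign (by simp) (fun _ => by simp; omega) ?_)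
        refine ⟨?_, by simpa, by simpa, by simpa, by simpa, by simp [h20], hlt, D,
          by simpa using hD, by simpa [Marked] using hDM, hBD, hDB, fun j hj y hy hyF => ?_⟩
        · exact (((hf.setReg (by simp)).setReg (by simp)).setReg (by simp)).setReg (by simp)
        rcases Nat.lt_succ_iff_lt_or_eq.1 hj with hj | rfl
        · exact hDk j hj y hy hyF
        · obtain rfl : x = y := Fin.ext (hx.symm.trans hy)
          exact absurd hyF hxF
      · simp; omega
    · simp; omega
  · rintro k τ ⟨hf, h7, h17, h6, h19, h20, hk, D, hD, hDM, hBD, hDB, hDk⟩ hge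
    simp [h20, hf.reg 12 (by simp)] at hge
    obtain rfl := le_antisymm hk hge
    have : D = ball E.family X t (i + 1) := by
      refine hDB.antisymm fun x hx => ?_
      rcases mem_ball_succ.1 hx with h | ⟨hxX, hxF⟩
      · exact hBD h
      · obtain ⟨j, hj, hjx⟩ := hX.mem_iff.1 hxX
        refine hDk j hj x hjx ?_
        convert hxF
    subst this
    exact hQ τ hf h7 h17 h6 hD hDM
  · simp; ring_nf; omega

/-- The balls in `X` around `t` are available. -/
structure HasBalls (F : Finset (Finset (Fin n))) (X : Finset (Fin n)) (t : Fin n)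
    (σ : Config) : Prop where
  listing : ∀ i ≤ σ.reg 17, Listing (σ.mem 6) (σ.mem 7 i) (ball F X t i)
  last : ball F X t (σ.reg 17) = X
  lt : σ.reg 17 < σ.reg 12

theorem ite_one_zero_le (p : Prop) [Decidable p] : (if p then 1 else 0) ≤ 1 := by
  split_ifs <;> simp

theorem runs_findBalls {X : Finset (Fin n)} {t : Fin n} (hF : Commutable E.family)
    (hX : Listing (σ.mem 5) (σ.reg 12) X) (hXF : X ∈ E.family) (ht : t ∈ X)
    (htF : {t} ∈ E.family) (h16 : σ.reg 16 = t.val)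
    (hm : σ.reg 12 < E.bankSize) (hw : 1 ≤ E.wordMax)
    (hQ : ∀ τ, Frame 15 6 σ τ → HasBalls E.family X t τ → Q τ) :
    Runs E findBalls σ (σ.reg 12 * (σ.reg 12 * (E.testTime + 44) + 35) + 20) Q := by
  have hpos : 0 < σ.reg 12 := hX.card_eq ▸ Finset.card_pos.2 ⟨t, ht⟩
  refine Runs.le (Runs.seq <| Runs.store (by simp) (by simp) (by simp; omega)
    (fun hb => hb.1 _) <| Runs.seq <| Runs.store (by simp) (by simp) (by simp; omega)
    (fun _ => by simpa) <| Runs.seq <| Runs.assign (by simp) (by simp) <| Runs.seq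
    (T₂ := σ.reg 12 * (σ.reg 12 * (E.testTime + 44) + 7 + 10) + 7) <|
    Runs.loop (fun k τ => Frame 15 6 σ τ ∧ τ.reg 20 = k ∧ k ≤ σ.reg 12 ∧ τ.reg 16 = t.val ∧
      τ.mem 7 0 = 1 ∧ τ.mem 6 0 = t.val ∧
      ∀ j < k, ∀ x : Fin n, σ.mem 5 j = x.val → τ.mem 8 j = if x = t then 1 else 0)
      (σ.reg 12) 10 ?_ ?_ ?_ ?_) ?_
  · refine ⟨?_, by simp, by simp, by simp [h16], by simp, by simp [h16], by simp⟩
    exact ((Frame.rfl.setCell (by simp)).setCell (by simp)).setReg (by simp)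
  · intro k τ _
    simp
  · rintro k τ ⟨hf, h20, hk, h16, h7, h6, h8⟩ hb hlt
    have h12 : τ.reg 12 = σ.reg 12 := hf.reg 12 (by simp)
    have h5 : τ.mem 5 = σ.mem 5 := hf.mem 5 (by simp)
    simp [h20, h12] at hlt
    obtain ⟨x, hxX, hx⟩ := hX.exists_mem hlt
    have hb' := hb.1 12
    refine ⟨hlt, Runs.le (Runs.seq <| Runs.store (by simp) (by simp; omega) (by simp; omega)
      (fun _ => ?_) <| Runs.assign (by simp) (fun _ => by simp; omega) ?_) (by simp)⟩
    · exact (ite_one_zero_le _).trans hw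
    · refine ⟨(hf.setCell (by simp)).setReg (by simp), by simp [h20], hlt, by simpa, by simpa,
        by simpa, fun j hj y hy => ?_⟩
      rcases Nat.lt_succ_iff_lt_or_eq.1 hj with hj | rfl
      · simp [h20]
        rw [Function.update_of_ne (by omega), h8 j hj y hy]
      · simp [h20, h5, hy, h16, Fin.val_inj]
  · rintro k τ ⟨hf, h20, hk, h16, h7, h6, h8⟩ hge
    have h12 : τ.reg 12 = σ.reg 12 := hf.reg 12 (by simp)
    have h5 : τ.mem 5 = σ.mem 5 := hf.mem 5 (by simp)
    simp [h20, h12] at hge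
    obtain rfl := le_antisymm hk hge
    refine Runs.le (Runs.seq <| Runs.assign (by simp) (by simp) <| Runs.seq <|
      Runs.assign (by simp) (fun _ => by simpa) <|
      Runs.loop (fun i τ => Frame 15 6 σ τ ∧ τ.reg 17 = i ∧ i < σ.reg 12 ∧
        τ.mem 7 i = τ.reg 15 ∧ Marked τ (ball E.family X t i) ∧
        ∀ i' ≤ i, Listing (τ.mem 6) (τ.mem 7 i') (ball E.family X t i'))
        (σ.reg 12) (σ.reg 12 * (E.testTime + 44) + 7 + 7) ?_ ?_ ?_ ?_) ?_
    · refine ⟨(hf.setReg (by simp)).setReg (by simp), by simp, hpos, by simpa, ?_, ?_⟩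
      · intro j hj x hx
        simp at hj hx ⊢
        rw [h8 j (by omega) x (by rw [← h5, hx])]
        simp [ball]
      · intro i' hi'
        obtain rfl : i' = 0 := by omega
        simp [h7, ball]
        have := Listing.singleton (m := τ.mem 6) h6
        rwa [Function.update_eq_self] at this
    · intro i ρ _
      simp
    · rintro i ρ ⟨hf, h17, hi, h7, hM, hL⟩ hb hlt
      have h12 : ρ.reg 12 = σ.reg 12 := hf.reg 12 (by simp)
      have h5 : ρ.mem 5 = σ.mem 5 := hf.mem 5 (by simp)
      simp [h12] at hlt
      have hLi := hL i le_rfl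
      -- A ball has more elements than its index until it fills `X`; this keeps the number of rounds
      -- and the index in bank `7` below the size of `X`.
      have hi' : i < ρ.reg 15 := by
        rw [← h7, ← hLi.card_eq]
        refine (lt_card_ball hF hXF ht htF i).resolve_left fun h => ?_
        rw [h] at hLi
        have := hLi.card_eq.symm.trans hX.card_eq
        omega
      rw [h7] at hLi
      have hb' := hb.1 12
      refine ⟨hi, Runs.le (Runs.seq <| runs_expandBall (X := X) (t := t) (i := i) ?_ ht hLi hM
        (by omega) hw fun π hf' h7' h17' h6' hL' hM' => Runs.seq <|
        Runs.assign (by simp) (fun _ => ?_) <| Runs.store (by simp) (by simp) ?_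
          (fun hb => hb.1 _) ?_) ?_⟩
      · rwa [h5, h12]
      · simp [h17', h17]; omega
      · simp [h17', h17]; omega
      · refine ⟨((hf.trans hf').setReg (by simp)).setCell (by simp), by simp [h17', h17],
          by omega, by simp [h17', h17], ?_, ?_⟩
        · simpa [Marked] using hM'
        · intro i' hi'
          simp [h17', h17]
          rcases Nat.le_succ_iff.1 hi' with hi' | rfl
          · rw [Function.update_of_ne (by omega), h7']
            -- Appending happens behind the current ball, so the smaller balls remain valid
            -- prefixes.
            refine (hL i' hi').congr fun j hj => h6' j (hj.trans_le ?_)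
            rw [← h7, ← (hL i' hi').card_eq, ← (hL i le_rfl).card_eq]
            exact Finset.card_le_card (ball_mono hi')
          · simpa using hL'
      · simp [h12]
    · rintro i ρ ⟨hf, h17, hi, h7, hM, hL⟩ hge
      have h12 : ρ.reg 12 = σ.reg 12 := hf.reg 12 (by simp)
      simp [h12] at hge
      refine hQ ρ hf ⟨by rwa [h17], ?_, by omega⟩
      rw [h17]
      refine Finset.eq_of_subset_of_card_le (ball_subset ht i) ?_
      rw [hX.card_eq, (hL i le_rfl).card_eq, h7]
      exact hge
    · simp; ring_nf; omega
  · simp; ring_nf; omega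

/-! ### Addable elements, layers and the choice of the least key -/

/-- Write into register `21` whether the element in register `18` is in `X⁺_A`. -/
def testElement : Program :=
  member 5 12 18 ;; .assign 21 (.lit 0) ;;
  .branch (.reg 22) .skip
    (.branch (.reg 10) (.assign 22 (.lit 1)) (member 4 9 18) ;;
      .branch (.reg 22) (.assign 19 (.reg 12) ;; probe) .skip)

/-- Write the layer of the element in register `18` into register `20`. -/
def findLayer : Program :=
  .assign 21 (.lit 0) ;; .assign 20 (.lit 0) ;;
  .loop (.eq (.reg 21) (.lit 0))
    (.assign 19 (.cell 7 (.reg 20)) ;; probe ;; .assign 20 (.add (.reg 20) (.lit 1)))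

/-- Write `choose(X, A)` into register `14`, and into register `13` whether it exists. -/
def chooseElement : Program :=
  findSource ;; findBalls ;; .assign 13 (.lit 0) ;; .assign 15 (.add (.reg 12) (.lit 1)) ;;
  .assign 18 (.lit 0) ;;
  .loop (.lt (.reg 18) (.reg 0))
    (testElement ;;
      .branch (.reg 21)
        (findLayer ;;
          .branch (.lt (.reg 20) (.reg 15))
            (.assign 13 (.lit 1) ;; .assign 14 (.reg 18) ;; .assign 15 (.reg 20)) .skip)
        .skip ;;
      .assign 18 (.add (.reg 18) (.lit 1)))

/-- The set `A` is the ground set or listed in bank `4`. -/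
def Restricts (σ : Config) (A : Finset (Fin n)) : Prop :=
  σ.reg 10 ≠ 0 ∧ A = Finset.univ ∨ σ.reg 10 = 0 ∧ Listing (σ.mem 4) (σ.reg 9) A

theorem Restricts.of_frame {a k : ℕ} {τ : Config} {A : Finset (Fin n)} (h : Restricts σ A)
    (hf : Frame a k σ τ) (ha : 11 ≤ a) (hk : 5 ≤ k) : Restricts τ A := by
  unfold Restricts
  have h10 : τ.reg 10 = σ.reg 10 := hf.reg 10 (by simp; omega)
  have h9 : τ.reg 9 = σ.reg 9 := hf.reg 9 (by simp; omega)
  have h4 : τ.mem 4 = σ.mem 4 := hf.mem 4 (by simp; omega)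
  rw [h10, h9, h4]
  exact h

theorem HasBalls.of_frame {τ : Config} {X : Finset (Fin n)} {t : Fin n}
    {F : Finset (Finset (Fin n))} (h : HasBalls F X t σ)
    (hf : Frame 18 9 σ τ) : HasBalls F X t τ := by
  have h12 : τ.reg 12 = σ.reg 12 := hf.reg 12 (by simp)
  have h17 : τ.reg 17 = σ.reg 17 := hf.reg 17 (by simp)
  have h6 : τ.mem 6 = σ.mem 6 := hf.mem 6 (by simp)
  have h7 : τ.mem 7 = σ.mem 7 := hf.mem 7 (by simp)
  refine ⟨?_, by rw [h17]; exact h.last, by rw [h17, h12]; exact h.lt⟩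
  rw [h17, h6, h7]
  exact h.listing

/-- The last ball is `X` itself, so bank `6` also serves for testing whether an element can be added
to `X`. -/
theorem HasBalls.listing_last {X : Finset (Fin n)} {t : Fin n} {F : Finset (Finset (Fin n))}
    (h : HasBalls F X t σ) (hX : X.card = σ.reg 12) : Listing (σ.mem 6) (σ.reg 12) X := by
  have := h.listing _ le_rfl
  rw [h.last] at this
  rwa [← hX, this.card_eq]

theorem runs_testElement {X A : Finset (Fin n)} {y : Fin n}
    (hX : Listing (σ.mem 5) (σ.reg 12) X) (hX6 : Listing (σ.mem 6) (σ.reg 12) X)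
    (hA : Restricts σ A) (hy : σ.reg 18 = y.val) (hm : σ.reg 12 < E.bankSize)
    (hm' : σ.reg 9 ≤ E.bankSize) (hw : 1 ≤ E.wordMax)
    (hQ : ∀ τ, Frame 19 9 σ τ →
      τ.reg 21 = (if y ∈ ext E.family X A then 1 else 0) → Q τ) :
    Runs E testElement σ (E.bankSize * 32 + E.testTime + 40) Q := by
  have hmul₁ : σ.reg 12 * 16 ≤ E.bankSize * 16 := Nat.mul_le_mul_right _ hm.le
  have hmul₂ : σ.reg 9 * 16 ≤ E.bankSize * 16 := Nat.mul_le_mul_right _ hm'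
  refine Runs.le (Runs.seq <| runs_member (by simp) (by simp) hm.le hw fun τ hf h22 =>
    Runs.seq <| Runs.assign (by simp) (by simp) <|
    Runs.branch (T₁ := 1) (T₂ := E.bankSize * 16 + E.testTime + 26) (by simp) (fun h => ?_)
      fun h => ?_) ?_
  · refine Runs.skip (hQ _ ((hf.mono (by simp) le_rfl).setReg (by simp)) ?_)
    have : y ∈ X := by simpa [h22, hX.mem_iff, hy] using h
    have : y ∉ ext E.family X A := fun h => (mem_ext.1 h).2.1 this
    simp [this]
  · have hyX : y ∉ X := by simpa [h22, hX.mem_iff, hy] using h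
    have h12 : τ.reg 12 = σ.reg 12 := hf.reg 12 (by simp)
    have h9 : τ.reg 9 = σ.reg 9 := hf.reg 9 (by simp)
    have h18 : τ.reg 18 = σ.reg 18 := hf.reg 18 (by simp)
    have h4 : τ.mem 4 = σ.mem 4 := hf.mem 4 (by simp)
    have h6 : τ.mem 6 = σ.mem 6 := hf.mem 6 (by simp)
    have hAτ := hA.of_frame hf (by simp) (by simp)
    have hf' : Frame 19 9 σ (τ.setReg 21 0) := (hf.mono (by simp) le_rfl).setReg (by simp)
    -- Whether `A` is the whole ground set or a list, the same probe follows once membership in `A`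
    -- is known.
    have main : ∀ ρ : Config, Frame 19 9 σ ρ → ρ.reg 21 = 0 →
        ρ.reg 22 = (if y ∈ A then 1 else 0) →
        Runs E (.branch (.reg 22) (.assign 19 (.reg 12) ;; probe) .skip) ρ
          (1 + (2 + (E.testTime + 12) + 1)) Q := by
      intro ρ hρ h21 h22
      have h12 : ρ.reg 12 = σ.reg 12 := hρ.reg 12 (by simp)
      refine Runs.branch (by simp) (fun h => Runs.seq <| Runs.assign (by simp)
        (fun hb => hb.1 _) <| runs_probe (B := X) (x := y) ?_ ?_ hyX ?_ hw fun v => ?_)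
        fun h => Runs.skip (hQ ρ hρ ?_)
      · simpa [h12, hρ.mem 6 (by simp)] using hX6
      · simpa [hρ.reg 18 (by simp)] using hy
      · simpa [h12]
      · refine hQ _ (((hρ.setReg (by simp)).setReg (by simp)).setReg (by simp)) ?_
        have hyA : y ∈ A := by simpa [h22] using h
        have : insert y X ∈ E.family ↔ y ∈ ext E.family X A := by
          rw [mem_ext]
          exact ⟨fun h => ⟨hyA, hyX, by convert h⟩, fun h => by convert h.2.2⟩
        simp [this]
      · have hyA : y ∉ A := by simpa [h22] using h
        have : y ∉ ext E.family X A := fun h => hyA (mem_ext.1 h).1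
        simp [this, h21]
    refine Runs.le (Runs.seq (T₂ := 1 + (2 + (E.testTime + 12) + 1)) <|
      Runs.branch (T₁ := 2) (T₂ := E.bankSize * 16 + 7) (by simp) (fun h => ?_) fun h => ?_) ?_
    · refine Runs.assign (by simp) (fun _ => by simpa) (main _ (hf'.setReg (by simp)) (by simp) ?_)
      rcases hAτ with h' | h'
      · simp [h'.2]
      · exact absurd h'.1 (by simpa using h)
    · refine Runs.le (runs_member (by simp) (by simp) ?_ hw fun ρ hρ h22 =>
        main ρ (hf'.trans (hρ.mono (by simp) le_rfl)) ?_ ?_) ?_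
      · simpa [h9]
      · simp [hρ.reg 21 (by simp)]
      · rcases hAτ with h' | h'
        · exact absurd (by simpa using h) h'.1
        · rw [h22]
          simp [h'.2.mem_iff, h18, hy]
      · simp [h9]; omega
    · simp; omega
  · simp; omega

theorem runs_findLayer {X : Finset (Fin n)} {t y : Fin n} (hB : HasBalls E.family X t σ)
    (ht : t ∈ X) (hX : X.card = σ.reg 12)
    (hyX : y ∈ ext E.family X Finset.univ) (hy : σ.reg 18 = y.val)
    (hm : σ.reg 12 < E.bankSize) (hmw : E.bankSize ≤ E.wordMax)
    (hQ : ∀ τ, Frame 19 9 σ τ → τ.reg 20 = layerFrom E.family X t y →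
      τ.reg 20 ≤ σ.reg 12 → Q τ) :
    Runs E findLayer σ (E.bankSize * (E.testTime + 22) + 7) Q := by
  obtain ⟨-, hyX, hyF⟩ := mem_ext.1 hyX
  -- The counter is increased after each probe, so after success at ball `k - 1` it holds `k`, which
  -- is the layer in the numbering that starts with `1`.
  refine Runs.le (Runs.seq <| Runs.assign (by simp) (by simp) <| Runs.seq <|
    Runs.assign (by simp) (by simp) <|
    Runs.loop (fun k τ => Frame 19 9 σ τ ∧ τ.reg 20 = k ∧ k ≤ σ.reg 17 + 1 ∧
      (τ.reg 21 = 0 → ∀ i < k, y ∉ ext E.family (ball E.family X t i) Finset.univ) ∧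
      (τ.reg 21 ≠ 0 → 0 < k ∧ y ∈ ext E.family (ball E.family X t (k - 1)) Finset.univ ∧
        ∀ i < k - 1, y ∉ ext E.family (ball E.family X t i) Finset.univ))
      (σ.reg 17 + 1) (E.testTime + 19) ?_ ?_ ?_ ?_) ?_
  · exact ⟨(Frame.rfl.setReg (by simp)).setReg (by simp), by simp, by simp, by simp, by simp⟩
  · intro k τ _
    simp
  · rintro k τ ⟨hf, h20, hk, h0, -⟩ hb h21
    have h21 : τ.reg 21 = 0 := by
      by_contra h
      exact h21 (if_neg h)
    have h0 := h0 h21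
    have hBτ := hB.of_frame (hf.mono (by simp) le_rfl)
    have h17 : τ.reg 17 = σ.reg 17 := hf.reg 17 (by simp)
    have hlt := hB.lt
    -- The last ball is `X`, to which `y` can be added, so the search succeeds there at the latest.
    have hk' : k < σ.reg 17 + 1 := by
      refine hk.lt_of_ne ?_
      rintro rfl
      refine h0 (σ.reg 17) (by omega) ?_
      rw [hB.last]
      exact mem_ext.2 ⟨Finset.mem_univ _, hyX, hyF⟩
    have hL := hBτ.listing k (by omega)
    have hcard := Finset.card_le_card (ball_subset (F := E.family) ht k)
    rw [hL.card_eq, hX] at hcard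
    have hyk : y ∉ ball E.family X t k := fun h => hyX (ball_subset ht k h)
    refine ⟨hk', Runs.le (Runs.seq <| Runs.assign ?_ (fun hb => hb.2 _ _) <| Runs.seq <|
      runs_probe (B := ball E.family X t k) (x := y) ?_ ?_ hyk ?_ (by omega) fun v =>
      Runs.assign (by simp) (fun _ => ?_) ?_) ?_⟩
    · simp; omega
    · simpa [h20] using hL
    · simpa [hf.reg 18 (by simp)] using hy
    · simp [h20]; omega
    · simp; omega
    · have hiff : insert y (ball E.family X t k) ∈ E.family ↔
          y ∈ ext E.family (ball E.family X t k) Finset.univ := by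
        rw [mem_ext]
        exact ⟨fun h => ⟨Finset.mem_univ _, hyk, by convert h⟩, fun h => by convert h.2.2⟩
      refine ⟨(((hf.setReg (by simp)).setReg (by simp)).setReg (by simp)).setReg (by simp),
        by simp [h20], hk', fun h i hi => ?_, fun h => ⟨by omega, ?_, by simpa using h0⟩⟩
      · rcases Nat.lt_succ_iff_lt_or_eq.1 hi with hi | rfl
        · exact h0 i hi
        · simpa [hiff] using h
      · simpa [hiff] using h
    · simp; omega
  · rintro k τ ⟨hf, h20, hk, -, h1⟩ h21
    have h21 : τ.reg 21 ≠ 0 := fun h => absurd (h21.symm.trans (if_pos h)) (by simp)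
    obtain ⟨hpos, hyk, hmin⟩ := h1 h21
    have hlt := hB.lt
    refine hQ τ hf ?_ (by omega)
    rw [h20]
    refine le_antisymm ?_ ?_
    · refine le_csInf ⟨k, hpos, hyk⟩ ?_
      rintro i ⟨hi, hyi⟩
      by_contra hlt
      exact hmin (i - 1) (by omega) hyi
    · have := layerFrom_le hyk
      omega
  · have : (σ.reg 17 + 1) * (E.testTime + 22) ≤ E.bankSize * (E.testTime + 22) :=
      Nat.mul_le_mul_right _ (by have := hB.lt; omega)
    simp [add_assoc]; omega

/-- What is known about `choose(X, A)` when the elements below `k` have been considered. -/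
def Best (F : Finset (Finset (Fin n))) (X A : Finset (Fin n)) (k : ℕ) (τ : Config) : Prop :=
  (τ.reg 13 = 0 ∧ τ.reg 15 = τ.reg 12 + 1 ∧ ∀ y ∈ ext F X A, k ≤ y.val) ∨
  (τ.reg 13 = 1 ∧ ∃ x ∈ ext F X A, τ.reg 14 = x.val ∧ τ.reg 15 = layer F X x ∧ x.val < k ∧
    ∀ y ∈ ext F X A, y.val < k → toLex (layer F X x, x) ≤ toLex (layer F X y, y))

theorem Best.of_frame {F : Finset (Finset (Fin n))} {X A : Finset (Fin n)} {k : ℕ} {τ : Config}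
    (h : Best F X A k σ) (hf : Frame 16 0 σ τ) : Best F X A k τ := by
  unfold Best
  have h12 : τ.reg 12 = σ.reg 12 := hf.reg 12 (by simp)
  have h13 : τ.reg 13 = σ.reg 13 := hf.reg 13 (by simp)
  have h14 : τ.reg 14 = σ.reg 14 := hf.reg 14 (by simp)
  have h15 : τ.reg 15 = σ.reg 15 := hf.reg 15 (by simp)
  rw [h12, h13, h14, h15]
  exact h

theorem Best.succ_of_notMem {F : Finset (Finset (Fin n))} {X A : Finset (Fin n)} {y : Fin n}
    (h : Best F X A y.val σ) (hy : y ∉ ext F X A) : Best F X A (y.val + 1) σ := by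
  rcases h with ⟨h13, h15, h⟩ | ⟨h13, x, hx, h14, h15, hxk, h⟩
  · refine Or.inl ⟨h13, h15, fun z hz => ?_⟩
    refine Nat.succ_le_of_lt ((h z hz).lt_of_ne fun he => hy ?_)
    rwa [Fin.ext he]
  · refine Or.inr ⟨h13, x, hx, h14, h15, by omega, fun z hz hzk => h z hz ?_⟩
    refine (Nat.le_of_lt_succ hzk).lt_of_ne fun he => hy ?_
    rwa [← Fin.ext he]

/-- Elements are scanned in increasing order, so on equal layers the earlier one has the smaller key
and is kept. -/
theorem Best.succ_of_le {F : Finset (Finset (Fin n))} {X A : Finset (Fin n)} {y : Fin n}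
    (h : Best F X A y.val σ) (hle : σ.reg 15 ≤ layer F X y) (hc : layer F X y ≤ σ.reg 12) :
    Best F X A (y.val + 1) σ := by
  rcases h with ⟨h13, h15, h⟩ | ⟨h13, x, hx, h14, h15, hxk, h⟩
  -- Without a candidate so far, register `15` would hold one more than the size of `X`, which
  -- exceeds every layer.
  · omega
  · refine Or.inr ⟨h13, x, hx, h14, h15, by omega, fun z hz hzk => ?_⟩
    rcases Nat.lt_succ_iff_lt_or_eq.1 hzk with hzk | hzk
    · exact h z hz hzk
    · obtain rfl := Fin.ext hzk
      rw [h15] at hle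
      rw [Prod.Lex.toLex_le_toLex]
      rcases hle.lt_or_eq with h | h
      · exact Or.inl h
      · exact Or.inr ⟨h, Fin.le_def.2 hxk.le⟩

theorem Best.succ_of_lt {F : Finset (Finset (Fin n))} {X A : Finset (Fin n)} {y : Fin n}
    {τ : Config} (h : Best F X A y.val σ) (hy : y ∈ ext F X A) (hlt : layer F X y < σ.reg 15)
    (h13 : τ.reg 13 = 1) (h14 : τ.reg 14 = y.val) (h15 : τ.reg 15 = layer F X y) :
    Best F X A (y.val + 1) τ := by
  refine Or.inr ⟨h13, y, hy, h14, h15, by omega, fun z hz hzk => ?_⟩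
  rcases Nat.lt_succ_iff_lt_or_eq.1 hzk with hzk | hzk
  · rcases h with ⟨-, -, h⟩ | ⟨-, x, hx, -, h15', -, h⟩
    · have := h z hz
      omega
    · refine le_trans ?_ (h z hz hzk)
      rw [Prod.Lex.toLex_le_toLex]
      left
      simpa [← h15'] using hlt
  · obtain rfl := Fin.ext hzk
    exact le_rfl

theorem Best.choose_eq {F : Finset (Finset (Fin n))} {X A : Finset (Fin n)}
    (h : Best F X A n σ) : (σ.reg 13 = 0 ∧ choose F X A = none) ∨
      (σ.reg 13 = 1 ∧ ∃ x, choose F X A = some x ∧ σ.reg 14 = x.val) := by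
  rcases h with ⟨h13, -, h⟩ | ⟨h13, x, hx, h14, -, -, h⟩
  · refine Or.inl ⟨h13, choose_eq_none_iff.2 (Finset.eq_empty_of_forall_notMem fun y hy => ?_)⟩
    have := h y hy
    omega
  · exact Or.inr ⟨h13, x, choose_eq_some_iff.2 ⟨hx, fun y hy => h y hy y.isLt⟩, h14⟩

/-- Source and balls cost `O(m²)` tests for bank size `m`, and each of the `n` elements costs `O(m)`
tests; scans of lists are of the same order. -/
theorem runs_chooseElement {X A : Finset (Fin n)} (hF : Commutable E.family)
    (hX : Listing (σ.mem 5) (σ.reg 12) X) (hXF : X ∈ E.family) (hne : X.Nonempty)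
    (hA : Restricts σ A) (h0 : σ.reg 0 = n) (hm : σ.reg 12 < E.bankSize)
    (hm' : σ.reg 9 ≤ E.bankSize) (hmw : E.bankSize ≤ E.wordMax) (hmn : E.bankSize ≤ 3 * n)
    (hg : 0 < E.testTime)
    (hQ : ∀ τ, Frame 13 6 σ τ → ((τ.reg 13 = 0 ∧ choose E.family X A = none) ∨
      (τ.reg 13 = 1 ∧ ∃ x, choose E.family X A = some x ∧ τ.reg 14 = x.val)) → Q τ) :
    Runs E chooseElement σ (n * E.bankSize * E.testTime * 600) Q := by
  refine Runs.le (Runs.seq <| runs_findSource hF hX hXF hne h0 hm.le (by omega)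
    fun τ t hf ht h16 => Runs.seq (T₁ := E.bankSize * (E.bankSize * (E.testTime + 44) + 35) + 20)
      (T₂ := n * (E.bankSize * 54 + E.bankSize * E.testTime + E.testTime + 75) + 12) ?_) ?_
  · obtain ⟨htX, htF⟩ := mem_source ht
    have h12 : τ.reg 12 = σ.reg 12 := hf.reg 12 (by simp)
    refine Runs.le (runs_findBalls (X := X) (t := t) hF ?_ hXF htX (by convert htF) h16
      (by omega) (by omega) fun ρ hρ hBρ => Runs.le (Runs.seq <| Runs.assign (by simp) (by simp) <|
      Runs.seq <| Runs.assign (by simp) (fun _ => ?_) <| Runs.seq <|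
      Runs.assign (by simp) (by simp) <|
      Runs.loop (fun k π => Frame 13 6 σ π ∧ π.reg 18 = k ∧ k ≤ n ∧ HasBalls E.family X t π ∧
        Best E.family X A k π)
        n (E.bankSize * 54 + E.bankSize * E.testTime + E.testTime + 72)
        ?_ ?_ ?_ ?_) ?_) ?_
    · rwa [h12, hf.mem 5 (by simp)]
    · simp [hρ.reg 12 (by simp), h12]; omega
    · have hf' : Frame 13 6 σ ρ := (hf.mono (by simp) (by simp)).trans (hρ.mono (by simp) (by simp))
      refine ⟨((hf'.setReg (by simp)).setReg (by simp)).setReg (by simp), by simp, by simp,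
        ⟨?_, ?_, ?_⟩, Or.inl ⟨by simp, by simp, by simp⟩⟩
      · simpa using hBρ.listing
      · simpa using hBρ.last
      · simpa using hBρ.lt
    · intro k π _
      simp
    · rintro k π ⟨hf, h18, hk, hB, hbest⟩ hb hlt
      have h12 : π.reg 12 = σ.reg 12 := hf.reg 12 (by simp)
      simp [h18, hf.reg 0 (by simp), h0] at hlt
      have hb0 := hb.1 0
      rw [hf.reg 0 (by simp), h0] at hb0
      obtain ⟨y, rfl⟩ : ∃ y : Fin n, k = y.val := ⟨⟨k, hlt⟩, rfl⟩
      have hX5 : Listing (π.mem 5) (π.reg 12) X := by rwa [h12, hf.mem 5 (by simp)]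
      refine ⟨hlt, Runs.le (Runs.seq <| runs_testElement hX5 (hB.listing_last hX5.card_eq)
        (hA.of_frame hf (by simp) (by simp)) h18 (by omega) ?_ (by omega) fun ρ hρ h21 =>
        Runs.seq (T₂ := 4) <| Runs.branch (T₁ := E.bankSize * (E.testTime + 22) + 7 + 11)
          (T₂ := 1) (by simp) (fun h => ?_) fun h => ?_) ?_⟩
      · rwa [hf.reg 9 (by simp)]
      · have hy : y ∈ ext E.family X A := by simpa [h21] using h
        have hBρ := hB.of_frame (hρ.mono (by simp) le_rfl)
        have h12' : ρ.reg 12 = σ.reg 12 := (hρ.reg 12 (by simp)).trans h12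
        refine Runs.seq <| runs_findLayer hBρ htX ?_ (ext_subset_ext_univ hy)
          ((hρ.reg 18 (by simp)).trans h18) (by omega) hmw fun μ hμ h20 h20' => ?_
        · rw [h12', hX.card_eq]
        rw [← layer_eq ht] at h20
        have hfμ := hρ.trans hμ
        have h18' : μ.reg 18 = y.val := (hfμ.reg 18 (by simp)).trans h18
        have hBμ := hB.of_frame (hfμ.mono (by simp) le_rfl)
        have hfσ : Frame 13 6 σ μ := hf.trans (hfμ.mono (by simp) (by simp))
        have hbestμ := hbest.of_frame (hfμ.mono (by simp) (by simp))
        refine Runs.le (Runs.branch (T₁ := 6) (T₂ := 1) (by simp) (fun h => ?_) fun h => ?_)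
          (by simp)
        · refine Runs.le (Runs.seq <| Runs.assign (by simp) (fun _ => by simp; omega) <|
            Runs.seq <| Runs.assign (by simp) (fun hb => hb.1 _) <|
            Runs.assign (by simp) (fun hb => hb.1 _) <|
            Runs.assign (by simp) (fun _ => by simp; omega) ?_) (by simp)
          refine ⟨?_, by simp [h18'], hlt, ⟨?_, ?_, ?_⟩, ?_⟩
          · exact (((hfσ.setReg (by simp)).setReg (by simp)).setReg (by simp)).setReg (by simp)
          · simpa using hBμ.listing
          · simpa using hBμ.last
          · simpa using hBμ.lt
          · refine hbestμ.succ_of_lt hy ?_ (by simp) (by simp [h18']) (by simp [h20])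
            simpa [h20] using h
        · refine Runs.skip <| Runs.assign (by simp) (fun _ => by simp; omega) ?_
          refine ⟨hfσ.setReg (by simp), by simp [h18'], hlt,
            hBμ.of_frame (Frame.rfl.setReg (by simp)), ?_⟩
          refine (hbestμ.succ_of_le ?_ ?_).of_frame (Frame.rfl.setReg (by simp))
          · simpa [h20] using h
          · have : μ.reg 12 = ρ.reg 12 := hμ.reg 12 (by simp)
            omega
      · have hy : y ∉ ext E.family X A := by simpa [h21] using h
        have h18' : ρ.reg 18 = y.val := (hρ.reg 18 (by simp)).trans h18
        refine Runs.skip <| Runs.assign (by simp) (fun _ => by simp; omega) ?_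
        refine ⟨(hf.trans (hρ.mono (by simp) (by simp))).setReg (by simp), by simp [h18'], hlt,
          (hB.of_frame (hρ.mono (by simp) le_rfl)).of_frame (Frame.rfl.setReg (by simp)), ?_⟩
        exact ((hbest.of_frame (hρ.mono (by simp) (by simp))).succ_of_notMem hy).of_frame
          (Frame.rfl.setReg (by simp))
      · simp; ring_nf; omega
    · rintro k π ⟨hf, h18, hk, hB, hbest⟩ hge
      simp [h18, hf.reg 0 (by simp), h0] at hge
      obtain rfl := le_antisymm hk hge
      exact hQ π hf hbest.choose_eq
    · simp; ring_nf; omega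
    · rw [h12]
      have : σ.reg 12 * (σ.reg 12 * (E.testTime + 44) + 35) ≤
          E.bankSize * (E.bankSize * (E.testTime + 44) + 35) := by gcongr
      omega
  · have h1 : σ.reg 12 * (E.testTime + 33) ≤ E.bankSize * (E.testTime + 33) := by gcongr
    generalize E.testTime = g at *
    generalize E.bankSize = m at *
    have hm1 : 1 ≤ m := by omega
    have hn1 : 1 ≤ n := by omega
    -- This is where a bank size of at most `3n` is used: the quadratic cost of the balls is
    -- absorbed.
    have e1 : m * m * g ≤ n * m * g * 3 := by
      calc m * m * g ≤ 3 * n * m * g := by gcongr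
        _ = n * m * g * 3 := by ring
    have e2 : m * m ≤ m * m * g := Nat.le_mul_of_pos_right _ hg
    have e3 : m * g ≤ n * m * g := by
      calc m * g = 1 * m * g := by ring
        _ ≤ n * m * g := by gcongr
    have e4 : m ≤ m * g := Nat.le_mul_of_pos_right _ hg
    have e5 : n * g ≤ n * m * g := by
      calc n * g = n * 1 * g := by ring
        _ ≤ n * m * g := by gcongr
    have e6 : n * m ≤ n * m * g := Nat.le_mul_of_pos_right _ hg
    have e7 : n ≤ n * g := Nat.le_mul_of_pos_right _ hg
    nlinarith

/-! ### Completion with early stopping, copying and comparing lists -/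

/-- Add chosen elements of `X⁺_A` to `X` until there is none, or the number in register `11` is
chosen. -/
def grow : Program :=
  chooseElement ;;
  -- Both sides are `0` or `1`, so the loop goes on exactly if an element was chosen and it is not
  -- the one to stop at.
  .loop (.lt (.eq (.reg 14) (.reg 11)) (.reg 13))
    (.store 5 (.reg 12) (.reg 14) ;; .assign 12 (.add (.reg 12) (.lit 1)) ;; chooseElement)

/-- Copy a list from one bank to another one. -/
def copyBank (src dst : Fin 9) (len len' : Fin 24) : Program :=
  .assign 20 (.lit 0) ;;
  .loop (.lt (.reg 20) (.reg len))
    (.store dst (.reg 20) (.cell src (.reg 20)) ;; .assign 20 (.add (.reg 20) (.lit 1))) ;;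
  .assign len' (.reg len)

/-- Write into register `13` whether the banks `4` and `5` list the same set. -/
def sameSet : Program :=
  .assign 13 (.eq (.reg 12) (.reg 9)) ;; .assign 20 (.lit 0) ;;
  .loop (.lt (.reg 20) (.reg 12))
    (.assign 18 (.cell 5 (.reg 20)) ;; member 4 9 18 ;;
      .branch (.reg 22) .skip (.assign 13 (.lit 0)) ;;
      .assign 20 (.add (.reg 20) (.lit 1)))

/-- The bounds on the resources that the subroutines rely on. -/
structure Suitable (E : Env n) : Prop where
  commutable : Commutable E.family
  -- The surplus leaves room for one more element behind a solution, be it a probed one or `w`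
  -- behind `P`, and makes the bank size at least `2`.
  card_le : ∀ X ∈ E.family, X.card + 2 ≤ E.bankSize
  bankSize_le_wordMax : E.bankSize ≤ E.wordMax
  bankSize_le : E.bankSize ≤ 3 * n
  testTime_pos : 0 < E.testTime

theorem Suitable.two_le_bankSize (hE : Suitable E) : 2 ≤ E.bankSize := by
  simpa using hE.card_le ∅ hE.commutable.empty_mem

theorem Suitable.one_le_wordMax (hE : Suitable E) : 1 ≤ E.wordMax := by
  have := hE.two_le_bankSize
  have := hE.bankSize_le_wordMax
  omega

theorem Suitable.pos (hE : Suitable E) : 0 < n := by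
  have := hE.two_le_bankSize
  have := hE.bankSize_le
  omega

/-- The unit in which running times are measured. -/
def budget (E : Env n) : ℕ := n * E.bankSize ^ 2 * E.testTime

theorem Suitable.bankSize_mul_le_budget (hE : Suitable E) :
    E.bankSize * E.testTime ≤ budget E := by
  have := hE.two_le_bankSize
  have := hE.pos
  calc E.bankSize * E.testTime = 1 * E.bankSize ^ 1 * E.testTime := by ring
    _ ≤ budget E := by unfold budget; gcongr <;> omega

theorem Suitable.bankSize_le_budget (hE : Suitable E) : E.bankSize ≤ budget E :=
  (Nat.le_mul_of_pos_right _ hE.testTime_pos).trans hE.bankSize_mul_le_budget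

theorem Suitable.bankSize_sq_le_budget (hE : Suitable E) :
    E.bankSize * E.bankSize ≤ budget E := by
  have := hE.pos
  have := hE.testTime_pos
  calc E.bankSize * E.bankSize = 1 * E.bankSize ^ 2 * 1 := by ring
    _ ≤ budget E := by unfold budget; gcongr <;> omega

theorem Suitable.testTime_le_budget (hE : Suitable E) : E.testTime ≤ budget E := by
  have := hE.two_le_bankSize
  exact (Nat.le_mul_of_pos_left _ (by omega)).trans hE.bankSize_mul_le_budget

/-- What `grow` establishes when started with the set `X`. -/
def Grown (F : Finset (Finset (Fin n))) (X A : Finset (Fin n)) (v : ℕ) (τ : Config) : Prop :=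
  ∃ k, Listing (τ.mem 5) (τ.reg 12) ((completeStep F A)^[k] X) ∧
    ((τ.reg 13 = 0 ∧ choose F ((completeStep F A)^[k] X) A = none ∧
        ∀ i < k, ∀ x, choose F ((completeStep F A)^[i] X) A = some x → x.val ≠ v) ∨
      (τ.reg 13 = 1 ∧ ∃ x, choose F ((completeStep F A)^[k] X) A = some x ∧ x.val = v))

/-- After `k` steps the list is longer than `k` and still a solution, so there are fewer choices
than cells in a bank. Multiplying by the cost of a choice gives the unit `budget`. -/
theorem runs_grow {X A : Finset (Fin n)} (hE : Suitable E)
    (hX : Listing (σ.mem 5) (σ.reg 12) X) (hXF : X ∈ E.family) (hne : X.Nonempty)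
    (hA : Restricts σ A) (h0 : σ.reg 0 = n) (hm : σ.reg 9 ≤ E.bankSize)
    (hQ : ∀ τ, Frame 12 5 σ τ → Grown E.family X A (σ.reg 11) τ → Q τ) :
    Runs E grow σ (budget E * 1300) Q := by
  have h12 := hE.card_le X hXF
  rw [hX.card_eq] at h12
  refine Runs.le (Runs.seq <| runs_chooseElement hE.commutable hX hXF hne hA h0 (by omega) hm
    hE.bankSize_le_wordMax hE.bankSize_le hE.testTime_pos fun τ hf hc =>
    Runs.loop (fun k τ => Frame 12 5 σ τ ∧
      Listing (τ.mem 5) (τ.reg 12) ((completeStep E.family A)^[k] X) ∧ k < τ.reg 12 ∧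
      (∀ i < k, ∀ x, choose E.family ((completeStep E.family A)^[i] X) A = some x →
        x.val ≠ σ.reg 11) ∧
      ((τ.reg 13 = 0 ∧ choose E.family ((completeStep E.family A)^[k] X) A = none) ∨
        (τ.reg 13 = 1 ∧ ∃ x, choose E.family ((completeStep E.family A)^[k] X) A = some x ∧
          τ.reg 14 = x.val)))
      E.bankSize (n * E.bankSize * E.testTime * 600 + 7) ?_ ?_ ?_ ?_) ?_
  · refine ⟨hf.mono (by simp) (by simp), ?_, ?_, by simp, hc⟩
    · rwa [hf.mem 5 (by simp), hf.reg 12 (by simp)]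
    · rw [hf.reg 12 (by simp), ← hX.card_eq]
      exact hne.card_pos
  · intro k τ _
    simp
  · rintro k τ ⟨hf, hL, hk, hne', hc⟩ hb hv
    have hXk : (completeStep E.family A)^[k] X ∈ E.family := iterate_mem hXF k
    rcases hc with ⟨h13, -⟩ | ⟨h13, x, hx, h14⟩
    · simp [h13] at hv
    have hv : x.val ≠ σ.reg 11 := by
      intro h
      simp [h13, hf.reg 11 (by simp), h14, h] at hv
    obtain ⟨-, hxX, hxF⟩ := mem_ext.1 (mem_ext_of_choose hx)
    have hstep : (completeStep E.family A)^[k + 1] X =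
        insert x ((completeStep E.family A)^[k] X) := by
      rw [Function.iterate_succ_apply', completeStep_of_choose hx]
    have hcard := hE.card_le _ hxF
    rw [Finset.card_insert_of_notMem hxX, hL.card_eq] at hcard
    have hmw := hE.bankSize_le_wordMax
    refine ⟨by omega, Runs.le (Runs.seq <| Runs.store (by simp) (by simp) (by simp; omega)
      (fun hb => hb.1 _) <| Runs.seq <| Runs.assign (by simp) (fun _ => by simp; omega) <|
      runs_chooseElement (X := (completeStep E.family A)^[k + 1] X) (A := A) hE.commutable ?_ ?_ ?_
        ?_ ?_ ?_ ?_ hmw hE.bankSize_le hE.testTime_pos fun ρ hρ hc => ?_) ?_⟩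
    · rw [hstep]
      simpa using (by convert hL.push hxX h14 : Listing _ _ (insert x _))
    · rw [hstep]; exact hxF
    · exact hne.mono (subset_iterate _ _ _)
    · exact hA.of_frame ((hf.setCell (by simp)).setReg (by simp)) (by simp) (by simp)
    · simpa [hf.reg 0 (by simp)] using h0
    · simp; omega
    · simpa [hf.reg 9 (by simp)] using hm
    · refine ⟨((hf.setCell (by simp)).setReg (by simp)).trans (hρ.mono (by simp) (by simp)), ?_,
        ?_, ?_, hc⟩
      · rw [hstep, hρ.mem 5 (by simp), hρ.reg 12 (by simp)]
        simpa using (by convert hL.push hxX h14 : Listing _ _ (insert x _))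
      · rw [hρ.reg 12 (by simp)]
        simpa using hk
      · intro i hi y hy
        rcases Nat.lt_succ_iff_lt_or_eq.1 hi with hi | rfl
        · exact hne' i hi y hy
        · obtain rfl := Option.some.inj (hx.symm.trans hy)
          exact hv
    · simp; omega
  · rintro k τ ⟨hf, hL, hk, hne', hc⟩ hv
    refine hQ τ hf ⟨k, hL, ?_⟩
    rcases hc with ⟨h13, hc⟩ | ⟨h13, x, hx, h14⟩
    · exact Or.inl ⟨h13, hc, hne'⟩
    · refine Or.inr ⟨h13, x, hx, ?_⟩
      by_contra h
      simp [h13, hf.reg 11 (by simp), h14, h] at hv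
  · have hm2 := hE.two_le_bankSize
    have hn := hE.pos
    have hg := hE.testTime_pos
    unfold budget
    generalize E.testTime = g at *
    generalize E.bankSize = m at *
    simp
    have e1 : m ≤ n * m * g := by
      calc m = 1 * m * 1 := by ring
        _ ≤ n * m * g := by gcongr <;> omega
    generalize hu : n * m * g = u at *
    have e2 : n * m ^ 2 * g = m * u := by rw [← hu]; ring
    rw [e2]
    have e3 : 2 * u ≤ m * u := by gcongr
    nlinarith

/-- The number `n` is no element, so with it as the stopping value growth is a full completion. -/
theorem Grown.complete {F : Finset (Finset (Fin n))} {X A : Finset (Fin n)} {τ : Config}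
    (h : Grown F X A n τ) : Listing (τ.mem 5) (τ.reg 12) (complete F X A) := by
  obtain ⟨k, hL, ⟨-, h, -⟩ | ⟨-, x, -, hx⟩⟩ := h
  · rwa [complete_eq_of_none h]
  · exact absurd hx x.isLt.ne

/-- Stopping at `w` leaves what precedes `w`. If growth ends without `w` being chosen, no later
iteration chooses it either. -/
theorem Grown.prefixBefore {F : Finset (Finset (Fin n))} {A : Finset (Fin n)} {s w : Fin n}
    {τ : Config} (h : Grown F {s} A w.val τ) :
    (τ.reg 13 = 0 ∧ ∀ C, ¬ PrefixBefore F A s w C) ∨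
      (τ.reg 13 = 1 ∧ ∃ C, PrefixBefore F A s w C ∧ Listing (τ.mem 5) (τ.reg 12) C) := by
  obtain ⟨k, hL, ⟨h13, hnone, hlt⟩ | ⟨h13, x, hx, hxw⟩⟩ := h
  · refine Or.inl ⟨h13, ?_⟩
    rintro C ⟨i, rfl, hi⟩
    rcases lt_or_ge i k with h | h
    · exact hlt i h w hi rfl
    · rw [iterate_of_none hnone h, hnone] at hi
      simp at hi
  · obtain rfl := Fin.ext hxw
    exact Or.inr ⟨h13, _, ⟨k, rfl, hx⟩, hL⟩

theorem runs_copyBank (hE : Suitable E) {src dst : Fin 9} {len len' : Fin 24} {X : Finset (Fin n)}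
    (hX : Listing (σ.mem src) (σ.reg len) X) (hne : src ≠ dst) (hlen : len ≠ 20)
    (hm : σ.reg len ≤ E.bankSize)
    (hQ : ∀ τ, (∀ i, i ≠ 20 → i ≠ len' → τ.reg i = σ.reg i) → τ.reg len' = σ.reg len →
      (∀ k, k ≠ dst → τ.mem k = σ.mem k) → τ.out = σ.out →
      Listing (τ.mem dst) (τ.reg len') X → Q τ) :
    Runs E (copyBank src dst len len') σ (budget E * 15) Q := by
  have := hE.bankSize_le_budget
  have := hE.two_le_bankSize
  have h : σ.reg len * 11 ≤ E.bankSize * 11 := Nat.mul_le_mul_right _ hm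
  refine Runs.le (Runs.seq <| Runs.assign (by simp) (by simp) <| Runs.seq (T₂ := 2) <|
    Runs.loop (fun k τ => (∀ i, i ≠ 20 → τ.reg i = σ.reg i) ∧ τ.reg 20 = k ∧ k ≤ σ.reg len ∧
      (∀ k, k ≠ dst → τ.mem k = σ.mem k) ∧ τ.out = σ.out ∧
      ∀ j < k, τ.mem dst j = σ.mem src j) (σ.reg len) 8 ?_ ?_ ?_ ?_) ?_
  · exact ⟨fun i hi => by simp [hi], by simp, by simp, by simp, by simp, by simp⟩
  · intro k τ _
    simp
  · rintro k τ ⟨hr, h20, hk, hmem, hout, hcopy⟩ hb hlt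
    simp [h20, hr len hlen] at hlt
    have hb' := hb.1 len
    rw [hr len hlen] at hb'
    refine ⟨hlt, Runs.le (Runs.seq <| Runs.store (by simp) (by simp; omega) (by simp; omega)
      (fun hb => hb.2 _ _) <| Runs.assign (by simp) (fun _ => by simp; omega) ?_) (by simp)⟩
    refine ⟨fun i hi => by simp [hi, hr], by simp [h20], hlt, fun k hk => by simp [hk, hmem],
      by simpa, fun j hj => ?_⟩
    simp [h20]
    rcases Nat.lt_succ_iff_lt_or_eq.1 hj with hj | rfl
    · rw [Function.update_of_ne (by omega), hcopy j hj]
    · simp [hmem src hne]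
  · rintro k τ ⟨hr, h20, hk, hmem, hout, hcopy⟩ hge
    simp [h20, hr len hlen] at hge
    obtain rfl := le_antisymm hk hge
    refine Runs.assign (by simp) (fun hb => hb.1 _) (hQ _ ?_ ?_ ?_ ?_ ?_)
    · intro i hi hi'
      simp [hi', hr i hi]
    · simp [hr len hlen]
    · simpa using hmem
    · simpa using hout
    · simpa [hr len hlen] using hX.congr hcopy
  · simp; omega

/-- The lists have no repetitions, so equal lengths and one inclusion suffice; checking the
inclusion costs the product of the lengths. -/
theorem runs_sameSet (hE : Suitable E) {X A : Finset (Fin n)} (hX : Listing (σ.mem 5) (σ.reg 12) X)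
    (hA : Listing (σ.mem 4) (σ.reg 9) A) (hm : σ.reg 12 ≤ E.bankSize)
    (hm' : σ.reg 9 ≤ E.bankSize)
    (hQ : ∀ τ, Frame 13 9 σ τ → τ.reg 13 = (if X = A then 1 else 0) → Q τ) :
    Runs E sameSet σ (budget E * 46) Q := by
  have hw := hE.one_le_wordMax
  have hmul : σ.reg 9 * 16 ≤ E.bankSize * 16 := Nat.mul_le_mul_right _ hm'
  refine Runs.le (Runs.seq <| Runs.assign (by simp) (fun _ => ?_) <| Runs.seq <|
    Runs.assign (by simp) (by simp) <|
    Runs.loop (fun k τ => Frame 13 9 σ τ ∧ τ.reg 20 = k ∧ k ≤ σ.reg 12 ∧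
      τ.reg 13 = if σ.reg 12 = σ.reg 9 ∧ ∀ j < k, ∀ x : Fin n, σ.mem 5 j = x.val → x ∈ A
        then 1 else 0)
      (σ.reg 12) (E.bankSize * 16 + 18) ?_ ?_ ?_ ?_) ?_
  · exact (ite_one_zero_le _).trans hw
  · exact ⟨(Frame.rfl.setReg (by simp)).setReg (by simp), by simp, by simp, by simp; congr⟩
  · intro k τ _
    simp
  · rintro k τ ⟨hf, h20, hk, h13⟩ hb hlt
    have h12 : τ.reg 12 = σ.reg 12 := hf.reg 12 (by simp)
    have h9 : τ.reg 9 = σ.reg 9 := hf.reg 9 (by simp)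
    have h5 : τ.mem 5 = σ.mem 5 := hf.mem 5 (by simp)
    have h4 : τ.mem 4 = σ.mem 4 := hf.mem 4 (by simp)
    simp [h20, h12] at hlt
    have hb' := hb.1 12
    obtain ⟨x, hxX, hx⟩ := hX.exists_mem hlt
    refine ⟨hlt, Runs.le (Runs.seq <| Runs.assign (by simp; omega) (fun hb => hb.2 _ _) <|
      Runs.seq <| runs_member (by simp) (by simp) (by simpa [h9]) hw fun ρ hρ h22 =>
      Runs.seq (T₂ := 4) <| Runs.branch (T₁ := 1) (T₂ := 2) (by simp) (fun h => ?_) fun h => ?_) ?_⟩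
    · have hxA : x ∈ A := by
        rw [hA.mem_iff]
        simpa [h22, h20, h5, h4, h9, hx] using h
      have hiff : (∀ j < k + 1, ∀ x : Fin n, σ.mem 5 j = x.val → x ∈ A) ↔
          ∀ j < k, ∀ x : Fin n, σ.mem 5 j = x.val → x ∈ A := by
        refine ⟨fun h j hj => h j (by omega), fun h j hj y hy => ?_⟩
        rcases Nat.lt_succ_iff_lt_or_eq.1 hj with hj | rfl
        · exact h j hj y hy
        · rwa [← Fin.ext (hx.symm.trans hy)]
      refine Runs.skip <| Runs.assign (by simp) (fun _ => ?_) ?_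
      · simp [hρ.reg 20 (by simp)]; omega
      · refine ⟨((hf.setReg (by simp)).trans (hρ.mono (by simp) le_rfl)).setReg (by simp),
          by simp [hρ.reg 20 (by simp), h20], hlt, ?_⟩
        simp only [hiff]
        simpa [hρ.reg 13 (by simp)] using h13
    · have hxA : x ∉ A := by
        rw [hA.mem_iff]
        simpa [h22, h20, h5, h4, h9, hx] using h
      refine Runs.assign (by simp) (by simp) <| Runs.assign (by simp) (fun _ => ?_) ?_
      · simp [hρ.reg 20 (by simp)]; omega
      · refine ⟨(((hf.setReg (by simp)).trans (hρ.mono (by simp) le_rfl)).setReg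
          (by simp)).setReg (by simp), by simp [hρ.reg 20 (by simp), h20], hlt, ?_⟩
        rw [if_neg fun h => hxA (h.2 k (by omega) x hx)]
        simp
    · simp [h9]; omega
  · rintro k τ ⟨hf, h20, hk, h13⟩ hge
    simp [h20, hf.reg 12 (by simp)] at hge
    obtain rfl := le_antisymm hk hge
    refine hQ τ hf ?_
    have hiff : (σ.reg 12 = σ.reg 9 ∧
        ∀ j < σ.reg 12, ∀ x : Fin n, σ.mem 5 j = x.val → x ∈ A) ↔ X = A := by
      constructor
      · rintro ⟨hc, h⟩
        refine Finset.eq_of_subset_of_card_le (fun x hx => ?_) (by rw [hX.card_eq, hA.card_eq, hc])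
        obtain ⟨j, hj, hjx⟩ := hX.mem_iff.1 hx
        exact h j hj x hjx
      · rintro rfl
        exact ⟨hX.card_eq.symm.trans hA.card_eq, fun j hj x hx => hX.mem_iff.2 ⟨j, hj, hx⟩⟩
    simpa only [hiff] using h13
  · have : σ.reg 12 * (E.bankSize * 16 + 21) ≤ E.bankSize * (E.bankSize * 16 + 21) := by gcongr
    have := hE.bankSize_le_budget
    have := hE.bankSize_sq_le_budget
    have := hE.two_le_bankSize
    simp [add_assoc]
    linarith

/-! ### The checks for one source -/

/-- Output the set listed in bank `3`. -/
def output : Program :=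
  .emit (.reg 7) ;; .assign 20 (.lit 0) ;;
  .loop (.lt (.reg 20) (.reg 7))
    (.emit (.cell 3 (.reg 20)) ;; .assign 20 (.add (.reg 20) (.lit 1)))

/-- Append `w` to the core `C` in bank `2`, and store the result in bank `5`. -/
def extendCore : Program :=
  copyBank 2 5 6 12 ;; .store 5 (.reg 12) (.reg 1) ;; .assign 12 (.add (.reg 12) (.lit 1))

/-- Output the set in bank `3` if bank `2` lists what precedes `w` in its canonical order. -/
def checkOrder : Program :=
  copyBank 3 4 7 9 ;; .store 5 (.lit 0) (.reg 5) ;; .assign 12 (.lit 1) ;;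
  .assign 10 (.lit 0) ;; .assign 11 (.reg 1) ;; grow ;;
  .branch (.reg 13)
    (copyBank 2 4 6 9 ;; sameSet ;; .branch (.reg 13) output .skip) .skip

/-- Complete `C ∪ {w}`, and check the source and the canonical order of the result. -/
def checkSource : Program :=
  extendCore ;; .assign 10 (.lit 1) ;; grow ;; copyBank 5 3 12 7 ;; findSource ;;
  .branch (.eq (.reg 16) (.reg 5)) checkOrder .skip

/-- Check `R = complete(C ∪ {w}, P ∪ {w})`, where `P` is listed in bank `4`. -/
def checkRestr : Program :=
  extendCore ;; .store 4 (.reg 9) (.reg 1) ;; .assign 9 (.add (.reg 9) (.lit 1)) ;;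
  .assign 10 (.lit 0) ;; grow ;; copyBank 1 4 3 9 ;; sameSet ;;
  .branch (.reg 13) checkSource .skip

/-- Check `P = complete(C)`, where `C` is listed in bank `5`. -/
def checkParent : Program :=
  copyBank 5 2 12 6 ;; .assign 10 (.lit 1) ;; .assign 11 (.reg 0) ;; grow ;;
  copyBank 0 4 2 9 ;; sameSet ;; .branch (.reg 13) checkRestr .skip

/-- Output the child with the source in register `5`, if there is one. -/
def trySource : Program :=
  .store 5 (.lit 0) (.reg 5) ;; .test 21 5 (.lit 1) ;;
  .branch (.reg 21)
    (.assign 12 (.lit 1) ;; copyBank 1 4 3 9 ;; .assign 10 (.lit 0) ;; .assign 11 (.reg 1) ;;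
      grow ;; .branch (.reg 13) checkParent .skip)
    .skip

/-- Output all children. -/
def listChildren : Program :=
  .loop (.lt (.reg 4) (.reg 3))
    (.assign 5 (.cell 1 (.reg 4)) ;; trySource ;; .assign 4 (.add (.reg 4) (.lit 1)))

/-! ### Correctness of the checks -/

/-- The registers `0, …, 5` and the banks `0` and `1` are the same in both states, and `v` has been
written to the output. -/
structure Emitted (σ τ : Config) (v : List ℕ) : Prop where
  reg : ∀ i : Fin 24, i.val < 6 → τ.reg i = σ.reg i
  mem : ∀ j : Fin 9, j.val < 2 → τ.mem j = σ.mem j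
  out : τ.out = σ.out ++ v

theorem Frame.emitted {a k : ℕ} {τ : Config} (h : Frame a k σ τ) (ha : 6 ≤ a) (hk : 2 ≤ k) :
    Emitted σ τ [] :=
  ⟨fun i hi => h.reg i (by omega), fun j hj => h.mem j (by omega), by simpa using h.out⟩

theorem Frame.trans_emitted {a k : ℕ} {τ ρ : Config} {v : List ℕ} (h : Frame a k σ τ)
    (h' : Emitted τ ρ v) (ha : 6 ≤ a) (hk : 2 ≤ k) : Emitted σ ρ v :=
  ⟨fun i hi => (h'.reg i hi).trans (h.reg i (by omega)),
    fun j hj => (h'.mem j hj).trans (h.mem j (by omega)), by rw [h'.out, h.out]⟩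

/-- Either a set with the property `G` has been written to the output, or there is none. -/
def Outcome (G : Finset (Fin n) → Prop) (σ τ : Config) : Prop :=
  (Emitted σ τ [] ∧ ∀ S, ¬ G S) ∨
    ∃ l : List (Fin n), l.Nodup ∧ G l.toFinset ∧ Emitted σ τ (l.length :: l.map Fin.val)

theorem Outcome.of_frame {G : Finset (Fin n) → Prop} {a k : ℕ} {τ ρ : Config}
    (h : Outcome G τ ρ) (hf : Frame a k σ τ) (ha : 6 ≤ a) (hk : 2 ≤ k) : Outcome G σ ρ := by
  rcases h with ⟨h, hG⟩ | ⟨l, hl, hG, h⟩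
  · exact Or.inl ⟨hf.trans_emitted h ha hk, hG⟩
  · exact Or.inr ⟨l, hl, hG, hf.trans_emitted h ha hk⟩

theorem Outcome.congr {G G' : Finset (Fin n) → Prop} {τ : Config} (h : Outcome G σ τ)
    (hG : ∀ S, G S ↔ G' S) : Outcome G' σ τ := by
  obtain rfl : G = G' := funext fun S => propext (hG S)
  exact h

theorem Frame.of_copy {a k : ℕ} {dst : Fin 9} {len' : Fin 24} {τ : Config}
    (hr : ∀ i, i ≠ 20 → i ≠ len' → τ.reg i = σ.reg i) (hm : ∀ k, k ≠ dst → τ.mem k = σ.mem k)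
    (ho : τ.out = σ.out) (ha : a ≤ 20) (ha' : a ≤ len'.val) (hk : k ≤ dst.val) :
    Frame a k σ τ := by
  refine ⟨fun i hi => hr i ?_ ?_, fun j hj => hm j ?_, ho⟩
  · rintro rfl; simp at hi; omega
  · rintro rfl; omega
  · rintro rfl; omega

theorem Suitable.card_add_two_le (hE : Suitable E) {m : ℕ → ℕ} {k : ℕ} {X : Finset (Fin n)}
    (h : Listing m k X) (hX : X ∈ E.family) : k + 2 ≤ E.bankSize :=
  h.card_eq ▸ hE.card_le X hX

/-- The input is in place, and register `5` holds `s`. -/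
structure Ready (P R : Finset (Fin n)) (w s : Fin n) (σ : Config) : Prop where
  reg_zero : σ.reg 0 = n
  reg_one : σ.reg 1 = w.val
  reg_five : σ.reg 5 = s.val
  listing_zero : Listing (σ.mem 0) (σ.reg 2) P
  listing_one : Listing (σ.mem 1) (σ.reg 3) R

theorem Ready.of_frame {P R : Finset (Fin n)} {w s : Fin n} {a k : ℕ} {τ : Config}
    (h : Ready P R w s σ) (hf : Frame a k σ τ) (ha : 6 ≤ a) (hk : 2 ≤ k) :
    Ready P R w s τ := by
  have hr : ∀ i : Fin 24, i.val < 6 → τ.reg i = σ.reg i := fun i hi => hf.reg i (by omega)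
  have hm : ∀ j : Fin 9, j.val < 2 → τ.mem j = σ.mem j := fun j hj => hf.mem j (by omega)
  refine ⟨?_, ?_, ?_, ?_, ?_⟩
  · rw [hr 0 (by simp)]; exact h.reg_zero
  · rw [hr 1 (by simp)]; exact h.reg_one
  · rw [hr 5 (by simp)]; exact h.reg_five
  · rw [hr 2 (by simp), hm 0 (by simp)]; exact h.listing_zero
  · rw [hr 3 (by simp), hm 1 (by simp)]; exact h.listing_one

theorem runs_output (hE : Suitable E) {S : Finset (Fin n)} (hS : Listing (σ.mem 3) (σ.reg 7) S)
    (hSF : S ∈ E.family) :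
    Runs E output σ (budget E * 20) fun τ => ∃ l : List (Fin n), l.Nodup ∧ l.toFinset = S ∧
      Emitted σ τ (l.length :: l.map Fin.val) := by
  have h7 := hE.card_add_two_le hS hSF
  have := hE.bankSize_le_budget
  obtain ⟨l, hl, hlS, hm⟩ := hS
  have hlen : l.length = σ.reg 7 := by simpa using congrArg List.length hm
  refine Runs.le (Runs.seq <| Runs.emit (by simp) <| Runs.seq <|
    Runs.assign (by simp) (by simp) <|
    Runs.loop (fun k τ => (∀ i, i ≠ 20 → τ.reg i = σ.reg i) ∧ τ.mem = σ.mem ∧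
      τ.reg 20 = k ∧ k ≤ σ.reg 7 ∧
      τ.out = σ.out ++ σ.reg 7 :: (List.range k).map (σ.mem 3)) (σ.reg 7) 7 ?_ ?_ ?_ ?_) ?_
  · exact ⟨fun i hi => by simp [hi], by simp, by simp, by simp, by simp⟩
  · intro k τ _
    simp
  · rintro k τ ⟨hr, hmem, h20, hk, hout⟩ hb hlt
    simp [h20, hr 7 (by simp)] at hlt
    have hb' := hb.1 7
    rw [hr 7 (by simp)] at hb'
    refine ⟨hlt, Runs.le (Runs.seq <| Runs.emit (by simp; omega) <|
      Runs.assign (by simp) (fun _ => by simp; omega) ?_) (by simp)⟩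
    refine ⟨fun i hi => by simp [hi, hr], by simpa, by simp [h20], hlt, ?_⟩
    simp [hout, hmem, h20, List.range_succ]
  · rintro k τ ⟨hr, hmem, h20, hk, hout⟩ hge
    simp [h20, hr 7 (by simp)] at hge
    obtain rfl := le_antisymm hk hge
    refine ⟨l, hl, hlS, fun i hi => hr i ?_, fun j _ => by rw [hmem], ?_⟩
    · rintro rfl; simp at hi
    · rw [hout, hlen, hm]
  · simp; omega

theorem runs_extendCore (hE : Suitable E) {P R C : Finset (Fin n)} {w s : Fin n}
    (hσ : Ready P R w s σ) (hC : Listing (σ.mem 2) (σ.reg 6) C) (hwC : w ∉ C)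
    (hCF : C ∈ E.family) (hQ : ∀ τ, Frame 12 5 σ τ →
      Listing (τ.mem 5) (τ.reg 12) (insert w C) → Q τ) :
    Runs E extendCore σ (budget E * 20) Q := by
  have h6 := hE.card_add_two_le hC hCF
  have := hE.bankSize_le_budget
  have := hE.bankSize_le_wordMax
  refine Runs.le (Runs.seq <| runs_copyBank hE hC (by simp) (by simp) (by omega)
    fun τ hr h12 hm ho hL => Runs.seq <| Runs.store (by simp) (by simp) ?_ (fun hb => hb.1 _) <|
    Runs.assign (by simp) (fun _ => ?_) ?_) ?_
  · simp [h12]; omega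
  · simp [h12]; omega
  · have hf : Frame 12 5 σ τ := Frame.of_copy hr hm ho (by simp) (by simp) (by simp)
    refine hQ _ ((hf.setCell (by simp)).setReg (by simp)) ?_
    have h1 : τ.reg 1 = w.val := (hσ.of_frame hf (by simp) (by simp)).reg_one
    simpa using hL.push hwC h1
  · simp; omega

/-- Growing `{s}` inside `S` until `w` is chosen yields a set `D`; by `PrefixBefore.unique`
comparing `D` with `C` decides the question. -/
theorem runs_checkOrder (hE : Suitable E) {P R C S : Finset (Fin n)} {w s : Fin n}
    (hσ : Ready P R w s σ) (hC : Listing (σ.mem 2) (σ.reg 6) C)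
    (hS : Listing (σ.mem 3) (σ.reg 7) S) (hCF : C ∈ E.family) (hSF : S ∈ E.family)
    (hsF : {s} ∈ E.family) :
    Runs E checkOrder σ (budget E * 1500)
      (Outcome (fun S' => S' = S ∧ PrefixBefore E.family S' s w C) σ) := by
  have h6 := hE.card_add_two_le hC hCF
  have h7 := hE.card_add_two_le hS hSF
  have := hE.bankSize_le_budget
  have := hE.bankSize_le_wordMax
  refine Runs.le (Runs.seq <| runs_copyBank hE hS (by simp) (by simp) (by omega)
    fun τ hr h9 hm ho hL => Runs.seq <| Runs.store (by simp) (by simp) (by simp; omega)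
    (fun hb => hb.1 _) <| Runs.seq <| Runs.assign (by simp) (fun _ => by simp; omega) <|
    Runs.seq <| Runs.assign (by simp) (by simp) <| Runs.seq <|
    Runs.assign (by simp) (fun hb => hb.1 _) <| Runs.seq <|
    runs_grow (X := {s}) (A := S) hE ?_ (by convert hsF) (by simp) (Or.inr ⟨by simp, by simpa⟩)
      ?_ ?_ fun ρ hρ hG => Runs.branch (T₁ := budget E * 15 + (budget E * 46 +
        (1 + (budget E * 20 + 1)))) (T₂ := 1) (by simp) (fun h => ?_) fun h => ?_) ?_
  · have hf : Frame 9 4 σ τ := Frame.of_copy hr hm ho (by simp) (by simp) (by simp)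
    have h5 : τ.reg 5 = s.val := (hσ.of_frame hf (by simp) (by simp)).reg_five
    simpa using Listing.singleton h5
  · simpa [hr 0 (by simp) (by simp)] using hσ.reg_zero
  · simp [h9]; omega
  pick_goal 3
  · simp; omega
  all_goals
    have hf : Frame 9 4 σ τ := Frame.of_copy hr hm ho (by simp) (by simp) (by simp)
    have hf' : Frame 9 4 σ ρ := ((((hf.setCell (by simp)).setReg (by simp)).setReg
      (by simp)).setReg (by simp)).trans (hρ.mono (by simp) (by simp))
    have h1 : τ.reg 1 = w.val := (hσ.of_frame hf (by simp) (by simp)).reg_one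
    simp [h1] at hG
    replace hG := hG.prefixBefore
  · rcases hG with ⟨h13, -⟩ | ⟨-, D, hD, hDL⟩
    · exact absurd h13 (by simpa using h)
    have hDF : D ∈ E.family := by
      obtain ⟨k, rfl, -⟩ := hD
      exact iterate_mem (by convert hsF) k
    have hCρ : Listing (ρ.mem 2) (ρ.reg 6) C := by
      rwa [hf'.mem 2 (by simp), hf'.reg 6 (by simp)]
    have h6' : ρ.reg 6 = σ.reg 6 := hf'.reg 6 (by simp)
    have hDm := hE.card_add_two_le hDL hDF
    refine Runs.seq <| runs_copyBank hE hCρ (by simp) (by simp) (by omega)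
      fun π hr h9 hm ho hL => Runs.seq <| runs_sameSet hE (X := D) (A := C) ?_ hL ?_ ?_
      fun μ hμ h13 => ?_
    · rwa [hm 5 (by simp), hr 12 (by simp) (by simp)]
    · rw [hr 12 (by simp) (by simp)]
      omega
    · omega
    have hfμ : Frame 8 4 σ μ := (hf'.mono (by simp) le_rfl).trans
      ((Frame.of_copy hr hm ho (by simp) (by simp) (by simp)).trans (hμ.mono (by simp) (by simp)))
    refine Runs.branch (by simp) (fun h => ?_) fun h => ?_
    · have hDC : D = C := by
        by_contra hne
        simp [h13, hne] at h
      subst hDC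
      refine (runs_output hE (S := S) ?_ hSF).mono ?_
      · rwa [hfμ.mem 3 (by simp), hfμ.reg 7 (by simp)]
      · rintro ν ⟨l, hl, rfl, h⟩
        exact Or.inr ⟨l, hl, ⟨rfl, hD⟩, hfμ.trans_emitted h (by simp) (by simp)⟩
    · refine Runs.skip (Or.inl ⟨hfμ.emitted (by simp) (by simp), ?_⟩)
      rintro _ ⟨rfl, hC⟩
      simp [h13, hD.unique hC] at h
  · rcases hG with ⟨-, hno⟩ | ⟨h13, -⟩
    · refine Runs.skip (Or.inl ⟨hf'.emitted (by simp) (by simp), ?_⟩)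
      rintro _ ⟨rfl, hC⟩
      exact hno C hC
    · simp [h13] at h

theorem runs_checkSource (hE : Suitable E) {P R C : Finset (Fin n)} {w s : Fin n}
    (hσ : Ready P R w s σ) (hC : Listing (σ.mem 2) (σ.reg 6) C) (hwC : w ∉ C)
    (hCF : C ∈ E.family) (hwF : insert w C ∈ E.family) (hsF : {s} ∈ E.family)
    (h11 : σ.reg 11 = n) (h9 : σ.reg 9 ≤ E.bankSize) :
    Runs E checkSource σ (budget E * 2900) (Outcome (fun S =>
      S = complete E.family (insert w C) Finset.univ ∧ source E.family S = some s ∧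
        PrefixBefore E.family S s w C) σ) := by
  have := hE.bankSize_le_budget
  have := hE.bankSize_mul_le_budget
  have := hE.bankSize_le_wordMax
  have := hE.two_le_bankSize
  refine Runs.le (Runs.seq <| runs_extendCore hE hσ hC hwC hCF fun τ hf hL => Runs.seq <|
    Runs.assign (by simp) (fun _ => by simp; omega) <| Runs.seq <|
    runs_grow (X := insert w C) (A := Finset.univ) hE (by simpa using hL) hwF (by simp)
    (Or.inl ⟨by simp, rfl⟩) ?_ ?_ fun ρ hρ hG =>
    Runs.seq (T₁ := budget E * 15) (T₂ := budget E * 46 + (3 + (budget E * 1500 + 1))) ?_) ?_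
  · simpa [hf.reg 0 (by simp)] using hσ.reg_zero
  · simpa [hf.reg 9 (by simp)] using h9
  · have hfρ : Frame 10 5 σ ρ := ((hf.mono (by simp) le_rfl).setReg (by simp)).trans
      (hρ.mono (by simp) (by simp))
    simp [hf.reg 11 (by simp), h11] at hG
    have hS := hG.complete
    have hSF : complete E.family (insert w C) Finset.univ ∈ E.family :=
      complete_mem (by convert hwF)
    have hSm := hE.card_add_two_le hS hSF
    have hne : (complete E.family (insert w C) Finset.univ).Nonempty :=
      ⟨w, subset_complete _ _ (Finset.mem_insert_self _ _)⟩
    refine runs_copyBank hE hS (by simp) (by simp) (by omega) fun π hr h7 hm ho hL =>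
      Runs.seq (Runs.le (runs_findSource hE.commutable
        (X := complete E.family (insert w C) Finset.univ) ?_ hSF hne ?_ ?_ hE.one_le_wordMax
        fun μ t hμ ht h16 => Runs.branch (T₁ := budget E * 1500) (T₂ := 1) (by simp)
          (fun h => ?_) fun h => ?_) ?_)
    · rwa [hm 5 (by simp), hr 12 (by simp) (by simp)]
    · rw [hr 0 (by simp) (by simp), hfρ.reg 0 (by simp)]
      exact hσ.reg_zero
    · rw [hr 12 (by simp) (by simp)]
      omega
    all_goals
      have hfπ : Frame 7 3 σ π := (hfρ.mono (by simp) (by simp)).trans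
        (Frame.of_copy hr hm ho (by simp) (by simp) (by simp))
    pick_goal 3
    · have : π.reg 12 * (E.testTime + 33) ≤ E.bankSize * (E.testTime + 33) := by
        rw [hr 12 (by simp) (by simp)]
        gcongr
        omega
      linarith
    all_goals
      have hfμ : Frame 7 3 σ μ := hfπ.trans (hμ.mono (by simp) (by simp))
      have hσμ := hσ.of_frame hfμ (by simp) (by simp)
    · have hts : t = s := by
        by_contra hne
        have : t.val ≠ s.val := fun h => hne (Fin.ext h)
        simp [h16, hσμ.reg_five, this] at h
      subst hts
      refine (runs_checkOrder hE (C := C)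
        (S := complete E.family (insert w C) Finset.univ) hσμ ?_ ?_ hCF hSF hsF).mono ?_
      · rwa [hfμ.mem 2 (by simp), hfμ.reg 6 (by simp)]
      · rwa [hμ.mem 3 (by simp), hμ.reg 7 (by simp)]
      · intro ν hν
        refine (hν.of_frame hfμ (by simp) (by simp)).congr fun S => ?_
        constructor
        · rintro ⟨rfl, h⟩
          exact ⟨rfl, ht, h⟩
        · rintro ⟨rfl, -, h⟩
          exact ⟨rfl, h⟩
    · refine Runs.skip (Or.inl ⟨hfμ.emitted (by simp) (by simp), ?_⟩)
      rintro _ ⟨rfl, hs, -⟩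
      obtain rfl := Option.some.inj (ht.symm.trans hs)
      simp [h16, hσμ.reg_five] at h
  · simp; omega

/-- Register `11` still holds `n` from the check of the parent, so growth is a full completion both
here and in `checkSource`. -/
theorem runs_checkRestr (hE : Suitable E) {P R C : Finset (Fin n)} {w s : Fin n}
    (hσ : Ready P R w s σ) (hC : Listing (σ.mem 2) (σ.reg 6) C) (hwC : w ∉ C)
    (hCF : C ∈ E.family) (hwF : insert w C ∈ E.family) (hsF : {s} ∈ E.family)
    (h11 : σ.reg 11 = n) (hwP : w ∉ P) (hPF : P ∈ E.family) (hRF : R ∈ E.family)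
    (hP : Listing (σ.mem 4) (σ.reg 9) P) :
    Runs E checkRestr σ (budget E * 4350) (Outcome (fun S =>
      complete E.family (insert w C) (insert w P) = R ∧
      S = complete E.family (insert w C) Finset.univ ∧ source E.family S = some s ∧
        PrefixBefore E.family S s w C) σ) := by
  have := hE.bankSize_le_budget
  have := hE.bankSize_le_wordMax
  have := hE.two_le_bankSize
  have h9 := hE.card_add_two_le hP hPF
  refine Runs.le (Runs.seq <| runs_extendCore hE hσ hC hwC hCF fun τ hf hL => Runs.seq <|
    Runs.store (by simp) (by simp) ?_ (fun hb => hb.1 _) <| Runs.seq <|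
    Runs.assign (by simp) (fun _ => ?_) <| Runs.seq <| Runs.assign (by simp) (by simp) <|
    Runs.seq <| runs_grow (X := insert w C) (A := insert w P) hE (by simpa using hL) hwF (by simp)
    (Or.inr ⟨by simp, ?_⟩) ?_ ?_ fun ρ hρ hG =>
    Runs.seq (T₁ := budget E * 15) (T₂ := budget E * 46 + (1 + (budget E * 2900 + 1))) ?_) ?_
  · simp [hf.reg 9 (by simp)]; omega
  · simp [hf.reg 9 (by simp)]; omega
  · have h1 : τ.reg 1 = w.val := (hσ.of_frame hf (by simp) (by simp)).reg_one
    rw [← hf.mem 4 (by simp), ← hf.reg 9 (by simp)] at hP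
    simpa using hP.push hwP h1
  · simpa [hf.reg 0 (by simp)] using hσ.reg_zero
  · simp [hf.reg 9 (by simp)]; omega
  · have hfρ : Frame 9 4 σ ρ := ((((hf.mono (by simp) (by simp)).setCell (by simp)).setReg
      (by simp)).setReg (by simp)).trans (hρ.mono (by simp) (by simp))
    have h11ρ : ρ.reg 11 = n := by
      rw [hρ.reg 11 (by simp)]
      simpa [hf.reg 11 (by simp)] using h11
    simp [hf.reg 11 (by simp), h11] at hG
    have hS := hG.complete
    have hSF : complete E.family (insert w C) (insert w P) ∈ E.family :=
      complete_mem (by convert hwF)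
    have hSm := hE.card_add_two_le hS hSF
    have hσρ := hσ.of_frame hfρ (by simp) (by simp)
    have hRm := hE.card_add_two_le hσρ.listing_one hRF
    refine runs_copyBank hE hσρ.listing_one (by simp) (by simp) (by omega)
      fun π hr h9 hm ho hL => Runs.seq <| runs_sameSet hE
        (X := complete E.family (insert w C) (insert w P)) (A := R) ?_ hL ?_ ?_
        fun μ hμ h13 => Runs.branch (by simp) (fun h => ?_) fun h => ?_
    · rwa [hm 5 (by simp), hr 12 (by simp) (by simp)]
    · rw [hr 12 (by simp) (by simp)]
      omega
    · omega
    all_goals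
      have hfμ : Frame 9 4 σ μ := hfρ.trans ((Frame.of_copy hr hm ho (by simp) (by simp)
        (by simp)).trans (hμ.mono (by simp) (by simp)))
      have hσμ := hσ.of_frame hfμ (by simp) (by simp)
    · have hR : complete E.family (insert w C) (insert w P) = R := by
        by_contra hne
        simp [h13, hne] at h
      refine (runs_checkSource hE (C := C) hσμ ?_ hwC hCF hwF hsF ?_ ?_).mono ?_
      · rwa [hfμ.mem 2 (by simp), hfμ.reg 6 (by simp)]
      · rw [hμ.reg 11 (by simp), hr 11 (by simp) (by simp), h11ρ]
      · rw [hμ.reg 9 (by simp)]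
        omega
      · intro ν hν
        refine (hν.of_frame hfμ (by simp) (by simp)).congr fun S => ?_
        exact (and_iff_right hR).symm
    · refine Runs.skip (Or.inl ⟨hfμ.emitted (by simp) (by simp), ?_⟩)
      rintro _ ⟨hR, -⟩
      simp [h13, hR] at h
  · simp; omega

/-- Growth overwrites bank `5`, so `C` is first saved in bank `2`, from where the later checks take
it. -/
theorem runs_checkParent (hE : Suitable E) {P R C : Finset (Fin n)} {w s : Fin n}
    (hσ : Ready P R w s σ) (hC : Listing (σ.mem 5) (σ.reg 12) C) (hwC : w ∉ C)
    (hCF : C ∈ E.family) (hne : C.Nonempty) (hwF : insert w C ∈ E.family)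
    (hsF : {s} ∈ E.family) (hwP : w ∉ P) (hPF : P ∈ E.family) (hRF : R ∈ E.family)
    (h9 : σ.reg 9 ≤ E.bankSize) :
    Runs E checkParent σ (budget E * 5750) (Outcome (fun S =>
      complete E.family C Finset.univ = P ∧
      complete E.family (insert w C) (insert w P) = R ∧
      S = complete E.family (insert w C) Finset.univ ∧ source E.family S = some s ∧
        PrefixBefore E.family S s w C) σ) := by
  have := hE.bankSize_le_budget
  have := hE.bankSize_le_wordMax
  have := hE.two_le_bankSize
  have h12 := hE.card_add_two_le hC hCF
  refine Runs.le (Runs.seq <| runs_copyBank hE hC (by simp) (by simp) (by omega)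
    fun τ hr h6 hm ho hL => Runs.seq <|
    Runs.assign (by simp) (fun _ => by simp; omega) <| Runs.seq <|
    Runs.assign (by simp) (fun hb => hb.1 _) <|
    Runs.seq <| runs_grow (X := C) (A := Finset.univ) hE ?_ hCF hne
    (Or.inl ⟨by simp, rfl⟩) ?_ ?_ fun ρ hρ hG =>
    Runs.seq (T₁ := budget E * 15) (T₂ := budget E * 46 + (1 + (budget E * 4350 + 1))) ?_) ?_
  · simpa [hm 5 (by simp), hr 12 (by simp) (by simp)] using hC
  · simpa [hr 0 (by simp) (by simp)] using hσ.reg_zero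
  · simpa [hr 9 (by simp) (by simp)] using h9
  · have hfτ : Frame 6 2 σ τ := Frame.of_copy hr hm ho (by simp) (by simp) (by simp)
    have hfρ : Frame 6 2 σ ρ := ((hfτ.setReg (by simp)).setReg (by simp)).trans
      (hρ.mono (by simp) (by simp))
    have h0τ : τ.reg 0 = n := (hσ.of_frame hfτ (by simp) (by simp)).reg_zero
    simp [h0τ] at hG
    have hS := hG.complete
    have hSF : complete E.family C Finset.univ ∈ E.family := complete_mem hCF
    have hSm := hE.card_add_two_le hS hSF
    have hσρ := hσ.of_frame hfρ (by simp) (by simp)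
    have hPm := hE.card_add_two_le hσρ.listing_zero hPF
    refine runs_copyBank hE hσρ.listing_zero (by simp) (by simp) (by omega)
      fun π hr' h9' hm' ho' hL' => Runs.seq <| runs_sameSet hE
        (X := complete E.family C Finset.univ) (A := P) ?_ hL' ?_ ?_
        fun μ hμ h13 => Runs.branch (by simp) (fun h => ?_) fun h => ?_
    · rwa [hm' 5 (by simp), hr' 12 (by simp) (by simp)]
    · rw [hr' 12 (by simp) (by simp)]
      omega
    · omega
    all_goals
      have hfμ : Frame 6 2 σ μ := hfρ.trans ((Frame.of_copy hr' hm' ho' (by simp) (by simp)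
        (by simp)).trans (hμ.mono (by simp) (by simp)))
      have hσμ := hσ.of_frame hfμ (by simp) (by simp)
    · have hP : complete E.family C Finset.univ = P := by
        by_contra hne
        simp [h13, hne] at h
      refine (runs_checkRestr hE (C := C) hσμ ?_ hwC hCF hwF hsF ?_ hwP hPF hRF ?_).mono ?_
      · rw [hμ.mem 2 (by simp), hμ.reg 6 (by simp), hm' 2 (by simp), hr' 6 (by simp) (by simp),
          hρ.mem 2 (by simp), hρ.reg 6 (by simp)]
        simpa using hL
      · rw [hμ.reg 11 (by simp), hr' 11 (by simp) (by simp), hρ.reg 11 (by simp)]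
        simpa using h0τ
      · rwa [hμ.mem 4 (by simp), hμ.reg 9 (by simp)]
      · intro ν hν
        refine (hν.of_frame hfμ (by simp) (by simp)).congr fun S => ?_
        exact (and_iff_right hP).symm
    · refine Runs.skip (Or.inl ⟨hfμ.emitted (by simp) (by simp), ?_⟩)
      rintro _ ⟨hP, -⟩
      simp [h13, hP] at h
  · simp; omega

/-- If `{s}` is no solution, `s` is no source. If `complete({s}, R)` never chooses `w`, no child has
source `s`, by `IsChild.prefixBefore`. Otherwise `Commutable.isChild_iff` turns the checks into the
definition of a child. -/
theorem runs_trySource (hE : Suitable E) {P R : Finset (Fin n)} {w s : Fin n}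
    (hσ : Ready P R w s σ) (hwP : w ∉ P) (hPF : P ∈ E.family) (hRF : R ∈ E.family) :
    Runs E trySource σ (budget E * 7200) (Outcome (fun S =>
      IsChild E.family P w R S ∧ source E.family S = some s) σ) := by
  have := hE.bankSize_le_budget
  have := hE.testTime_le_budget
  have := hE.bankSize_le_wordMax
  have := hE.two_le_bankSize
  have h3 := hE.card_add_two_le hσ.listing_one hRF
  have hL5 := Listing.singleton (m := σ.mem 5) hσ.reg_five
  refine Runs.le (Runs.seq <| Runs.store (by simp) (by simp) (by simp; omega)
    (fun hb => hb.1 _) <| Runs.seq <| Runs.test (X := {s}) (by simp) (by simp; omega)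
    (by simpa using hL5) (by omega) <|
    Runs.branch (T₁ := budget E * 7080) (T₂ := 1) (by simp) (fun h => ?_) fun h => ?_) ?_
  · have hsF : {s} ∈ E.family := by simpa using h
    rw [if_pos hsF]
    have hL1 := hσ.listing_one
    have hf₀ : Frame 6 2 σ (((σ.setCell 5 0 (σ.reg 5)).setReg 21 1).setReg 12 1) :=
      ((Frame.rfl.setCell (by simp)).setReg (by simp)).setReg (by simp)
    refine Runs.le (Runs.seq <| Runs.assign (by simp) (fun _ => by simp; omega) <| Runs.seq <|
      runs_copyBank hE (by simpa using hL1) (by simp) (by simp) (by simp; omega)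
      fun τ hr h9 hm ho hL => Runs.seq <| Runs.assign (by simp) (by simp) <| Runs.seq <|
      Runs.assign (by simp) (fun hb => hb.1 _) <| Runs.seq <|
      runs_grow (X := {s}) (A := R) hE ?_ (by convert hsF) (by simp)
        (Or.inr ⟨by simp, by simpa using hL⟩) ?_ ?_ fun ρ hρ hG => Runs.branch
        (T₁ := budget E * 5750) (T₂ := 1) (by simp) (fun h => ?_) fun h => ?_) ?_
    · have h12 := hr 12 (by simp) (by simp)
      have h5 := hm 5 (by simp)
      simp at h12 h5
      simpa [h12, h5] using hL5
    · have h0 := hr 0 (by simp) (by simp)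
      simp at h0
      simpa [h0] using hσ.reg_zero
    · simp at h9 ⊢
      omega
    pick_goal 3
    · simp; omega
    all_goals
      have hfτ : Frame 6 2 σ τ := hf₀.trans
        (Frame.of_copy hr hm ho (by simp) (by simp) (by simp))
      have hf : Frame 6 2 σ ρ := ((hfτ.setReg (by simp)).setReg (by simp)).trans
        (hρ.mono (by simp) (by simp))
      have h1 : τ.reg 1 = w.val := (hσ.of_frame hfτ (by simp) (by simp)).reg_one
      simp [h1] at hG
      replace hG := hG.prefixBefore
    · rcases hG with ⟨h13, -⟩ | ⟨-, C, hC, hCL⟩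
      · exact absurd h13 (by simpa using h)
      have hC' := hC
      obtain ⟨k, hk, hw⟩ := hC
      obtain ⟨-, hwC, hwF⟩ := mem_ext.1 (mem_ext_of_choose hw)
      have hCF : C ∈ E.family := hk ▸ iterate_mem (by convert hsF) k
      have hne : C.Nonempty :=
        ⟨s, hk ▸ subset_iterate _ _ _ (Finset.mem_singleton_self s)⟩
      refine (runs_checkParent hE (C := C) (hσ.of_frame hf (by simp) (by simp)) hCL hwC hCF hne
        (by convert hwF) hsF hwP hPF hRF ?_).mono ?_
      · rw [hρ.reg 9 (by simp)]
        simp at h9 ⊢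
        omega
      · intro ν hν
        refine (hν.of_frame hf (by simp) (by simp)).congr fun S => ?_
        have := hE.commutable.isChild_iff (S := S) hwP hC'
        convert this.symm
    · rcases hG with ⟨-, hno⟩ | ⟨h13, -⟩
      · refine Runs.skip (Or.inl ⟨hf.emitted (by simp) (by simp), ?_⟩)
        rintro S ⟨hS, hs⟩
        obtain ⟨C, hC, -⟩ := hS.prefixBefore hE.commutable hs
        exact hno C hC
      · simp [h13] at h
  · have hsF : {s} ∉ E.family := by simpa using h
    refine Runs.skip (Or.inl ⟨Frame.emitted (a := 6) (k := 2) ?_ le_rfl le_rfl, ?_⟩)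
    · exact (Frame.rfl.setCell (by simp)).setReg (by simp)
    · rintro S ⟨-, hs⟩
      exact hsF (by convert (mem_source hs).2)
  · simp; omega

/-! ### The loop over the possible sources -/

theorem IsChild.source_mem {F : Finset (Finset (Fin n))} (hF : Commutable F)
    {P R S : Finset (Fin n)} {w : Fin n} (h : IsChild F P w R S) :
    ∃ s ∈ R, source F S = some s := by
  obtain ⟨s, -, hs, -⟩ := h.spec hF
  obtain ⟨C, ⟨k, rfl, -⟩, -, -, hR, -⟩ := h.prefixBefore hF hs
  refine ⟨s, ?_, hs⟩
  rw [← hR]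
  exact subset_complete _ _ (Finset.mem_insert_of_mem
    (subset_iterate _ _ _ (Finset.mem_singleton_self s)))

theorem encode_append (L : List (List (Fin n))) (l : List (Fin n)) :
    encode (L ++ [l]) = encode L ++ l.length :: l.map Fin.val := by
  simp [encode]

/-- After `k` rounds the output consists of the children whose source is among the first `k`
elements in the list of `R`. -/
theorem runs_listChildren (hE : Suitable E) {P R : Finset (Fin n)} {w : Fin n} (hwP : w ∉ P)
    (hPF : P ∈ E.family) (hRF : R ∈ E.family) (h0 : σ.reg 0 = n) (h1 : σ.reg 1 = w.val)
    (h4 : σ.reg 4 = 0) (hP : Listing (σ.mem 0) (σ.reg 2) P)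
    (hR : Listing (σ.mem 1) (σ.reg 3) R) (hout : σ.out = []) :
    Runs E listChildren σ (E.bankSize * (budget E * 7220)) fun τ => ∃ L,
      τ.out = encode L ∧ Enumerates L fun S => IsChild E.family P w R S := by
  have := hE.bankSize_le_budget
  have := hE.two_le_bankSize
  have := hE.bankSize_le_wordMax
  have h3 := hE.card_add_two_le hR hRF
  refine Runs.le (Runs.loop (fun k τ => (∀ i : Fin 24, i.val < 4 → τ.reg i = σ.reg i) ∧
    (∀ j : Fin 9, j.val < 2 → τ.mem j = σ.mem j) ∧ τ.reg 4 = k ∧ k ≤ σ.reg 3 ∧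
    ∃ L, τ.out = encode L ∧ Enumerates L fun S => IsChild E.family P w R S ∧
      ∃ j < k, ∃ s : Fin n, σ.mem 1 j = s.val ∧ source E.family S = some s)
    E.bankSize (budget E * 7200 + 8) ?_ ?_ ?_ ?_) ?_
  · exact ⟨fun _ _ => rfl, fun _ _ => rfl, h4, Nat.zero_le _, [], by simp [hout, encode],
      by simp, by simp, by simp⟩
  · intro k τ _
    simp
  · rintro k τ ⟨hr, hm, h4, hk, L, hL, hLn, hLd, hLS⟩ hb hlt
    simp [h4, hr 3 (by simp)] at hlt
    obtain ⟨s, hsR, hs⟩ := hR.exists_mem hlt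
    refine ⟨by omega, Runs.le (Runs.seq <| Runs.assign (by simp; omega) (fun hb => hb.2 _ _) <|
      Runs.seq <| Runs.mono (Q' := Outcome _ _) (runs_trySource (P := P) (R := R) (w := w)
        (s := s) hE ⟨?_, ?_, ?_, ?_, ?_⟩ hwP hPF hRF)
        fun ρ hρ => Runs.assign (by simp) (fun hb => ?_) ?_) ?_⟩
    · simpa [hr 0 (by simp)] using h0
    · simpa [hr 1 (by simp)] using h1
    · simp [h4, hm 1 (by simp), hs]
    · simpa [hr 2 (by simp), hm 0 (by simp)] using hP
    · simpa [hr 3 (by simp), hm 1 (by simp)] using hR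
    · have h4ρ : ρ.reg 4 = k := by
        rcases hρ with ⟨h, -⟩ | ⟨l, -, -, h⟩ <;> rw [h.reg 4 (by simp)] <;> simpa using h4
      simp [h4ρ]; omega
    · have key : ∀ v, Emitted (τ.setReg 5 (τ.mem 1 (τ.reg 4))) ρ v →
          (∀ i : Fin 24, i.val < 4 → (ρ.setReg 4 (ρ.reg 4 + 1)).reg i = σ.reg i) ∧
          (∀ j : Fin 9, j.val < 2 → (ρ.setReg 4 (ρ.reg 4 + 1)).mem j = σ.mem j) ∧
          (ρ.setReg 4 (ρ.reg 4 + 1)).reg 4 = k + 1 ∧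
          (ρ.setReg 4 (ρ.reg 4 + 1)).out = encode L ++ v := by
        intro v h
        refine ⟨fun i hi => ?_, fun j hj => ?_, ?_, ?_⟩
        · have h4' : i ≠ 4 := by rintro rfl; simp at hi
          have h5' : i ≠ 5 := by rintro rfl; simp at hi
          rw [← hr i hi]
          simp [h4', h.reg i (by omega), h5']
        · rw [← hm j hj]
          simp [h.mem j hj]
        · simp [h.reg 4 (by simp), h4]
        · simp [h.out, hL]
      have hsucc : ∀ S, (∃ j < k + 1, ∃ s : Fin n, σ.mem 1 j = s.val ∧
          source E.family S = some s) ↔ (∃ j < k, ∃ s : Fin n, σ.mem 1 j = s.val ∧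
          source E.family S = some s) ∨ source E.family S = some s := by
        intro S
        constructor
        · rintro ⟨j, hj, s', hjs, hS⟩
          rcases Nat.lt_succ_iff_lt_or_eq.1 hj with hj | rfl
          · exact Or.inl ⟨j, hj, s', hjs, hS⟩
          · obtain rfl := Fin.ext (hs.symm.trans hjs)
            exact Or.inr hS
        · rintro (⟨j, hj, h⟩ | h)
          · exact ⟨j, by omega, h⟩
          · exact ⟨k, by omega, s, hs, h⟩
      rcases hρ with ⟨h, hno⟩ | ⟨l, hl, ⟨hlS, hls⟩, h⟩
      · obtain ⟨h₁, h₂, h₃, h₄⟩ := key _ h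
        refine ⟨h₁, h₂, h₃, hlt, L, by simpa using h₄, hLn, hLd, fun S => ?_⟩
        rw [hLS]
        beta_reduce
        rw [hsucc]
        have : ¬ (IsChild E.family P w R S ∧ source E.family S = some s) := hno S
        rw [and_or_left]
        exact (or_iff_left this).symm
      · obtain ⟨h₁, h₂, h₃, h₄⟩ := key _ h
        -- Sets listed before have their source at an earlier position of `R`; the source of a set
        -- is unique, and `R` is listed without repetitions.
        have hnew : l.toFinset ∉ L.map List.toFinset := by
          rw [hLS]
          rintro ⟨-, j, hj, s', hjs, hS⟩
          obtain rfl := Option.some.inj (hls.symm.trans hS)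
          have := hR.inj (hj.trans hlt) hlt (hjs.trans hs.symm)
          omega
        refine ⟨h₁, h₂, h₃, hlt, L ++ [l], by rw [encode_append]; exact h₄, ?_, ?_, fun S => ?_⟩
        · intro l' hl'
          rcases List.mem_append.1 hl' with h | h
          · exact hLn l' h
          · rwa [List.mem_singleton.1 h]
        · rw [List.map_append, List.nodup_append]
          refine ⟨hLd, by simp, ?_⟩
          rintro a ha b hb rfl
          simp only [List.map_cons, List.map_nil, List.mem_singleton] at hb
          exact hnew (hb ▸ ha)
        · rw [List.map_append, List.mem_append, hLS]
          beta_reduce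
          rw [hsucc]
          simp only [List.map_cons, List.map_nil, List.mem_singleton]
          constructor
          · rintro (⟨hS, h⟩ | rfl)
            · exact ⟨hS, Or.inl h⟩
            · exact ⟨hlS, Or.inr hls⟩
          · rintro ⟨hS, h | h⟩
            · exact Or.inl ⟨hS, h⟩
            · right
              -- Two children with the same source have the same core, hence the same completion
              -- after adding `w`.
              obtain ⟨C, hC, -, -, -, hSC⟩ := hS.prefixBefore hE.commutable h
              obtain ⟨D, hD, -, -, -, hlD⟩ := hlS.prefixBefore hE.commutable hls
              rw [← hSC, ← hlD, hC.unique hD]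
    · simp; omega
  · rintro k τ ⟨hr, hm, h4, hk, L, hL, hLn, hLd, hLS⟩ hge
    simp [h4, hr 3 (by simp)] at hge
    obtain rfl := le_antisymm hk hge
    refine ⟨L, hL, hLn, hLd, fun S => ?_⟩
    rw [hLS, and_iff_left_iff_imp]
    intro hS
    -- The source belongs to the core, which is contained in `R`, so scanning `R` misses no child.
    obtain ⟨s, hsR, hs⟩ := hS.source_mem hE.commutable
    obtain ⟨j, hj, hjs⟩ := hR.mem_iff.1 hsR
    exact ⟨j, hj, s, hjs, hs⟩
  · simp
    have : E.bankSize * 2 ≤ E.bankSize * budget E := by gcongr; omega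
    nlinarith

/-! ### The input state and the size parameters -/

theorem listing_input (p : List (Fin n)) (hp : p.Nodup) :
    Listing (fun j => (p.map Fin.val).getD j 0) p.length p.toFinset := by
  refine ⟨p, hp, rfl, List.ext_getElem (by simp) fun i h _ => ?_⟩
  simp at h
  simp [h]

theorem getD_map_val_le (p : List (Fin n)) (j : ℕ) : (p.map Fin.val).getD j 0 ≤ n := by
  rw [List.getD_eq_getElem?_getD]
  rcases h : (p.map Fin.val)[j]? with _ | v
  · simp
  · obtain ⟨x, -, rfl⟩ := List.mem_map.1 (List.mem_of_getElem? h)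
    simp

theorem length_le_of_nodup {p : List (Fin n)} (hp : p.Nodup) : p.length ≤ n := by
  simpa [List.toFinset_card_of_nodup hp] using Finset.card_le_univ p.toFinset

theorem bounded_inputState {N : ℕ} (hN : n ≤ N) {w : Fin n} {p l : List (Fin n)}
    (hp : p.Nodup) (hl : l.Nodup) : (inputState 24 9 w p l).Bounded N := by
  have := length_le_of_nodup hp
  have := length_le_of_nodup hl
  constructor
  · intro i
    simp only [inputState]
    split <;> omega
  · intro k a
    simp only [inputState]
    split
    · exact (getD_map_val_le p a).trans hN
    · exact (getD_map_val_le l a).trans hN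
    · exact Nat.zero_le _

theorem maxSize_le (F : Finset (Finset (Fin n))) : maxSize F ≤ n :=
  Finset.sup_le fun X _ => by simpa using Finset.card_le_univ X

theorem card_le_maxSize {F : Finset (Finset (Fin n))} {X : Finset (Fin n)} (hX : X ∈ F) :
    X.card ≤ maxSize F := Finset.le_sup (f := Finset.card) hX

/-- If all solutions were empty, `R` and `P` would coincide. Positivity of `q` absorbs additive
constants and forces the space bound of the test to be positive. -/
theorem maxSize_pos {F : Finset (Finset (Fin n))} {P R : Finset (Fin n)} {w : Fin n}
    (hP : IsMaximalSolution F P) (hR : IsRestrSolution F P w R) : 0 < maxSize F := by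
  by_contra h
  have hempty : ∀ X ∈ F, X = ∅ := fun X hX =>
    Finset.card_eq_zero.1 (by have := card_le_maxSize hX; omega)
  exact hR.2 ((hempty R hR.1.prop.1).trans (hempty P hP.prop).symm)

end MaxEnum

theorem mainTheorem3 :
    ∃ (r b : ℕ) (prog : MaxEnum.Prog r b) (K : ℕ), ∀ c : ℕ, ∃ K' : ℕ,
      ∀ (n : ℕ) (F : Finset (Finset (Fin n))), MaxEnum.Commutable F →
      ∀ GT GS : ℕ, 0 < GT → MaxEnum.maxSize F ≤ c * GS →
      ∀ (P R : Finset (Fin n)) (w : Fin n),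
        MaxEnum.IsMaximalSolution F P → w ∉ P → MaxEnum.IsRestrSolution F P w R →
      ∀ p l : List (Fin n), p.Nodup → p.toFinset = P → l.Nodup → l.toFinset = R →
      ∃ (m t : ℕ) (σ : MaxEnum.State r b) (L : List (List (Fin n))),
        MaxEnum.Exec ⟨F, GT, m, K * n⟩ prog (MaxEnum.inputState r b w p l) σ t ∧
        σ.out = MaxEnum.encode L ∧
        MaxEnum.Enumerates L (fun S => MaxEnum.IsMaximalSolution F S ∧
          MaxEnum.parent F S = some P ∧ MaxEnum.pi F S = some w ∧
          MaxEnum.restrOf F S = some R) ∧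
        t ≤ K * (MaxEnum.maxSize F ^ 3 * n * GT) ∧
        r + b * m + GS ≤ K' * GS := by
  -- The time constant is `27 · 7220`, with `27` from `(q + 2)³ ≤ (3q)³`. The space constant is `9c`
  -- for the banks plus `24 + 9 · 2 + 1` for the registers, the surplus cells and the test itself.
  refine ⟨24, 9, MaxEnum.listChildren, 194940, fun c => ⟨9 * c + 43, ?_⟩⟩
  intro n F hF GT GS hGT hGS P R w hP hwP hR p l hp hpP hl hlR
  have hq := MaxEnum.maxSize_pos hP hR
  have hqn := MaxEnum.maxSize_le F
  have hGSpos : 0 < GS := by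
    rcases Nat.eq_zero_or_pos GS with rfl | h
    · omega
    · exact h
  -- Banks get `q + 2` cells, which is at most `3n` because `0 < q ≤ n`.
  have hE : MaxEnum.Suitable (n := n) ⟨F, GT, MaxEnum.maxSize F + 2, 194940 * n⟩ := by
    refine ⟨hF, fun X hX => ?_, ?_, ?_, hGT⟩
    · exact Nat.add_le_add_right (MaxEnum.card_le_maxSize hX) 2
    · simp only
      omega
    · simp only
      omega
  subst hpP hlR
  obtain ⟨τ, t, hexec, ht, L, hout, hL⟩ := MaxEnum.runs_listChildren
    (σ := MaxEnum.inputState 24 9 w p l) hE hwP hP.prop hR.1.prop.1 rfl rfl rfl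
    (MaxEnum.listing_input p hp) (MaxEnum.listing_input l hl) rfl
    (MaxEnum.bounded_inputState (by simp only; omega) hp hl)
  refine ⟨MaxEnum.maxSize F + 2, t, τ, L, hexec, hout, hL, ht.trans ?_, ?_⟩
  · simp only [MaxEnum.budget]
    generalize MaxEnum.maxSize F = q at *
    calc (q + 2) * (n * (q + 2) ^ 2 * GT * 7220) = (q + 2) ^ 3 * n * GT * 7220 := by ring
      _ ≤ (3 * q) ^ 3 * n * GT * 7220 := by gcongr; omega
      _ = 194940 * (q ^ 3 * n * GT) := by ring
  · have : 24 + 9 * (MaxEnum.maxSize F + 2) + GS ≤ 9 * (c * GS) + 43 * GS := by omega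
    calc _ ≤ _ := this
      _ = _ := by ring
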